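/- **Corrected Lasso.** *Model.* Let $n,p\ge 1$, $s\ge 0$, and let $(x_i,\varsigma_i,\xi_i)$, $i=1,\dots,n$, be i.i.d., with $x_i,\varsigma_i,\xi_i$ mutually independent, $x_i\sim N(0,\Sigma)$ in $\mathbb R^p$, $\varsigma_i\in\mathbb R^p$ centred sub-Gaussian with covariance $\Sigma_\varsigma=\gamma_\varsigma I$, and $\xi_i\in\mathbb R$ centred sub-Gaussian with variance $\sigma^2$. The sub-Gaussian variance proxies are at most $K$ times the variances, for some fixed $K\ge 1$: $\mathbb E e^{u^T\varsigma_i}\le e^{K\gamma_\varsigma\|u\|_2^2/2}$ for $u\in\mathbb R^p$ and $\mathbb E e^{r\xi_i}\le e^{K\sigma^2r^2/2}$ for $r\in\mathbb R$. One observes $z_i=x_i+\varsigma_i$ and $y_i=x_i^Tw^*+\xi_i$, where $w^*$ has at most $s$ nonzero entries and $\|w^*\|_1\le\rho$, $\rho>0$. Let $\sigma_{\min},\sigma_{\max}$ be the extreme eigenvalues of $\Sigma$. *Problem.* With $f_i(w)=\frac12(y_i-w^Tz_i)^2$ and $\Omega=\{w:\|w\|_1\le\rho\}$, let $\hat w$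 be a global minimizer over $\Omega$ of $$F(w)=\frac1n\sum_{i=1}^n f_i(w)-\frac{\gamma_\varsigma}2\|w\|_2^2+\lambda\|w\|_1 .$$ *Algorithm.* Let $L_1,\dots,L_n$ be such that $f_i$ is $L_i$-smooth, $\bar L=\frac1n\sum_{i=1}^n L_i$, and put $N=n+1$, $\phi_i=\frac{N}{n}f_i$ and $\tilde L_i=\frac Nn L_i$ for $i\le n$, $\phi_{N}(w)=-\frac{(\tilde\lambda+\gamma_\varsigma)N}{2}\|w\|_2^2$, $\tilde L_{N}=(\tilde\lambda+\gamma_\varsigma)N$, $\tilde L=\frac1N\sum_i\tilde L_i$, $\tilde g(w)=\frac12\|w\|_2^2+\frac\lambda{\tilde\lambda}\|w\|_1$, $q_i=\frac{\tilde L_i+\tilde L}{2N\tilde L}$, $\eta_i=\frac{\eta}{q_iN}$. SDCA starts at arbitrary $a_1^0,\dots,a_N^0\in\mathbb R^p$, $v^0=\frac1{\tilde\lambda N}\sum_i a_i^0$; at step $t\ge1$ it draws $i$ (independently of the past) from the distribution $(q_1,\dots,q_N)$ and sets $a_i^t=a_i^{t-1}-\eta_i\tilde\lambda N(\nabla\phi_i(w^{t-1})+a_i^{t-1})$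 (the other $a_j$ are unchanged) and $v^t=v^{t-1}-\eta_i(\nabla\phi_i(w^{t-1})+a_i^{t-1})$; always $w^t=\arg\max_{w\in\Omega}\langle w,v^t\rangle-\tilde g(w)$. *Potential.* Let $\tilde g^*(v)=\max_{w\in\Omega}\langle w,v\rangle-\tilde g(w)$, let $\hat v$ satisfy $\tilde g(\hat w)+\tilde g^*(\hat v)=\langle\hat w,\hat v\rangle$, let $\hat a_j=-\nabla\phi_j(\hat w)$ and $$A_t=\sum_{j=1}^{N}\tfrac1{q_j}\|a_j^t-\hat a_j\|_2^2,\quad B_t=2\big(\tilde g^*(v^t)-\langle\nabla\tilde g^*(\hat v),v^t-\hat v\rangle-\tilde g^*(\hat v)\big),\quad C_t=\tfrac{\eta}{N^2}A_t+\tfrac{\tilde\lambda}2B_t .$$ *Claim.* For every $K\ge1$ there are constants $c_0,\dots,c_7>0$, depending only on $K$, such that the following holds. Put $M=\sigma_{\min}\max\big(\big(\tfrac{\sigma_{\max}+\gamma_\varsigma}{\sigma_{\min}}\big)^2,1\big)$, $\varphi=(\sqrt{\sigma_{\max}}+\sqrt{\gamma_\varsigma})(\sigma+\sqrt{\gamma_\varsigma}\|w^*\|_2)$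 and $\tilde\kappa=\frac12\sigma_{\min}-c_2M\frac{s\log p}n-\gamma_\varsigma$. Suppose $$\lambda\ge\max\Big\{c_0\,\rho\, M\frac{\log p}n,\;c_1\varphi\sqrt{\tfrac{\log p}n}\Big\},\qquad 0<\tilde\lambda\le\tilde\kappa-\gamma_\varsigma .$$ Then, with probability at least $$1-c_3\exp\Big(-c_4n\min\Big(\frac{\sigma_{\min}^2}{(\sigma_{\max}+\gamma_\varsigma)^2},1\Big)\Big)-c_5\exp(-c_6\log p)$$ over the data, SDCA with any step size $0<\eta\le\min\{\frac1{16(\tilde\lambda+\bar L)},\frac1{4\tilde\lambda(n+1)}\}$ satisfies $$\mathbb E(C_t)\le(1-\eta\tilde\lambda)^tC_0\quad\text{until}\quad F(w^t)-F(\hat w)\le\delta,\qquad \delta=c_7M\frac{s\log p}n\|\hat w-w^*\|_2^2 ,$$ where $\mathbb E$ is over the sampling of the algorithm. Here "until" holds both path by path, i.e. $\mathbb E\big(C_t\mathbf 1\{F(w^k)-F(\hat w)>\delta\ \forall k<t\}\big)\le(1-\eta\tilde\lambda)^tC_0$ for all $t\ge 0$, and in mean, i.e. $\mathbb E(C_t)\le(1-\eta\tilde\lambda)^tC_0$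 whenever $\mathbb E F(w^k)-F(\hat w)>\delta$ for all $k<t$. -/

import Mathlib

open MeasureTheory ProbabilityTheory
open scoped NNReal RealInnerProductSpace

namespace CorrectedLasso

/-- `ℝ^p` with the Euclidean norm. -/
abbrev Vec (p : ℕ) : Type := EuclideanSpace ℝ (Fin p)

/-- The `ℓ₁` norm. -/
def l1Norm {p : ℕ} (w : Vec p) : ℝ := ∑ j, |w j|

/-- `w` has at most `s` nonzero coordinates. -/
def IsSparse {p : ℕ} (s : ℕ) (w : Vec p) : Prop := {j : Fin p | w j ≠ 0}.ncard ≤ s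

/-- `f` is `L`-smooth: differentiable with an `L`-Lipschitz gradient. -/
def IsSmooth {p : ℕ} (f : Vec p → ℝ) (L : ℝ) : Prop :=
  Differentiable ℝ f ∧ ∀ w w' : Vec p, ‖gradient f w - gradient f w'‖ ≤ L * ‖w - w'‖

/-- A maximizer of `h` over `Ω` (an arbitrary one; unique for strictly concave `h`). -/
noncomputable def argmaxOn {p : ℕ} (Ω : Set (Vec p)) (h : Vec p → ℝ) : Vec p :=
  Classical.epsilon (fun w => w ∈ Ω ∧ IsMaxOn h Ω w)

/-- The conjugate of `g` over `Ω`: `g*(v) = max_{w ∈ Ω} ⟨w, v⟩ - g(w)`. -/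
noncomputable def conj {p : ℕ} (Ω : Set (Vec p)) (g : Vec p → ℝ) (v : Vec p) : ℝ :=
  sSup ((fun w => ⟪w, v⟫ - g w) '' Ω)

/-! ### The generalized dual free SDCA algorithm -/

/-- The input of SDCA on `min_{w ∈ Ω} (1/N) ∑ i, φ i w + lam * g w`: the component functions, their
smoothness parameters, the regularizer with its weight, the feasible set and the step size. -/
structure SDCA (N p : ℕ) where
  φ : Fin N → Vec p → ℝ
  L : Fin N → ℝ
  g : Vec p → ℝ
  Ω : Set (Vec p)
  lam : ℝ
  η : ℝ

/-- The iterates `(a₁, …, a_N)`, `v`, `w`. -/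
structure State (N p : ℕ) where
  a : Fin N → Vec p
  v : Vec p
  w : Vec p

namespace SDCA

variable {N p : ℕ} (𝒜 : SDCA N p)

/-- The average smoothness parameter. -/
noncomputable def Lbar : ℝ := (∑ i, 𝒜.L i) / N

/-- The sampling distribution `q i = (L i + Lbar) / (2 N Lbar)`. -/
noncomputable def q (i : Fin N) : ℝ := (𝒜.L i + 𝒜.Lbar) / (2 * N * 𝒜.Lbar)

/-- The proximal step `argmax_{w ∈ Ω} ⟨w, v⟩ - g w`. -/
noncomputable def prox (v : Vec p) : Vec p := argmaxOn 𝒜.Ω (fun w => ⟪w, v⟫ - 𝒜.g w)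

/-- Initialization at given pseudo-dual variables. -/
noncomputable def init (a₀ : Fin N → Vec p) : State N p where
  a := a₀
  v := (1 / (𝒜.lam * N)) • ∑ i, a₀ i
  w := 𝒜.prox ((1 / (𝒜.lam * N)) • ∑ i, a₀ i)

/-- The individual step size `η i = η / (q i N)`. -/
noncomputable def stepSize (i : Fin N) : ℝ := 𝒜.η / (𝒜.q i * N)

/-- The update of `v` when coordinate `i` is picked. -/
noncomputable def nextV (x : State N p) (i : Fin N) : Vec p :=
  x.v - 𝒜.stepSize i • (gradient (𝒜.φ i) x.w + x.a i)

/-- One iteration, when coordinate `i` is picked. -/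
noncomputable def step (x : State N p) (i : Fin N) : State N p where
  a := Function.update x.a i
    (x.a i - (𝒜.stepSize i * 𝒜.lam * N) • (gradient (𝒜.φ i) x.w + x.a i))
  v := 𝒜.nextV x i
  w := 𝒜.prox (𝒜.nextV x i)

/-- The state after `t` iterations, in which the coordinates `I 0, …, I (t - 1)` were picked. -/
noncomputable def run (a₀ : Fin N → Vec p) : (t : ℕ) → (Fin t → Fin N) → State N p
  | 0, _ => 𝒜.init a₀
  | t + 1, I => 𝒜.step (run a₀ t (fun k => I k.castSucc)) (I (Fin.last t))

/-- The state after the first `k ≤ t` of `t` iterations. -/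
noncomputable def runTake (a₀ : Fin N → Vec p) {t : ℕ} (k : ℕ) (hk : k ≤ t)
    (I : Fin t → Fin N) : State N p :=
  𝒜.run a₀ k (fun l => I (Fin.castLE hk l))

/-- Expectation of a function of the first `t` picks, which are independent with law `q`. -/
noncomputable def expect (t : ℕ) (h : (Fin t → Fin N) → ℝ) : ℝ :=
  ∑ I : Fin t → Fin N, (∏ k, 𝒜.q (I k)) * h I

/-- The potential `A = ∑ j, (1 / q j) ‖a j - â j‖²` with `â j = -∇ φ j (ŵ)`. -/
noncomputable def potA (what : Vec p) (x : State N p) : ℝ :=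
  ∑ j, (1 / 𝒜.q j) * ‖x.a j - (-gradient (𝒜.φ j) what)‖ ^ 2

/-- The potential `B = 2 (g*(v) - ⟨∇ g*(v̂), v - v̂⟩ - g*(v̂))`. -/
noncomputable def potB (vhat : Vec p) (x : State N p) : ℝ :=
  2 * (conj 𝒜.Ω 𝒜.g x.v - ⟪gradient (conj 𝒜.Ω 𝒜.g) vhat, x.v - vhat⟫ - conj 𝒜.Ω 𝒜.g vhat)

/-- The potential `C = (η / N²) A + (lam / 2) B`. -/
noncomputable def potC (what vhat : Vec p) (x : State N p) : ℝ :=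
  𝒜.η / (N : ℝ) ^ 2 * 𝒜.potA what x + 𝒜.lam / 2 * 𝒜.potB vhat x

end SDCA

/-! ### The corrected Lasso -/

/-- The loss `f_i(w) = (1/2) (y_i - ⟨w, z_i⟩)²` of one sample. -/
noncomputable def loss {p : ℕ} (z : Vec p) (y : ℝ) (w : Vec p) : ℝ := (1 / 2) * (y - ⟪w, z⟫) ^ 2

/-- The objective
`F(w) = (1/n) ∑ i, f_i(w) - (1/2) wᵀ (γ I) w + lam ‖w‖₁`. -/
noncomputable def objective {n p : ℕ} (z : Fin n → Vec p) (y : Fin n → ℝ) (γ lam : ℝ)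
    (w : Vec p) : ℝ :=
  (1 / n) * ∑ i, loss (z i) (y i) w - γ / 2 * ‖w‖ ^ 2 + lam * l1Norm w

/-- The feasible set `‖w‖₁ ≤ ρ`. -/
def feasible (p : ℕ) (ρ : ℝ) : Set (Vec p) := {w | l1Norm w ≤ ρ}

/-- SDCA for the corrected Lasso: the `n + 1` functions `φ_i = ((n+1)/n) f_i` for `i ≤ n` and
`φ_{n+1} = -((lam' + γ)(n+1)/2) ‖·‖²`, with the corresponding smoothness parameters, and the
strongly convex regularizer `g = (1/2) ‖·‖² + (lam/lam') ‖·‖₁` with weight `lam'`. -/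
noncomputable def sdca {n p : ℕ} (z : Fin n → Vec p) (y : Fin n → ℝ) (γ ρ lam lam' : ℝ)
    (L : Fin n → ℝ) (η : ℝ) : SDCA (n + 1) p where
  φ := Fin.snoc (α := fun _ => Vec p → ℝ) (fun i w => ((n + 1 : ℝ) / n) * loss (z i) (y i) w)
    (fun w => -((lam' + γ) * (n + 1) / 2) * ‖w‖ ^ 2)
  L := Fin.snoc (α := fun _ => ℝ) (fun i => ((n + 1 : ℝ) / n) * L i) ((lam' + γ) * (n + 1))
  g := fun w => (1 / 2) * ‖w‖ ^ 2 + lam / lam' * l1Norm w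
  Ω := feasible p ρ
  lam := lam'
  η := η

/-! ### The statistical model -/

/-- The smallest eigenvalue of a symmetric matrix. -/
noncomputable def sigmaMin {p : ℕ} {S : Matrix (Fin p) (Fin p) ℝ} (hS : S.PosSemidef) : ℝ :=
  ⨅ i, hS.isHermitian.eigenvalues i

/-- The largest eigenvalue of a symmetric matrix. -/
noncomputable def sigmaMax {p : ℕ} {S : Matrix (Fin p) (Fin p) ℝ} (hS : S.PosSemidef) : ℝ :=
  ⨆ i, hS.isHermitian.eigenvalues i

/-- `(x_i, ς_i, ξ_i)`, `i < n`, are i.i.d.; the covariate `x_i`, its corruption `ς_i` and the noise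
`ξ_i` are independent of each other; `x_i ∼ N(0, S)`; `ς_i` is centred with covariance `γ I`, `ξ_i`
is centred with variance `σ²`; and `ς_i`, `ξ_i` are sub-Gaussian, with variance proxies at most `K`
times the variances. -/
structure AdditiveNoiseModel {Ω : Type*} [MeasurableSpace Ω] (P : Measure Ω) {n p : ℕ} (K : ℝ≥0)
    (S : Matrix (Fin p) (Fin p) ℝ) (γ σ : ℝ≥0)
    (x ς : Fin n → Ω → Vec p) (ξ : Fin n → Ω → ℝ) : Prop where
  measurable_x : ∀ i, Measurable (x i)
  measurable_ς : ∀ i, Measurable (ς i)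
  measurable_ξ : ∀ i, Measurable (ξ i)
  indep_samples : iIndepFun (fun i ω => (x i ω, ς i ω, ξ i ω)) P
  identDistrib : ∀ i j, IdentDistrib (fun ω => (x i ω, ς i ω, ξ i ω))
    (fun ω => (x j ω, ς j ω, ξ j ω)) P P
  indep_x : ∀ i, IndepFun (x i) (fun ω => (ς i ω, ξ i ω)) P
  indep_ς_ξ : ∀ i, IndepFun (ς i) (ξ i) P
  gaussian_x : ∀ i, P.map (x i) = multivariateGaussian 0 S
  mean_ς : ∀ i j, ∫ ω, ς i ω j ∂P = 0
  cov_ς : ∀ i j k, covariance (fun ω => ς i ω j) (fun ω => ς i ω k) P = if j = k then (γ : ℝ) else 0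
  subgaussian_ς : ∀ i (u : Vec p), HasSubgaussianMGF (fun ω => ⟪u, ς i ω⟫) (K * γ * ‖u‖₊ ^ 2) P
  mean_ξ : ∀ i, ∫ ω, ξ i ω ∂P = 0
  var_ξ : ∀ i, variance (ξ i) P = (σ : ℝ) ^ 2
  subgaussian_ξ : ∀ i, HasSubgaussianMGF (ξ i) (K * σ ^ 2) P

/-- The observed covariates `z_i = x_i + ς_i`. -/
def obsZ {Ω : Type*} {n p : ℕ} (x ς : Fin n → Ω → Vec p) (ω : Ω) (i : Fin n) : Vec p :=
  x i ω + ς i ω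

/-- The responses `y_i = ⟨x_i, w*⟩ + ξ_i`. -/
noncomputable def obsY {Ω : Type*} {n p : ℕ} (x : Fin n → Ω → Vec p) (ξ : Fin n → Ω → ℝ)
    (wstar : Vec p) (ω : Ω) (i : Fin n) : ℝ :=
  ⟪x i ω, wstar⟫ + ξ i ω

/-- `σ_min max(((σ_max + γ)/σ_min)², 1)`. -/
noncomputable def curvature (σmin σmax γ : ℝ) : ℝ :=
  σmin * max (((σmax + γ) / σmin) ^ 2) 1

/-- `φ = (√σ_max + √γ)(σ + √γ ‖w*‖)`. -/
noncomputable def noiseLevel (σmax γ σ normw : ℝ) : ℝ :=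
  (√σmax + √γ) * (σ + √γ * normw)

/-- `κ = σ_min/2 - c₂ σ_min max(((σ_max + γ)/σ_min)², 1) (s log p)/n - γ`. -/
noncomputable def kappaTilde (c₂ σmin σmax γ : ℝ) (s n p : ℕ) : ℝ :=
  (1 / 2) * σmin - c₂ * curvature σmin σmax γ * (s * Real.log p / n) - γ

/-- The tolerance `δ = c₇ σ_min max(((σ_max + γ)/σ_min)², 1) (s log p)/n ‖ŵ - w*‖²`. -/
noncomputable def tolerance {p : ℕ} (c₇ σmin σmax γ : ℝ) (s n : ℕ) (what wstar : Vec p) : ℝ :=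
  c₇ * curvature σmin σmax γ * (s * Real.log p / n) * ‖what - wstar‖ ^ 2

end CorrectedLasso

namespace CorrectedLasso

/-! ### The conjugate of a strongly convex function over a compact set -/

section Conjugate

variable {p : ℕ} {Ω : Set (Vec p)} {g : Vec p → ℝ}

/-! The argument splits into a deterministic analysis of SDCA on a good sample and a proof that good
samples are likely.

Algorithm. The conjugate of a 1-strongly convex function is 1-smooth, with the proximal point as
gradient. Expanding both potentials over one random pick, the terms `‖∇φ_i(w) + a_i‖²` from `A` and
`B` cancel, and `sum_q_potC_step` gives contraction by `1 - ηλ̃` up to an error: gradient variance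
minus first-order progress. No convexity of the `φ_i` is used. If progress beats variance by a
multiple of `F(w) - F(ŵ) - δ` (`GapCondition`), the potential contracts while the gap exceeds `δ`,
both path by path and in mean.

Geometry. The concave last component cancels the strong convexity lent to the regularizer, so the
progress is exactly `F(w) - F(ŵ)` plus half the curvature form at `w - ŵ`, minus `λ̃‖w - ŵ‖²/2`. The
form may be indefinite, but on a `GoodSample` it is bounded below up to `τ‖·‖₁²`. Any feasible point
is close in `ℓ₁` to a cone around the support of `w*`, with an error controlled by its objective
gap, so `τ‖w - ŵ‖₁²` is absorbed by the curvature, a fraction of the gap, and a multiple of `τ s ‖ŵ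
- w*‖²`. This last term is the tolerance (`GoodSample.le_gram_sub`, `gapCondition_sdca`).

Probability. Products of sub-Gaussian variables satisfy a Bernstein bound
(`measure_abs_sum_mul_sub_gt_le`). It controls the gradient at `w*`, and the empirical quadratic
form at all sums of `k` signed basis vectors by a union bound. Maurey's averaging carries the latter
to every vector at the price `σ_min ‖v‖₁²/(k - 1)`; taking `k` of order `n/log p` yields the
restricted eigenvalue condition. When `log p > n`, Bernstein fails at the required scale, but then
the hypotheses force `w* = 0` and a self-normalized bound takes over. -/

theorem argmaxOn_spec (hΩ : IsCompact Ω) (hne : Ω.Nonempty) {h : Vec p → ℝ} (hh : Continuous h) :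
    argmaxOn Ω h ∈ Ω ∧ IsMaxOn h Ω (argmaxOn Ω h) := by
  obtain ⟨w, hw, hmax⟩ := hΩ.exists_isMaxOn hne hh.continuousOn
  exact Classical.epsilon_spec (p := fun w => w ∈ Ω ∧ IsMaxOn h Ω w) ⟨w, hw, hmax⟩

theorem conj_eq_of_isMaxOn {v w : Vec p} (hw : w ∈ Ω) (hmax : IsMaxOn (fun u => ⟪u, v⟫ - g u) Ω w) :
    conj Ω g v = ⟪w, v⟫ - g w := by
  apply IsGreatest.csSup_eq
  exact ⟨⟨w, hw, rfl⟩, by rintro _ ⟨u, hu, rfl⟩; exact hmax hu⟩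

theorem le_conj (hΩ : IsCompact Ω) (hg : Continuous g) {w : Vec p} (hw : w ∈ Ω) (v : Vec p) :
    ⟪w, v⟫ - g w ≤ conj Ω g v := by
  refine le_csSup ?_ ⟨w, hw, rfl⟩
  exact hΩ.bddAbove_image (by fun_prop)

/-- Quadratic growth at a maximizer of `⟪·, v⟫ - g` for strongly convex `g`. -/
theorem quadratic_growth_of_isMaxOn (hg : StrongConvexOn Ω 1 g) {v w u : Vec p} (hw : w ∈ Ω)
    (hu : u ∈ Ω) (hmax : IsMaxOn (fun u => ⟪u, v⟫ - g u) Ω w) :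
    ⟪u, v⟫ - g u + 1 / 2 * ‖u - w‖ ^ 2 ≤ ⟪w, v⟫ - g w := by
  -- Compare `w` with the point a fraction `t` of the way to `u` and divide by `t`; the factor `1 -
  -- t` disappears as `t → 0`.
  have key : ∀ t : ℝ, 0 < t → t < 1 →
      ⟪u, v⟫ - g u + (1 - t) * (1 / 2 * ‖u - w‖ ^ 2) ≤ ⟪w, v⟫ - g w := by
    intro t ht ht1
    have h1 := hg.2 hu hw ht.le (sub_nonneg.2 ht1.le) (by ring)
    have h2 := hmax (hg.1 hu hw ht.le (sub_nonneg.2 ht1.le) (by ring))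
    simp only [Set.mem_ofPred_eq, inner_add_left, real_inner_smul_left, smul_eq_mul] at h1 h2
    have h3 : t * (⟪u, v⟫ - g u + (1 - t) * (1 / 2 * ‖u - w‖ ^ 2)) ≤ t * (⟪w, v⟫ - g w) := by
      linarith
    exact le_of_mul_le_mul_left h3 ht
  have hlim : Filter.Tendsto (fun t : ℝ => ⟪u, v⟫ - g u + (1 - t) * (1 / 2 * ‖u - w‖ ^ 2))
      (nhdsWithin 0 (Set.Ioi 0)) (nhds (⟪u, v⟫ - g u + (1 - 0) * (1 / 2 * ‖u - w‖ ^ 2))) := by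
    apply Filter.Tendsto.mono_left _ nhdsWithin_le_nhds
    exact (Continuous.tendsto (by fun_prop) 0)
  have := le_of_tendsto hlim (Filter.mem_of_superset (Ioo_mem_nhdsGT (zero_lt_one' ℝ))
    (fun t ht => key t ht.1 ht.2))
  linarith

/-- Strong convexity dualizes to smoothness: if `u` is the maximizer at `v'`, quadratic growth costs
`‖u - w‖²/2`, while the cross term gains at most `‖u - w‖ ‖v' - v‖`. -/
theorem conj_le_quadratic (hΩ : IsCompact Ω) (hgc : Continuous g) (hg : StrongConvexOn Ω 1 g)
    {v w : Vec p} (hw : w ∈ Ω) (hmax : IsMaxOn (fun u => ⟪u, v⟫ - g u) Ω w) (v' : Vec p) :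
    conj Ω g v' ≤ conj Ω g v + ⟪w, v' - v⟫ + 1 / 2 * ‖v' - v‖ ^ 2 := by
  have hs := argmaxOn_spec (h := fun u => ⟪u, v'⟫ - g u) hΩ ⟨w, hw⟩ (by fun_prop)
  set u := argmaxOn Ω (fun u => ⟪u, v'⟫ - g u)
  rw [conj_eq_of_isMaxOn hs.1 hs.2, conj_eq_of_isMaxOn hw hmax]
  have h1 := quadratic_growth_of_isMaxOn hg hw hs.1 hmax
  have h2 : ⟪u, v'⟫ = ⟪u, v⟫ + ⟪w, v' - v⟫ + ⟪u - w, v' - v⟫ := by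
    simp only [inner_sub_left, inner_sub_right]; ring
  have h3 : ⟪u - w, v' - v⟫ ≤ ‖u - w‖ * ‖v' - v‖ := real_inner_le_norm _ _
  nlinarith [sq_nonneg (‖u - w‖ - ‖v' - v‖)]

theorem le_conj_of_isMaxOn (hΩ : IsCompact Ω) (hgc : Continuous g)
    {v w : Vec p} (hw : w ∈ Ω) (hmax : IsMaxOn (fun u => ⟪u, v⟫ - g u) Ω w) (v' : Vec p) :
    conj Ω g v + ⟪w, v' - v⟫ ≤ conj Ω g v' := by
  rw [conj_eq_of_isMaxOn hw hmax]
  have := le_conj hΩ hgc hw v'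
  rw [inner_sub_right]; linarith

/-- The conjugate lies between its affine minorant and a quadratic perturbation of it. This
identifies the `gradient` in `potB` with a genuine maximizer. -/
theorem hasGradientAt_conj (hΩ : IsCompact Ω) (hgc : Continuous g) (hg : StrongConvexOn Ω 1 g)
    {v w : Vec p} (hw : w ∈ Ω) (hmax : IsMaxOn (fun u => ⟪u, v⟫ - g u) Ω w) :
    HasGradientAt (conj Ω g) w v := by
  rw [hasGradientAt_iff_isLittleO]
  have hO : (fun v' => conj Ω g v' - conj Ω g v - ⟪w, v' - v⟫) =O[nhds v]
      fun v' => ‖v' - v‖ ^ 2 := by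
    refine Asymptotics.IsBigO.of_bound (1 / 2) (Filter.Eventually.of_forall fun v' => ?_)
    have h1 := conj_le_quadratic hΩ hgc hg hw hmax v'
    have h2 := le_conj_of_isMaxOn hΩ hgc hw hmax v'
    rw [Real.norm_eq_abs, abs_of_nonneg (by linarith), Real.norm_eq_abs,
      abs_of_nonneg (by positivity)]
    linarith
  refine hO.trans_isLittleO ?_
  rw [← Asymptotics.isLittleO_norm_right]
  have : (fun v' => ‖v' - v‖ ^ 2) =o[nhds v] fun v' => ‖v' - v‖ ^ 1 :=
    (Asymptotics.isLittleO_pow_pow (𝕜 := ℝ) one_lt_two).comp_tendsto (by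
      have : Filter.Tendsto (fun v' => ‖v' - v‖) (nhds v) (nhds ‖v - v‖) :=
        Continuous.tendsto (by fun_prop) v
      simpa using this)
  simpa using this

/-- Equality in the Fenchel inequality identifies the maximizers. -/
theorem isMaxOn_of_conj_eq (hΩ : IsCompact Ω) (hgc : Continuous g) {v w : Vec p}
    (h : g w + conj Ω g v = ⟪w, v⟫) : IsMaxOn (fun u => ⟪u, v⟫ - g u) Ω w := by
  intro u hu
  have := le_conj hΩ hgc hu v
  simp only [Set.mem_ofPred_eq]
  linarith

end Conjugate

/-! ### One iteration of SDCA -/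

namespace SDCA

variable {N p : ℕ} (𝒜 : SDCA N p)

/-- The standing assumptions on the input of SDCA. -/
structure Regular : Prop where
  N_pos : 0 < N
  lam_pos : 0 < 𝒜.lam
  η_pos : 0 < 𝒜.η
  q_pos : ∀ i, 0 < 𝒜.q i
  sum_q : ∑ i, 𝒜.q i = 1
  step_le : ∀ i, 2 * (𝒜.η * 𝒜.lam) ≤ 𝒜.q i
  compact : IsCompact 𝒜.Ω
  nonempty : 𝒜.Ω.Nonempty
  continuous_g : Continuous 𝒜.g
  strongConvex_g : StrongConvexOn 𝒜.Ω 1 𝒜.g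

/-- The invariants of the iteration. -/
structure Consistent (x : State N p) : Prop where
  v_eq : x.v = (1 / (𝒜.lam * N)) • ∑ i, x.a i
  w_eq : x.w = 𝒜.prox x.v

variable {𝒜}

theorem prox_spec (h𝒜 : 𝒜.Regular) (v : Vec p) :
    𝒜.prox v ∈ 𝒜.Ω ∧ IsMaxOn (fun u => ⟪u, v⟫ - 𝒜.g u) 𝒜.Ω (𝒜.prox v) :=
  argmaxOn_spec h𝒜.compact h𝒜.nonempty (by have := h𝒜.continuous_g; fun_prop)

theorem consistent_init (a₀ : Fin N → Vec p) : 𝒜.Consistent (𝒜.init a₀) := ⟨rfl, rfl⟩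

/-- The factor `lam * N` in the update of `a i` cancels the `1 / (lam * N)` in front of the sum. -/
theorem Consistent.step (h𝒜 : 𝒜.Regular) {x : State N p} (hx : 𝒜.Consistent x) (i : Fin N) :
    𝒜.Consistent (𝒜.step x i) := by
  refine ⟨?_, rfl⟩
  have hN : (N : ℝ) ≠ 0 := by exact_mod_cast h𝒜.N_pos.ne'
  have hl := h𝒜.lam_pos.ne'
  simp only [SDCA.step, nextV]
  rw [Finset.sum_update_of_mem (Finset.mem_univ i), hx.v_eq,
    ← Finset.add_sum_erase _ _ (Finset.mem_univ i), Finset.sdiff_singleton_eq_erase]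
  simp only [smul_add, smul_sub, smul_smul]
  have : 1 / (𝒜.lam * N) * (𝒜.stepSize i * 𝒜.lam * N) = 𝒜.stepSize i := by field_simp
  rw [this]
  abel

theorem consistent_run (h𝒜 : 𝒜.Regular) (a₀ : Fin N → Vec p) :
    ∀ (t : ℕ) (I : Fin t → Fin N), 𝒜.Consistent (𝒜.run a₀ t I)
  | 0, _ => consistent_init a₀
  | t + 1, _ => (consistent_run h𝒜 a₀ t _).step h𝒜 _

theorem run_mem (h𝒜 : 𝒜.Regular) (a₀ : Fin N → Vec p) (t : ℕ) (I : Fin t → Fin N) :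
    (𝒜.run a₀ t I).w ∈ 𝒜.Ω := by
  rw [(consistent_run h𝒜 a₀ t I).w_eq]
  exact (prox_spec h𝒜 _).1

/-! ### Expected one-step change of the potentials -/

section Potential

variable {what vhat : Vec p}

/-- The conjugate has gradient `what` at `vhat`, so Fenchel equality turns the Bregman divergence
into twice a Fenchel gap, free of `vhat`. -/
theorem potB_eq (h𝒜 : 𝒜.Regular) (hw : what ∈ 𝒜.Ω)
    (hv : 𝒜.g what + conj 𝒜.Ω 𝒜.g vhat = ⟪what, vhat⟫) (x : State N p) :
    𝒜.potB vhat x = 2 * (conj 𝒜.Ω 𝒜.g x.v - ⟪what, x.v⟫ + 𝒜.g what) := by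
  have hmax := isMaxOn_of_conj_eq h𝒜.compact h𝒜.continuous_g hv
  rw [potB, (hasGradientAt_conj h𝒜.compact h𝒜.continuous_g h𝒜.strongConvex_g hw hmax).gradient,
    inner_sub_right, ← hv]
  ring

theorem potB_nonneg (h𝒜 : 𝒜.Regular) (hw : what ∈ 𝒜.Ω)
    (hv : 𝒜.g what + conj 𝒜.Ω 𝒜.g vhat = ⟪what, vhat⟫) (x : State N p) :
    0 ≤ 𝒜.potB vhat x := by
  rw [potB_eq h𝒜 hw hv]
  have := le_conj h𝒜.compact h𝒜.continuous_g hw x.v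
  linarith

theorem potA_nonneg (h𝒜 : 𝒜.Regular) (x : State N p) : 0 ≤ 𝒜.potA what x :=
  Finset.sum_nonneg fun i _ => mul_nonneg (one_div_nonneg.2 (h𝒜.q_pos i).le) (sq_nonneg _)

theorem potC_nonneg (h𝒜 : 𝒜.Regular) (hw : what ∈ 𝒜.Ω)
    (hv : 𝒜.g what + conj 𝒜.Ω 𝒜.g vhat = ⟪what, vhat⟫) (x : State N p) :
    0 ≤ 𝒜.potC what vhat x := by
  have h1 := potB_nonneg h𝒜 hw hv x
  have h2 := potA_nonneg (what := what) h𝒜 x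
  have h3 := h𝒜.η_pos
  have h4 := h𝒜.lam_pos
  unfold potC
  positivity

/-- The identity for `‖(1 - β)X + βY‖²` with `X = a + b` and `Y = b - c`. Its negative term later
pays for the quadratic error in `potB`. -/
theorem norm_sq_convex_comb (a b c : Vec p) (β : ℝ) :
    ‖a - β • (c + a) + b‖ ^ 2 = (1 - β) * ‖a + b‖ ^ 2 + β * ‖c - b‖ ^ 2
      - β * (1 - β) * ‖c + a‖ ^ 2 := by
  simp only [← real_inner_self_eq_norm_sq, inner_add_left, inner_add_right, inner_sub_left,
    inner_sub_right, real_inner_smul_left, real_inner_smul_right]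
  rw [real_inner_comm a b, real_inner_comm a c, real_inner_comm b c]
  ring

/-- A pick moves `a i` a fraction `β` of the way to `-∇φ_i(w)`. Since `β ≤ 1/2`, at least half of
the negative term of `norm_sq_convex_comb` survives. -/
theorem sum_q_potA_step (h𝒜 : 𝒜.Regular) (x : State N p) :
    ∑ i, 𝒜.q i * 𝒜.potA what (𝒜.step x i) ≤ (1 - 𝒜.η * 𝒜.lam) * 𝒜.potA what x
      + 𝒜.η * 𝒜.lam * ∑ i, 1 / 𝒜.q i * ‖gradient (𝒜.φ i) x.w - gradient (𝒜.φ i) what‖ ^ 2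
      - 𝒜.η * 𝒜.lam * (1 / 2) * ∑ i, 1 / 𝒜.q i * ‖gradient (𝒜.φ i) x.w + x.a i‖ ^ 2 := by
  have hN : (N : ℝ) ≠ 0 := by exact_mod_cast h𝒜.N_pos.ne'
  set T : Fin N → ℝ := fun j => 1 / 𝒜.q j * ‖x.a j - (-gradient (𝒜.φ j) what)‖ ^ 2 with hT
  have hA : 𝒜.potA what x = ∑ j, T j := rfl
  have hstep : ∀ i, 𝒜.q i * 𝒜.potA what (𝒜.step x i) ≤ 𝒜.q i * 𝒜.potA what x
      + (-(𝒜.η * 𝒜.lam) * T i + 𝒜.η * 𝒜.lam *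
        (1 / 𝒜.q i * ‖gradient (𝒜.φ i) x.w - gradient (𝒜.φ i) what‖ ^ 2)
      - 𝒜.η * 𝒜.lam * (1 / 2) * (1 / 𝒜.q i * ‖gradient (𝒜.φ i) x.w + x.a i‖ ^ 2)) := by
    intro i
    have hq := h𝒜.q_pos i
    set β := 𝒜.stepSize i * 𝒜.lam * N with hβ
    -- The step sizes are chosen so that the expected contraction of each coordinate is the same.
    have hβq : β * 𝒜.q i = 𝒜.η * 𝒜.lam := by
      rw [hβ, stepSize]; field_simp
    have hsplit : 𝒜.potA what (𝒜.step x i) = 𝒜.potA what x - T i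
        + 1 / 𝒜.q i * ‖(x.a i - β • (gradient (𝒜.φ i) x.w + x.a i))
          + gradient (𝒜.φ i) what‖ ^ 2 := by
      rw [hA, potA, ← Finset.add_sum_erase _ _ (Finset.mem_univ i),
        ← Finset.add_sum_erase _ T (Finset.mem_univ i)]
      have : ∑ j ∈ Finset.univ.erase i,
          1 / 𝒜.q j * ‖(𝒜.step x i).a j - (-gradient (𝒜.φ j) what)‖ ^ 2
          = ∑ j ∈ Finset.univ.erase i, T j := by
        refine Finset.sum_congr rfl fun j hj => ?_
        simp [SDCA.step, hT, Function.update_of_ne (Finset.ne_of_mem_erase hj)]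
      rw [this]
      simp only [SDCA.step, Function.update_self, sub_neg_eq_add]
      ring
    rw [hsplit, norm_sq_convex_comb]
    have hTi : 𝒜.q i * T i = ‖x.a i + gradient (𝒜.φ i) what‖ ^ 2 := by
      simp only [hT, sub_neg_eq_add]; field_simp
    have e : 𝒜.q i * (𝒜.potA what x - T i + 1 / 𝒜.q i *
        ((1 - β) * ‖x.a i + gradient (𝒜.φ i) what‖ ^ 2
          + β * ‖gradient (𝒜.φ i) x.w - gradient (𝒜.φ i) what‖ ^ 2
          - β * (1 - β) * ‖gradient (𝒜.φ i) x.w + x.a i‖ ^ 2))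
        = 𝒜.q i * 𝒜.potA what x + (-(β * 𝒜.q i) * T i + β * 𝒜.q i *
        (1 / 𝒜.q i * ‖gradient (𝒜.φ i) x.w - gradient (𝒜.φ i) what‖ ^ 2)
      - β * 𝒜.q i * (1 - β) * (1 / 𝒜.q i * ‖gradient (𝒜.φ i) x.w + x.a i‖ ^ 2)) := by
      rw [← hTi]; field_simp; ring
    rw [e, hβq]
    have hβ2 : β ≤ 1 / 2 := by
      have := h𝒜.step_le i
      by_contra hcon
      push Not at hcon
      nlinarith
    have hpos : 0 ≤ 1 / 𝒜.q i * ‖gradient (𝒜.φ i) x.w + x.a i‖ ^ 2 := by positivity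
    have hηl : 0 < 𝒜.η * 𝒜.lam := mul_pos h𝒜.η_pos h𝒜.lam_pos
    have := mul_nonneg (mul_nonneg hηl.le (by linarith : 0 ≤ 1 - β - 1 / 2)) hpos
    linarith
  refine (Finset.sum_le_sum fun i _ => hstep i).trans (le_of_eq ?_)
  rw [Finset.sum_add_distrib, ← Finset.sum_mul, h𝒜.sum_q, Finset.sum_sub_distrib,
    Finset.sum_add_distrib, ← Finset.mul_sum, ← Finset.mul_sum, ← Finset.mul_sum, ← hA]
  ring

/-- Apply smoothness of the conjugate at `x.v`, where its gradient is `x.w`. The probability cancels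
in `q i * stepSize i = η / N`, so the linear term is unbiased. -/
theorem sum_q_potB_step (h𝒜 : 𝒜.Regular) (hw : what ∈ 𝒜.Ω)
    (hv : 𝒜.g what + conj 𝒜.Ω 𝒜.g vhat = ⟪what, vhat⟫) {x : State N p} (hx : 𝒜.Consistent x) :
    ∑ i, 𝒜.q i * 𝒜.potB vhat (𝒜.step x i) ≤ (1 - 𝒜.η * 𝒜.lam) * 𝒜.potB vhat x
      - 2 * 𝒜.η * (⟪x.w - what, (1 / (N : ℝ)) • ∑ i, gradient (𝒜.φ i) x.w⟫
        + 𝒜.lam * (𝒜.g x.w - 𝒜.g what))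
      + (𝒜.η ^ 2 / N ^ 2) * ∑ i, 1 / 𝒜.q i * ‖gradient (𝒜.φ i) x.w + x.a i‖ ^ 2 := by
  have hN : (N : ℝ) ≠ 0 := by exact_mod_cast h𝒜.N_pos.ne'
  have hl := h𝒜.lam_pos.ne'
  have hprox := prox_spec h𝒜 x.v
  rw [← hx.w_eq] at hprox
  have hstep : ∀ i, 𝒜.q i * 𝒜.potB vhat (𝒜.step x i) ≤ 𝒜.q i * 𝒜.potB vhat x
      + (-(2 * 𝒜.η / N) * ⟪x.w - what, gradient (𝒜.φ i) x.w + x.a i⟫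
        + (𝒜.η ^ 2 / N ^ 2) * (1 / 𝒜.q i * ‖gradient (𝒜.φ i) x.w + x.a i‖ ^ 2)) := by
    intro i
    have hq := h𝒜.q_pos i
    have h1 := conj_le_quadratic h𝒜.compact h𝒜.continuous_g h𝒜.strongConvex_g hprox.1 hprox.2
      (𝒜.nextV x i)
    have hd : 𝒜.nextV x i - x.v = -(𝒜.stepSize i • (gradient (𝒜.φ i) x.w + x.a i)) := by
      rw [nextV]; abel
    have hin : ⟪what, 𝒜.nextV x i⟫ = ⟪what, x.v⟫ + ⟪what, 𝒜.nextV x i - x.v⟫ := by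
      rw [inner_sub_right]; ring
    have h2 : 𝒜.potB vhat (𝒜.step x i) ≤ 𝒜.potB vhat x
        + (2 * ⟪x.w - what, 𝒜.nextV x i - x.v⟫ + ‖𝒜.nextV x i - x.v‖ ^ 2) := by
      rw [potB_eq h𝒜 hw hv, potB_eq h𝒜 hw hv]
      simp only [SDCA.step]
      rw [hin, inner_sub_left]
      linarith
    refine (mul_le_mul_of_nonneg_left h2 hq.le).trans (le_of_eq ?_)
    rw [hd, norm_neg, norm_smul, inner_neg_right, real_inner_smul_right, mul_pow, Real.norm_eq_abs,
      sq_abs, stepSize]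
    field_simp
  refine (Finset.sum_le_sum fun i _ => hstep i).trans (le_of_eq ?_)
  rw [Finset.sum_add_distrib, ← Finset.sum_mul, h𝒜.sum_q, Finset.sum_add_distrib, ← Finset.mul_sum,
    ← Finset.mul_sum, ← inner_sum, Finset.sum_add_distrib]
  -- The dual variables sum to a multiple of `v`, so the inner product with `x.w - what` reproduces
  -- `potB` up to the difference of the regularizer; this is the contraction.
  have ha : ∑ i, x.a i = (𝒜.lam * N) • x.v := by
    rw [hx.v_eq, smul_smul, mul_one_div_cancel (by positivity), one_smul]
  rw [ha, inner_add_right, real_inner_smul_right, real_inner_smul_right]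
  have hB : 𝒜.potB vhat x = 2 * (⟪x.w - what, x.v⟫ - 𝒜.g x.w + 𝒜.g what) := by
    rw [potB_eq h𝒜 hw hv, conj_eq_of_isMaxOn hprox.1 hprox.2, inner_sub_left]; ring
  rw [hB]
  field_simp
  ring

/-- The expected decrease of the potential in one iteration. -/
theorem sum_q_potC_step (h𝒜 : 𝒜.Regular) (hw : what ∈ 𝒜.Ω)
    (hv : 𝒜.g what + conj 𝒜.Ω 𝒜.g vhat = ⟪what, vhat⟫) {x : State N p} (hx : 𝒜.Consistent x) :
    ∑ i, 𝒜.q i * 𝒜.potC what vhat (𝒜.step x i) ≤ (1 - 𝒜.η * 𝒜.lam) * 𝒜.potC what vhat x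
      + 𝒜.η * 𝒜.lam * (𝒜.η / N ^ 2 *
          (∑ i, 1 / 𝒜.q i * ‖gradient (𝒜.φ i) x.w - gradient (𝒜.φ i) what‖ ^ 2)
        - (⟪x.w - what, (1 / (N : ℝ)) • ∑ i, gradient (𝒜.φ i) x.w⟫
          + 𝒜.lam * (𝒜.g x.w - 𝒜.g what))) := by
  have hA := sum_q_potA_step (what := what) h𝒜 x
  have hB := sum_q_potB_step h𝒜 hw hv hx
  have h1 : ∑ i, 𝒜.q i * 𝒜.potC what vhat (𝒜.step x i)
      = 𝒜.η / (N : ℝ) ^ 2 * ∑ i, 𝒜.q i * 𝒜.potA what (𝒜.step x i)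
        + 𝒜.lam / 2 * ∑ i, 𝒜.q i * 𝒜.potB vhat (𝒜.step x i) := by
    rw [Finset.mul_sum, Finset.mul_sum, ← Finset.sum_add_distrib]
    refine Finset.sum_congr rfl fun i _ => ?_
    rw [potC]; ring
  rw [h1]
  have h3 := h𝒜.η_pos
  have h4 := h𝒜.lam_pos
  have hA' := mul_le_mul_of_nonneg_left hA (by positivity : 0 ≤ 𝒜.η / (N : ℝ) ^ 2)
  have hB' := mul_le_mul_of_nonneg_left hB (by positivity : 0 ≤ 𝒜.lam / 2)
  -- The weights in `potC` are such that `η/N² · ηλ/2 = λ/2 · η²/N²`: the two sums of `‖∇φ_i(w) +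
  -- a_i‖²` cancel.
  refine (add_le_add hA' hB').trans (le_of_eq ?_)
  rw [potC]
  ring

end Potential

/-! ### Expectations over the sampling -/

/-- The tower property: the last pick is averaged first, conditionally on the others. -/
theorem expect_succ (t : ℕ) (h : (Fin (t + 1) → Fin N) → ℝ) :
    𝒜.expect (t + 1) h
      = 𝒜.expect t (fun I => ∑ i, 𝒜.q i * h (Fin.snoc (α := fun _ => Fin N) I i)) := by
  rw [expect, expect, ← (Fin.snocEquiv fun _ => Fin N).sum_comp, Fintype.sum_prod_type_right]
  refine Finset.sum_congr rfl fun I _ => ?_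
  rw [Finset.mul_sum]
  refine Finset.sum_congr rfl fun i _ => ?_
  simp only [Fin.snocEquiv, Equiv.coe_fn_mk, Fin.prod_univ_castSucc, Fin.snoc_castSucc,
    Fin.snoc_last]
  ring

theorem expect_mono (h𝒜 : 𝒜.Regular) {t : ℕ} {h h' : (Fin t → Fin N) → ℝ} (hh : ∀ I, h I ≤ h' I) :
    𝒜.expect t h ≤ 𝒜.expect t h' :=
  Finset.sum_le_sum fun I _ =>
    mul_le_mul_of_nonneg_left (hh I) (Finset.prod_nonneg fun k _ => (h𝒜.q_pos (I k)).le)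

theorem expect_add (t : ℕ) (h h' : (Fin t → Fin N) → ℝ) :
    𝒜.expect t (fun I => h I + h' I) = 𝒜.expect t h + 𝒜.expect t h' := by
  simp only [expect, mul_add, Finset.sum_add_distrib]

theorem expect_const_mul (t : ℕ) (c : ℝ) (h : (Fin t → Fin N) → ℝ) :
    𝒜.expect t (fun I => c * h I) = c * 𝒜.expect t h := by
  simp only [expect, Finset.mul_sum]
  exact Finset.sum_congr rfl fun I _ => by ring

theorem expect_const (h𝒜 : 𝒜.Regular) (t : ℕ) (c : ℝ) : 𝒜.expect t (fun _ => c) = c := by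
  induction t with
  | zero => simp [expect]
  | succ t ih =>
    rw [expect_succ]
    simp only [← Finset.sum_mul, h𝒜.sum_q, one_mul, ih]

theorem expect_zero (h : (Fin 0 → Fin N) → ℝ) : 𝒜.expect 0 h = h finZeroElim := by
  simp [expect, Subsingleton.elim (default : Fin 0 → Fin N) finZeroElim]

theorem run_snoc (a₀ : Fin N → Vec p) (t : ℕ) (I : Fin t → Fin N) (i : Fin N) :
    𝒜.run a₀ (t + 1) (Fin.snoc (α := fun _ => Fin N) I i) = 𝒜.step (𝒜.run a₀ t I) i := by
  simp [run]

theorem runTake_snoc (a₀ : Fin N → Vec p) {t : ℕ} (I : Fin t → Fin N) (i : Fin N) {k : ℕ}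
    (hk : k ≤ t) : 𝒜.runTake a₀ k (hk.trans t.le_succ) (Fin.snoc (α := fun _ => Fin N) I i)
      = 𝒜.runTake a₀ k hk I := by
  unfold runTake
  congr 1
  funext l
  have : (Fin.castLE (hk.trans t.le_succ) l : Fin (t + 1)) = (Fin.castLE hk l).castSucc := rfl
  rw [this, Fin.snoc_castSucc]

theorem runTake_self (a₀ : Fin N → Vec p) {t : ℕ} (I : Fin t → Fin N) :
    𝒜.runTake a₀ t le_rfl I = 𝒜.run a₀ t I := rfl

/-! ### Contraction along the run -/

section Convergence

variable {what vhat : Vec p} {F : Vec p → ℝ} {δ c : ℝ}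

/-- The one-step condition on the objective under which the potential contracts as long as the
gap exceeds `δ`. -/
def GapCondition (𝒜 : SDCA N p) (F : Vec p → ℝ) (what : Vec p) (δ c : ℝ) : Prop :=
  ∀ w ∈ 𝒜.Ω, 𝒜.η / N ^ 2 * (∑ i, 1 / 𝒜.q i * ‖gradient (𝒜.φ i) w - gradient (𝒜.φ i) what‖ ^ 2)
    + c * (F w - F what - δ) ≤ ⟪w - what, (1 / (N : ℝ)) • ∑ i, gradient (𝒜.φ i) w⟫
      + 𝒜.lam * (𝒜.g w - 𝒜.g what)

theorem sum_q_potC_run (h𝒜 : 𝒜.Regular) (hw : what ∈ 𝒜.Ω)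
    (hv : 𝒜.g what + conj 𝒜.Ω 𝒜.g vhat = ⟪what, vhat⟫)
    (hgap : 𝒜.GapCondition F what δ c) (a₀ : Fin N → Vec p) (t : ℕ) (I : Fin t → Fin N) :
    ∑ i, 𝒜.q i * 𝒜.potC what vhat (𝒜.step (𝒜.run a₀ t I) i)
      ≤ (1 - 𝒜.η * 𝒜.lam) * 𝒜.potC what vhat (𝒜.run a₀ t I)
        + (-(𝒜.η * 𝒜.lam * c)) * (F (𝒜.run a₀ t I).w - F what + -δ) := by
  have h1 := sum_q_potC_step h𝒜 hw hv (consistent_run h𝒜 a₀ t I)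
  have h2 := hgap _ (run_mem h𝒜 a₀ t I)
  have h3 := mul_pos h𝒜.η_pos h𝒜.lam_pos
  have h4 := mul_le_mul_of_nonneg_left h2 h3.le
  linarith

theorem one_sub_nonneg (h𝒜 : 𝒜.Regular) : 0 ≤ 1 - 𝒜.η * 𝒜.lam := by
  have h3 := mul_pos h𝒜.η_pos h𝒜.lam_pos
  have i : Fin N := ⟨0, h𝒜.N_pos⟩
  have h1 := h𝒜.step_le i
  have h2 : 𝒜.q i ≤ ∑ i, 𝒜.q i :=
    Finset.single_le_sum (fun j _ => (h𝒜.q_pos j).le) (Finset.mem_univ i)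
  rw [h𝒜.sum_q] at h2
  linarith

/-- The error of one step is linear in `F` at the iterate, so after averaging only the sign of the
mean gap minus `δ` matters. -/
theorem expect_potC_le (h𝒜 : 𝒜.Regular) (hw : what ∈ 𝒜.Ω)
    (hv : 𝒜.g what + conj 𝒜.Ω 𝒜.g vhat = ⟪what, vhat⟫) (hc : 0 ≤ c)
    (hgap : 𝒜.GapCondition F what δ c) (a₀ : Fin N → Vec p) (t : ℕ)
    (ht : ∀ k < t, δ < 𝒜.expect k (fun I => F (𝒜.run a₀ k I).w) - F what) :
    𝒜.expect t (fun I => 𝒜.potC what vhat (𝒜.run a₀ t I))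
      ≤ (1 - 𝒜.η * 𝒜.lam) ^ t * 𝒜.potC what vhat (𝒜.init a₀) := by
  induction t with
  | zero => simp [expect_zero, run]
  | succ t ih =>
    have ih := ih fun k hk => ht k (hk.trans t.lt_succ_self)
    have hδ := ht t t.lt_succ_self
    have h3 := mul_pos h𝒜.η_pos h𝒜.lam_pos
    rw [expect_succ]
    simp only [run_snoc]
    refine (expect_mono h𝒜 fun I => sum_q_potC_run h𝒜 hw hv hgap a₀ t I).trans ?_
    simp only [sub_eq_add_neg (F _)]
    rw [expect_add, expect_const_mul, expect_const_mul, expect_add, expect_add, expect_const h𝒜,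
      expect_const h𝒜, pow_succ]
    have h5 := mul_le_mul_of_nonneg_left ih (one_sub_nonneg h𝒜)
    have h6 : 0 ≤ 𝒜.η * 𝒜.lam * c * (𝒜.expect t (fun I => F (𝒜.run a₀ t I).w) + -F what + -δ) :=
      mul_nonneg (mul_nonneg h3.le hc) (by linarith)
    linarith

/-- The stopped potential is a supermartingale up to the factor `1 - ηλ`: a live path contracts, and
a path that has reached the gap contributes zero. -/
theorem expect_indicator_potC_le (h𝒜 : 𝒜.Regular) (hw : what ∈ 𝒜.Ω)
    (hv : 𝒜.g what + conj 𝒜.Ω 𝒜.g vhat = ⟪what, vhat⟫) (hc : 0 ≤ c)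
    (hgap : 𝒜.GapCondition F what δ c) (a₀ : Fin N → Vec p) (t : ℕ) :
    𝒜.expect t (Set.indicator
        {I | ∀ (k : ℕ) (hk : k < t), δ < F (𝒜.runTake a₀ k hk.le I).w - F what}
        (fun I => 𝒜.potC what vhat (𝒜.run a₀ t I)))
      ≤ (1 - 𝒜.η * 𝒜.lam) ^ t * 𝒜.potC what vhat (𝒜.init a₀) := by
  induction t with
  | zero => simp [expect_zero, run]
  | succ t ih =>
    have h3 := mul_pos h𝒜.η_pos h𝒜.lam_pos
    rw [expect_succ, pow_succ, mul_comm (_ ^ t), mul_assoc]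
    refine le_trans ?_ (mul_le_mul_of_nonneg_left ih (one_sub_nonneg h𝒜))
    rw [← expect_const_mul]
    refine expect_mono h𝒜 fun I => ?_
    by_cases hI : ∀ (k : ℕ) (hk : k < t), δ < F (𝒜.runTake a₀ k hk.le I).w - F what
    · rw [Set.indicator_of_mem (s := {I | ∀ (k : ℕ) (hk : k < t),
        δ < F (𝒜.runTake a₀ k hk.le I).w - F what}) hI]
      by_cases hδ : δ < F (𝒜.run a₀ t I).w - F what
      · have h1 := sum_q_potC_run h𝒜 hw hv hgap a₀ t I
        have h6 : 0 ≤ 𝒜.η * 𝒜.lam * c * (F (𝒜.run a₀ t I).w - F what + -δ) :=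
          mul_nonneg (mul_nonneg h3.le hc) (by linarith)
        refine le_trans (Finset.sum_le_sum fun i _ => mul_le_mul_of_nonneg_left ?_ (h𝒜.q_pos i).le)
          (by linarith [h1] : ∑ i, 𝒜.q i * 𝒜.potC what vhat (𝒜.step (𝒜.run a₀ t I) i) ≤ _)
        refine (Set.indicator_le_self' (fun _ _ => potC_nonneg h𝒜 hw hv _) _).trans ?_
        rw [run_snoc]
      -- The gap is reached exactly at time `t`: every extension of the path leaves the event.
      · refine le_trans (le_of_eq (Finset.sum_eq_zero fun i _ => ?_))
          (mul_nonneg (one_sub_nonneg h𝒜) (potC_nonneg h𝒜 hw hv _))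
        rw [Set.indicator_of_notMem, mul_zero]
        intro hmem
        have := hmem t t.lt_succ_self
        rw [runTake_snoc a₀ I i le_rfl, runTake_self] at this
        exact hδ this
    · refine le_trans (le_of_eq (Finset.sum_eq_zero fun i _ => ?_))
        (mul_nonneg (one_sub_nonneg h𝒜)
          (Set.indicator_nonneg (fun _ _ => potC_nonneg h𝒜 hw hv _) _))
      rw [Set.indicator_of_notMem, mul_zero]
      intro hmem
      refine hI fun k hk => ?_
      have := hmem k (hk.trans t.lt_succ_self)
      rwa [runTake_snoc a₀ I i hk.le] at this

end Convergence

end SDCA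

/-! ### Gradients and the `ℓ₁` norm -/

section Basic

variable {p : ℕ}

theorem hasGradientAt_loss (z : Vec p) (y : ℝ) (c : ℝ) (w : Vec p) :
    HasGradientAt (fun w => c * loss z y w) ((c * (⟪w, z⟫ - y)) • z) w := by
  rw [hasGradientAt_iff_hasFDerivAt]
  have h1 : HasFDerivAt (fun w : Vec p => ⟪z, w⟫) (innerSL ℝ z) w := (innerSL ℝ z).hasFDerivAt
  have h2 := (((h1.const_sub y).pow 2).const_mul (c * (1 / 2)))
  have hf : (fun w : Vec p => c * (1 / 2) * (y - ⟪z, w⟫) ^ 2) = fun w => c * loss z y w := by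
    funext w; rw [loss, real_inner_comm]; ring
  rw [hf] at h2
  refine h2.congr_fderiv ?_
  ext u
  simp [real_inner_comm z w]
  ring

theorem hasGradientAt_norm_sq (a : ℝ) (w : Vec p) :
    HasGradientAt (fun w : Vec p => -(a / 2) * ‖w‖ ^ 2) (-(a • w)) w := by
  rw [hasGradientAt_iff_hasFDerivAt]
  have h2 := (hasStrictFDerivAt_norm_sq w).hasFDerivAt.const_mul (-(a / 2))
  refine h2.congr_fderiv ?_
  ext u
  simp
  ring

/-- The smoothness parameter of the loss of a sample dominates `‖z‖²`. -/
theorem norm_sq_le_of_isSmooth (hp : 1 ≤ p) {z : Vec p} {y L : ℝ} (h : IsSmooth (loss z y) L) :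
    ‖z‖ ^ 2 ≤ L := by
  have hgrad : ∀ w, gradient (loss z y) w = (⟪w, z⟫ - y) • z := fun w => by
    simpa using (hasGradientAt_loss z y 1 w).gradient
  -- For `z = 0` only `0 ≤ L` is needed; it follows from the Lipschitz bound at two points at
  -- distance one, which exist because `1 ≤ p`.
  by_cases hz : z = 0
  · subst hz
    have h1 := h.2 (EuclideanSpace.single ⟨0, hp⟩ 1) 0
    simpa [hgrad] using h1
  · have h1 := h.2 z 0
    have hzn : 0 < ‖z‖ := norm_pos_iff.2 hz
    rw [hgrad, hgrad, ← sub_smul, norm_smul] at h1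
    simp only [inner_zero_left, sub_zero, zero_sub, sub_neg_eq_add, sub_add_cancel,
      real_inner_self_eq_norm_sq, norm_pow, norm_norm] at h1
    exact le_of_mul_le_mul_right h1 hzn

theorem l1Norm_nonneg (w : Vec p) : 0 ≤ l1Norm w := Finset.sum_nonneg fun _ _ => abs_nonneg _

theorem l1Norm_smul (c : ℝ) (w : Vec p) : l1Norm (c • w) = |c| * l1Norm w := by
  simp [l1Norm, abs_mul, Finset.mul_sum]

theorem l1Norm_add_le (u w : Vec p) : l1Norm (u + w) ≤ l1Norm u + l1Norm w := by
  simp only [l1Norm, ← Finset.sum_add_distrib]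
  exact Finset.sum_le_sum fun j _ => abs_add_le _ _

theorem l1Norm_sub_le (u w : Vec p) : l1Norm (u - w) ≤ l1Norm u + l1Norm w := by
  simp only [l1Norm, ← Finset.sum_add_distrib]
  exact Finset.sum_le_sum fun j _ => abs_sub _ _

theorem continuous_l1Norm : Continuous (l1Norm : Vec p → ℝ) := by
  unfold l1Norm
  fun_prop

theorem convexOn_l1Norm : ConvexOn ℝ Set.univ (l1Norm : Vec p → ℝ) := by
  refine ⟨convex_univ, fun u _ w _ a b ha hb _ => ?_⟩
  refine (l1Norm_add_le _ _).trans ?_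
  rw [l1Norm_smul, l1Norm_smul, abs_of_nonneg ha, abs_of_nonneg hb]
  rfl

theorem norm_le_l1Norm (w : Vec p) : ‖w‖ ≤ l1Norm w := by
  have h : w = ∑ j, w j • (EuclideanSpace.single j (1 : ℝ) : Vec p) := by
    ext k
    simp [Finset.sum_apply, Pi.single_apply]
  calc ‖w‖ = ‖∑ j, w j • (EuclideanSpace.single j (1 : ℝ) : Vec p)‖ := by rw [← h]
    _ ≤ ∑ j, ‖w j • (EuclideanSpace.single j (1 : ℝ) : Vec p)‖ := norm_sum_le _ _
    _ = l1Norm w := by simp [norm_smul, l1Norm]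

theorem isCompact_feasible (ρ : ℝ) : IsCompact (feasible p ρ) := by
  refine Metric.isCompact_of_isClosed_isBounded
    (isClosed_le continuous_l1Norm continuous_const) ?_
  refine (Metric.isBounded_closedBall (x := (0 : Vec p)) (r := ρ)).subset fun w hw => ?_
  rw [mem_closedBall_zero_iff]
  exact (norm_le_l1Norm w).trans hw

theorem convex_feasible (ρ : ℝ) : Convex ℝ (feasible p ρ) := by
  have := convexOn_l1Norm (p := p).convex_le ρ
  simpa [feasible] using this

theorem abs_inner_le_mul_l1Norm {u w : Vec p} {c : ℝ} (hu : ∀ j, |u j| ≤ c) :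
    |⟪u, w⟫| ≤ c * l1Norm w := by
  rw [PiLp.inner_apply, l1Norm, Finset.mul_sum]
  refine (Finset.abs_sum_le_sum_abs _ _).trans (Finset.sum_le_sum fun j _ => ?_)
  simp only [RCLike.inner_apply, conj_trivial, abs_mul]
  rw [mul_comm]
  exact mul_le_mul_of_nonneg_right (hu j) (abs_nonneg _)

/-- Decomposability of the `ℓ₁` norm at a sparse vector. -/
theorem l1Norm_sub_le_of_isSparse {s : ℕ} {wstar : Vec p} (hs : IsSparse s wstar) (w : Vec p) :
    l1Norm (w - wstar) ≤ l1Norm w - l1Norm wstar + 2 * (√s * ‖w - wstar‖) := by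
  classical
  set T := Finset.univ.filter fun j => wstar j ≠ 0 with hT
  have hcard : T.card ≤ s := by
    have : {j : Fin p | wstar j ≠ 0}.ncard = T.card := by
      rw [← Set.ncard_coe_finset]; congr 1; ext; simp [hT]
    exact this ▸ hs
  have h1 : l1Norm (w - wstar) ≤ l1Norm w - l1Norm wstar + 2 * ∑ j ∈ T, |(w - wstar) j| := by
    rw [Finset.sum_filter, Finset.mul_sum]
    simp only [l1Norm]
    rw [← Finset.sum_sub_distrib, ← Finset.sum_add_distrib]
    refine Finset.sum_le_sum fun j _ => ?_
    by_cases hj : wstar j = 0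
    · simp [hj]
    · have := abs_sub_abs_le_abs_sub (wstar j) (w j)
      rw [abs_sub_comm] at this
      simp only [PiLp.sub_apply, ne_eq, hj, not_false_eq_true, if_true]
      linarith
  have h2 : ∑ j ∈ T, |(w - wstar) j| ≤ √s * ‖w - wstar‖ := by
    have hcs := sq_sum_le_card_mul_sum_sq (s := T) (f := fun j => |(w - wstar) j|)
    have hn : ∑ j ∈ T, |(w - wstar) j| ^ 2 ≤ ‖w - wstar‖ ^ 2 := by
      rw [EuclideanSpace.norm_sq_eq]
      simp only [Real.norm_eq_abs]
      exact Finset.sum_le_sum_of_subset_of_nonneg (Finset.subset_univ _)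
        fun _ _ _ => sq_nonneg _
    refine le_of_sq_le_sq ?_ (by positivity)
    rw [mul_pow, Real.sq_sqrt (Nat.cast_nonneg s)]
    have : (T.card : ℝ) ≤ s := by exact_mod_cast hcard
    exact hcs.trans (mul_le_mul this hn (Finset.sum_nonneg fun _ _ => sq_nonneg _)
      (Nat.cast_nonneg s))
  linarith

end Basic

/-! ### The geometry of the objective -/

section Objective

variable {n p : ℕ} {z : Fin n → Vec p} {y : Fin n → ℝ} {γ lam ρ : ℝ}

/-- The quadratic form of the empirical second moment matrix. -/
noncomputable def gram (z : Fin n → Vec p) (v : Vec p) : ℝ := (1 / n) * ∑ i, ⟪v, z i⟫ ^ 2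

/-- The gradient of the smooth part of the objective. -/
noncomputable def smoothGrad (z : Fin n → Vec p) (y : Fin n → ℝ) (γ : ℝ) (u : Vec p) : Vec p :=
  (1 / n : ℝ) • ∑ i, (⟪u, z i⟫ - y i) • z i - γ • u

theorem gram_nonneg (z : Fin n → Vec p) (v : Vec p) : 0 ≤ gram z v := by
  unfold gram; positivity

theorem gram_smul (z : Fin n → Vec p) (c : ℝ) (v : Vec p) : gram z (c • v) = c ^ 2 * gram z v := by
  simp only [gram, real_inner_smul_left, mul_pow, ← Finset.mul_sum]
  ring

/-- The smooth part is quadratic, so its second-order expansion is exact. It is used with base point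
`wstar`, `what` and the current iterate. -/
theorem objective_sub (z : Fin n → Vec p) (y : Fin n → ℝ) (γ lam : ℝ) (w u : Vec p) :
    objective z y γ lam w - objective z y γ lam u
      = ⟪smoothGrad z y γ u, w - u⟫ + 1 / 2 * (gram z (w - u) - γ * ‖w - u‖ ^ 2)
        + lam * (l1Norm w - l1Norm u) := by
  have h1 : ∀ i, loss (z i) (y i) w = loss (z i) (y i) u + (⟪u, z i⟫ - y i) * ⟪z i, w - u⟫
      + 1 / 2 * ⟪w - u, z i⟫ ^ 2 := by
    intro i
    rw [loss, loss, inner_sub_left, inner_sub_right, real_inner_comm w (z i),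
      real_inner_comm u (z i)]
    ring
  have h2 : ‖w‖ ^ 2 = ‖u‖ ^ 2 + 2 * ⟪u, w - u⟫ + ‖w - u‖ ^ 2 := by
    rw [← norm_add_sq_real]; congr 2; abel
  have h3 : ⟪smoothGrad z y γ u, w - u⟫
      = (1 / n) * ∑ i, (⟪u, z i⟫ - y i) * ⟪z i, w - u⟫ - γ * ⟪u, w - u⟫ := by
    simp only [smoothGrad, inner_sub_left, real_inner_smul_left, sum_inner]
  rw [objective, objective, gram, h2, h3]
  simp only [h1, Finset.sum_add_distrib, ← Finset.mul_sum]
  ring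

/-- First-order optimality over the feasible set. -/
theorem half_quadratic_le_of_isMinOn (hlam : 0 ≤ lam) {what w : Vec p} (hwhat : what ∈ feasible p ρ)
    (hmin : IsMinOn (objective z y γ lam) (feasible p ρ) what) (hw : w ∈ feasible p ρ) :
    1 / 2 * (gram z (w - what) - γ * ‖w - what‖ ^ 2)
      ≤ objective z y γ lam w - objective z y γ lam what := by
  set ℓ := ⟪smoothGrad z y γ what, w - what⟫ + lam * (l1Norm w - l1Norm what) with hℓ
  set Q := gram z (w - what) - γ * ‖w - what‖ ^ 2 with hQ
  -- `Q` may be negative; letting `t → 0` isolates `0 ≤ ℓ`, leaving exactly `Q / 2` as a lower bound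
  -- for the gap.
  have key : ∀ t : ℝ, 0 < t → t < 1 → 0 ≤ ℓ + t * (1 / 2 * Q) := by
    intro t ht ht1
    have hmem : what + t • (w - what) ∈ feasible p ρ :=
      (convex_feasible ρ).add_smul_sub_mem hwhat hw ⟨ht.le, ht1.le⟩
    have h1 : objective z y γ lam what ≤ objective z y γ lam (what + t • (w - what)) := hmin hmem
    have h2 := objective_sub z y γ lam (what + t • (w - what)) what
    have h3 : l1Norm (what + t • (w - what)) ≤ (1 - t) * l1Norm what + t * l1Norm w := by
      have := convexOn_l1Norm.2 (Set.mem_univ what) (Set.mem_univ w) (sub_nonneg.2 ht1.le) ht.le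
        (by ring)
      have e : what + t • (w - what) = (1 - t) • what + t • w := by
        rw [smul_sub, sub_smul, one_smul]; abel
      rw [e]; exact this
    rw [add_sub_cancel_left, inner_smul_right, gram_smul, norm_smul, mul_pow, Real.norm_eq_abs,
      sq_abs] at h2
    have h4 := mul_le_mul_of_nonneg_left h3 hlam
    have h5 : 0 ≤ t * (ℓ + t * (1 / 2 * Q)) := by
      rw [hℓ, hQ]
      linarith
    exact nonneg_of_mul_nonneg_right h5 ht
  have hlim : Filter.Tendsto (fun t : ℝ => ℓ + t * (1 / 2 * Q))
      (nhdsWithin 0 (Set.Ioi 0)) (nhds (ℓ + 0 * (1 / 2 * Q))) := by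
    apply Filter.Tendsto.mono_left _ nhdsWithin_le_nhds
    exact (Continuous.tendsto (by fun_prop) 0)
  have := ge_of_tendsto hlim (Filter.mem_of_superset (Ioo_mem_nhdsGT (zero_lt_one' ℝ))
    (fun t ht => key t ht.1 ht.2))
  rw [objective_sub]
  linarith

/-- The deterministic conditions on the sample under which the corrected Lasso is well behaved:
lower restricted eigenvalues, small noise at `wstar`, and a regularization parameter which dominates
both. -/
structure GoodSample (z : Fin n → Vec p) (y : Fin n → ℝ) (γ ρ lam α τ : ℝ) (wstar : Vec p) :
    Prop where
  lam_pos : 0 < lam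
  τ_nonneg : 0 ≤ τ
  tol_le : 144 * (ρ * τ) ≤ lam
  restricted_eigenvalue : ∀ v, α * ‖v‖ ^ 2 - τ * l1Norm v ^ 2 ≤ gram z v - γ * ‖v‖ ^ 2
  deviation : ∀ j, |smoothGrad z y γ wstar j| ≤ lam / 4

variable {α τ : ℝ} {wstar what w : Vec p} {s : ℕ}

/-- Near-minimizers of the objective are close to the cone around the support of `wstar`. -/
theorem GoodSample.l1Norm_sub_le (h : GoodSample z y γ ρ lam α τ wstar) (hα : 0 ≤ α)
    (hs : IsSparse s wstar) (hstar : wstar ∈ feasible p ρ) (hw : w ∈ feasible p ρ) {D : ℝ}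
    (hD : objective z y γ lam w - objective z y γ lam wstar ≤ D) :
    l1Norm (w - wstar) ≤ 4 * (√s * ‖w - wstar‖) + 2 * (D / lam) := by
  have hl := h.lam_pos
  set ν := w - wstar with hν
  have h1 := l1Norm_sub_le_of_isSparse hs w
  rw [← hν] at h1
  have h2 : -(lam / 4 * l1Norm ν) ≤ ⟪smoothGrad z y γ wstar, ν⟫ :=
    (abs_le.1 (abs_inner_le_mul_l1Norm h.deviation)).1
  have h3 : l1Norm ν ≤ 2 * ρ := by
    have := CorrectedLasso.l1Norm_sub_le w wstar
    have h4 : l1Norm w ≤ ρ := hw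
    have h5 : l1Norm wstar ≤ ρ := hstar
    linarith
  have h0 := l1Norm_nonneg ν
  have h4 : -(lam / 4 * l1Norm ν) ≤ 1 / 2 * (gram z ν - γ * ‖ν‖ ^ 2) := by
    have h5 := h.restricted_eigenvalue ν
    have h6 : τ * l1Norm ν ^ 2 ≤ τ * (2 * ρ * l1Norm ν) := by
      rw [sq]; exact mul_le_mul_of_nonneg_left (mul_le_mul_of_nonneg_right h3 h0) h.τ_nonneg
    have h7 := mul_le_mul_of_nonneg_right h.tol_le h0
    have h8 : 0 ≤ α * ‖ν‖ ^ 2 := by positivity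
    have h9 : 0 ≤ lam * l1Norm ν := by positivity
    linarith
  rw [objective_sub, ← hν] at hD
  have h5 : lam * l1Norm ν ≤ lam * (4 * (√s * ‖ν‖) + 2 * (D / lam)) := by
    have h6 := mul_le_mul_of_nonneg_left h1 hl.le
    have h7 : lam * (2 * (D / lam)) = 2 * D := by field_simp
    rw [mul_add, h7]
    linarith
  exact le_of_mul_le_mul_left h5 hl

/-- The restricted eigenvalue condition along directions towards the minimizer. -/
theorem GoodSample.le_gram_sub (h : GoodSample z y γ ρ lam α τ wstar) (hα : 0 ≤ α)
    (hs : IsSparse s wstar) (hstar : wstar ∈ feasible p ρ) (hwhat : what ∈ feasible p ρ)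
    (hmin : IsMinOn (objective z y γ lam) (feasible p ρ) what) (hw : w ∈ feasible p ρ) :
    (α + γ - 128 * (τ * s)) * ‖w - what‖ ^ 2 ≤ gram z (w - what)
      + 1 / 9 * (objective z y γ lam w - objective z y γ lam what
        + 1440 * (τ * s) * ‖what - wstar‖ ^ 2) := by
  have hl := h.lam_pos
  have hτ := h.τ_nonneg
  set D := objective z y γ lam w - objective z y γ lam what with hD
  have hD0 : 0 ≤ D := sub_nonneg.2 (hmin hw)
  have hms : objective z y γ lam what ≤ objective z y γ lam wstar := hmin hstar
  have h1 := h.l1Norm_sub_le hα hs hstar hw (D := D) (by linarith)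
  have h2 := h.l1Norm_sub_le hα hs hstar hwhat (D := 0) (by linarith)
  simp only [zero_div, mul_zero, add_zero] at h2
  have hd : w - what = (w - wstar) - (what - wstar) := by abel
  have hd' : w - wstar = (w - what) + (what - wstar) := by abel
  have h3 : l1Norm (w - what) ≤ l1Norm (w - wstar) + l1Norm (what - wstar) := by
    rw [hd]; exact CorrectedLasso.l1Norm_sub_le _ _
  have h4 : ‖w - wstar‖ ≤ ‖w - what‖ + ‖what - wstar‖ := by
    rw [hd']; exact norm_add_le _ _
  have h5 : l1Norm (w - wstar) ≤ 2 * ρ := by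
    have := CorrectedLasso.l1Norm_sub_le w wstar
    have h4 : l1Norm w ≤ ρ := hw
    have h5 : l1Norm wstar ≤ ρ := hstar
    linarith
  set a := ‖w - what‖
  set b := ‖what - wstar‖
  set e := ‖w - wstar‖
  set E := D / lam with hE
  have hE0 : 0 ≤ E := by positivity
  have ha : 0 ≤ a := norm_nonneg _
  have hb : 0 ≤ b := norm_nonneg _
  have he : 0 ≤ e := norm_nonneg _
  have hsq : √(s : ℝ) ^ 2 = s := Real.sq_sqrt (Nat.cast_nonneg s)
  have hs0 : 0 ≤ √(s : ℝ) := Real.sqrt_nonneg _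
  have hx0 := l1Norm_nonneg (w - wstar)
  have hy0 := l1Norm_nonneg (what - wstar)
  have hu0 := l1Norm_nonneg (w - what)
  -- Squaring the cone bound would give `E²`; the diameter `2ρ` of the feasible set makes the
  -- contribution linear in `E`, hence in the gap.
  have hwst : l1Norm (w - wstar) ^ 2 ≤ 2 * (16 * (s * e ^ 2)) + 8 * (ρ * E) := by
    rcases le_total (2 * E) (2 * ρ) with hc | hc
    · have h6 : l1Norm (w - wstar) ^ 2 ≤ (4 * (√s * e) + 2 * E) ^ 2 := by gcongr
      have h7 : (4 * (√s * e) + 2 * E) ^ 2 ≤ 2 * (16 * (√s ^ 2 * e ^ 2)) + 2 * (2 * E * (2 * E)) := by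
        nlinarith [sq_nonneg (4 * (√s * e) - 2 * E)]
      have h8 : 2 * E * (2 * E) ≤ 2 * ρ * (2 * E) := by gcongr
      rw [hsq] at h7
      linarith
    · have h6 : l1Norm (w - wstar) ^ 2 ≤ (2 * ρ) * (4 * (√s * e) + 2 * E) := by
        rw [sq]; exact mul_le_mul h5 h1 hx0 (by linarith)
      have h7 : l1Norm (w - wstar) ^ 2 ≤ (2 * ρ) * (2 * E) := by
        rw [sq]
        exact mul_le_mul h5 (h5.trans hc) hx0 (by linarith)
      have h8 : 0 ≤ (s : ℝ) * e ^ 2 := by positivity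
      nlinarith [mul_nonneg (by linarith : 0 ≤ ρ) hE0]
  have hwh : l1Norm (what - wstar) ^ 2 ≤ 16 * (s * b ^ 2) := by
    have h6 : l1Norm (what - wstar) ^ 2 ≤ (4 * (√s * b)) ^ 2 := by gcongr
    rw [mul_pow, mul_pow, hsq] at h6
    linarith
  have he2 : s * e ^ 2 ≤ (s : ℝ) * (2 * a ^ 2 + 2 * b ^ 2) := by
    have : e ^ 2 ≤ (a + b) ^ 2 := by gcongr
    refine mul_le_mul_of_nonneg_left ?_ (Nat.cast_nonneg s)
    nlinarith [sq_nonneg (a - b)]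
  have htot : l1Norm (w - what) ^ 2 ≤ 128 * (s * a ^ 2) + 160 * (s * b ^ 2) + 16 * (ρ * E) := by
    have h6 : l1Norm (w - what) ^ 2 ≤ (l1Norm (w - wstar) + l1Norm (what - wstar)) ^ 2 := by gcongr
    nlinarith [sq_nonneg (l1Norm (w - wstar) - l1Norm (what - wstar))]
  -- The constant 144 turns `16 ρ τ E` into `D / 9`; likewise `160 = 1440 / 9`.
  have hρE : 144 * (ρ * τ) * E ≤ D := by
    have := mul_le_mul_of_nonneg_right h.tol_le hE0
    have h6 : lam * E = D := by rw [hE]; field_simp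
    linarith
  have hre := h.restricted_eigenvalue (w - what)
  have h7 := mul_le_mul_of_nonneg_left htot hτ
  linarith

end Objective

/-! ### SDCA on the corrected Lasso -/

section Lasso

variable {n p : ℕ} {z : Fin n → Vec p} {y : Fin n → ℝ} {γ ρ lam lam' η : ℝ} {L : Fin n → ℝ}

theorem strongConvexOn_sdca_g {c : ℝ} (hc : 0 ≤ c) (ρ : ℝ) :
    StrongConvexOn (feasible p ρ) 1 (fun w : Vec p => (1 / 2) * ‖w‖ ^ 2 + c * l1Norm w) := by
  rw [strongConvexOn_iff_convex]
  have h : ConvexOn ℝ (feasible p ρ) fun w : Vec p => c * l1Norm w :=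
    (convexOn_l1Norm.subset (Set.subset_univ _) (convex_feasible ρ)).smul hc
  simpa [add_sub_cancel_left] using h

theorem sdca_Lbar (hn : 1 ≤ n) :
    (sdca z y γ ρ lam lam' L η).Lbar = (∑ i, L i) / n + (lam' + γ) := by
  have : (n : ℝ) ≠ 0 := by positivity
  simp only [SDCA.Lbar, sdca, Fin.sum_univ_castSucc, Fin.snoc_castSucc, Fin.snoc_last,
    ← Finset.mul_sum]
  push_cast
  field_simp

theorem gradient_sdca_castSucc (i : Fin n) (w : Vec p) :
    gradient ((sdca z y γ ρ lam lam' L η).φ i.castSucc) w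
      = (((n + 1 : ℝ) / n) * (⟪w, z i⟫ - y i)) • z i := by
  simp only [sdca, Fin.snoc_castSucc]
  exact (hasGradientAt_loss _ _ _ _).gradient

theorem gradient_sdca_last (w : Vec p) :
    gradient ((sdca z y γ ρ lam lam' L η).φ (Fin.last n)) w = -(((lam' + γ) * (n + 1)) • w) := by
  simp only [sdca, Fin.snoc_last]
  exact (hasGradientAt_norm_sq _ _).gradient

/-- The last component corrects for the covariate noise and removes the quadratic that is moved into
the regularizer. -/
theorem average_gradient_sdca (hn : 1 ≤ n) (w : Vec p) :
    (1 / ((n + 1 : ℕ) : ℝ)) • ∑ i, gradient ((sdca z y γ ρ lam lam' L η).φ i) w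
      = smoothGrad z y γ w - lam' • w := by
  have hn' : (n : ℝ) ≠ 0 := by positivity
  have hn1 : (n + 1 : ℝ) ≠ 0 := by positivity
  rw [Fin.sum_univ_castSucc]
  simp only [gradient_sdca_castSucc, gradient_sdca_last, smoothGrad, ← smul_smul, ← Finset.smul_sum]
  push_cast
  rw [smul_add, smul_neg, smul_smul, smul_smul (lam' + γ), smul_smul (1 / (n + 1 : ℝ))]
  have e1 : 1 / (n + 1 : ℝ) * ((n + 1) / n) = 1 / n := by field_simp
  have e2 : 1 / (n + 1 : ℝ) * ((lam' + γ) * (n + 1)) = lam' + γ := by field_simp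
  rw [e1, e2, add_smul]
  abel

variable (hL : ∀ i, ‖z i‖ ^ 2 ≤ L i)
include hL

theorem sdca_L_nonneg (hlam' : 0 < lam') (hγ : 0 ≤ γ) (i : Fin (n + 1)) :
    0 ≤ (sdca z y γ ρ lam lam' L η).L i := by
  induction i using Fin.lastCases with
  | last => simp only [sdca, Fin.snoc_last]; positivity
  | cast i =>
    simp only [sdca, Fin.snoc_castSucc]
    have := (sq_nonneg ‖z i‖).trans (hL i)
    positivity

theorem sdca_Lbar_pos (hn : 1 ≤ n) (hlam' : 0 < lam') (hγ : 0 ≤ γ) :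
    0 < (sdca z y γ ρ lam lam' L η).Lbar := by
  rw [sdca_Lbar hn]
  have : 0 ≤ (∑ i, L i) / n :=
    div_nonneg (Finset.sum_nonneg fun i _ => (sq_nonneg ‖z i‖).trans (hL i)) (Nat.cast_nonneg _)
  linarith

/-- The uniform half of the sampling law gives `q i ≥ 1 / (2(n + 1))`, which the bound `η ≤ 1 / (4
lam' (n + 1))` is designed for. -/
theorem regular_sdca (hn : 1 ≤ n) (hlam' : 0 < lam') (hγ : 0 ≤ γ) (hlam : 0 ≤ lam) (hρ : 0 < ρ)
    (hη : 0 < η) (hη2 : η ≤ 1 / (4 * lam' * (n + 1))) :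
    (sdca z y γ ρ lam lam' L η).Regular := by
  have hLi := sdca_L_nonneg (y := y) (ρ := ρ) (lam := lam) (η := η) hL hlam' hγ
  have hLb := sdca_Lbar_pos (y := y) (ρ := ρ) (lam := lam) (η := η) hL hn hlam' hγ
  set 𝒜 := sdca z y γ ρ lam lam' L η with h𝒜
  have hn1 : (0 : ℝ) < n + 1 := by positivity
  have hq : ∀ i, 𝒜.q i = (𝒜.L i + 𝒜.Lbar) / (2 * (n + 1) * 𝒜.Lbar) := fun i => by
    rw [SDCA.q]; push_cast; rfl
  refine ⟨n.succ_pos, hlam', hη, fun i => ?_, ?_, fun i => ?_, isCompact_feasible ρ,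
    ⟨0, by simp [h𝒜, sdca, feasible, l1Norm, hρ.le]⟩, ?_, ?_⟩
  · rw [hq]
    have := hLi i
    positivity
  · simp only [hq]
    rw [← Finset.sum_div, Finset.sum_add_distrib, Finset.sum_const, Finset.card_univ,
      Fintype.card_fin]
    have : ∑ i, 𝒜.L i = (n + 1) * 𝒜.Lbar := by
      rw [SDCA.Lbar]; push_cast; field_simp
    rw [this, nsmul_eq_mul]
    push_cast
    field_simp
    ring
  · have h1 : 1 / (2 * (n + 1)) ≤ 𝒜.q i := by
      rw [hq, div_le_div_iff₀ (by positivity) (by positivity)]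
      have := mul_nonneg (hLi i) hn1.le
      linarith
    refine le_trans ?_ h1
    have h2 := mul_le_mul_of_nonneg_right hη2 hlam'.le
    have h3 : 1 / (4 * lam' * (n + 1)) * lam' = 1 / (2 * (n + 1)) / 2 := by field_simp; norm_num
    have : 𝒜.η * 𝒜.lam = η * lam' := rfl
    linarith
  · simp only [h𝒜, sdca]
    have := continuous_l1Norm (p := p)
    fun_prop
  · exact strongConvexOn_sdca_g (div_nonneg hlam hlam'.le) ρ

/-- The smoothness-proportional half of the sampling law gives `L i / q i ≤ 2 N Lbar`, so the
average smoothness replaces the maximum. For each component the squared gradient difference is at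
most its smoothness times its own quadratic form (in absolute value). -/
theorem sum_gradient_sdca_le (hn : 1 ≤ n) (hlam' : 0 < lam') (hγ : 0 ≤ γ) (hη : 0 < η)
    (w u : Vec p) :
    η / ((n + 1 : ℕ) : ℝ) ^ 2 * (∑ i, 1 / (sdca z y γ ρ lam lam' L η).q i *
      ‖gradient ((sdca z y γ ρ lam lam' L η).φ i) w
        - gradient ((sdca z y γ ρ lam lam' L η).φ i) u‖ ^ 2)
    ≤ 2 * η * ((∑ i, L i) / n + (lam' + γ)) * (gram z (w - u) + (lam' + γ) * ‖w - u‖ ^ 2) := by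
  have hLi := sdca_L_nonneg (y := y) (ρ := ρ) (lam := lam) (η := η) hL hlam' hγ
  have hLb := sdca_Lbar_pos (y := y) (ρ := ρ) (lam := lam) (η := η) hL hn hlam' hγ
  have hLbar := sdca_Lbar (z := z) (y := y) (γ := γ) (ρ := ρ) (lam := lam) (lam' := lam')
    (L := L) (η := η) hn
  have hgc := gradient_sdca_castSucc (z := z) (y := y) (γ := γ) (ρ := ρ) (lam := lam) (lam' := lam')
    (L := L) (η := η)
  have hgl := gradient_sdca_last (z := z) (y := y) (γ := γ) (ρ := ρ) (lam := lam) (lam' := lam')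
    (L := L) (η := η)
  have hLc : ∀ i : Fin n, (sdca z y γ ρ lam lam' L η).L i.castSucc = ((n + 1 : ℝ) / n) * L i :=
    fun i => by simp [sdca]
  have hLl : (sdca z y γ ρ lam lam' L η).L (Fin.last n) = (lam' + γ) * (n + 1) := by simp [sdca]
  rw [← hLbar]
  set 𝒜 := sdca z y γ ρ lam lam' L η with h𝒜
  have hn1 : (0 : ℝ) < n + 1 := by positivity
  have hn0 : (0 : ℝ) < n := by positivity
  have hq : ∀ i, 1 / 𝒜.q i * 𝒜.L i ≤ 2 * (n + 1) * 𝒜.Lbar := fun i => by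
    have h1 := hLi i
    have : 𝒜.q i = (𝒜.L i + 𝒜.Lbar) / (2 * (n + 1) * 𝒜.Lbar) := by
      rw [SDCA.q]; push_cast; rfl
    rw [this, one_div_div, div_mul_eq_mul_div, div_le_iff₀ (by positivity)]
    gcongr
    linarith
  have hqpos : ∀ i, 0 < 1 / 𝒜.q i := fun i => by
    have h1 := hLi i
    have : 𝒜.q i = (𝒜.L i + 𝒜.Lbar) / (2 * (n + 1) * 𝒜.Lbar) := by
      rw [SDCA.q]; push_cast; rfl
    rw [this]
    positivity
  rw [Fin.sum_univ_castSucc]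
  have h1 : ∀ i : Fin n, 1 / 𝒜.q i.castSucc * ‖gradient (𝒜.φ i.castSucc) w
      - gradient (𝒜.φ i.castSucc) u‖ ^ 2
      ≤ 2 * (n + 1) * 𝒜.Lbar * ((n + 1) / n) * ⟪w - u, z i⟫ ^ 2 := by
    intro i
    have h2 : ‖gradient (𝒜.φ i.castSucc) w - gradient (𝒜.φ i.castSucc) u‖ ^ 2
        ≤ 𝒜.L i.castSucc * (((n + 1) / n) * ⟪w - u, z i⟫ ^ 2) := by
      rw [hgc, hgc, ← sub_smul, norm_smul, mul_pow, Real.norm_eq_abs, sq_abs, hLc, inner_sub_left]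
      have : (((n + 1 : ℝ) / n) * (⟪w, z i⟫ - y i) - ((n + 1 : ℝ) / n) * (⟪u, z i⟫ - y i)) ^ 2
        = ((n + 1 : ℝ) / n) ^ 2 * (⟪w, z i⟫ - ⟪u, z i⟫) ^ 2 := by ring
      rw [this]
      have := mul_le_mul_of_nonneg_left (hL i)
        (by positivity : 0 ≤ ((n + 1 : ℝ) / n) ^ 2 * (⟪w, z i⟫ - ⟪u, z i⟫) ^ 2)
      linarith
    have h3 := mul_le_mul_of_nonneg_left h2 (hqpos i.castSucc).le
    have h4 := mul_le_mul_of_nonneg_right (hq i.castSucc)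
      (by positivity : 0 ≤ ((n + 1 : ℝ) / n) * ⟪w - u, z i⟫ ^ 2)
    linarith
  have h2 : 1 / 𝒜.q (Fin.last n) * ‖gradient (𝒜.φ (Fin.last n)) w
      - gradient (𝒜.φ (Fin.last n)) u‖ ^ 2
      ≤ 2 * (n + 1) * 𝒜.Lbar * ((lam' + γ) * (n + 1)) * ‖w - u‖ ^ 2 := by
    have h3 : ‖gradient (𝒜.φ (Fin.last n)) w - gradient (𝒜.φ (Fin.last n)) u‖ ^ 2
        = 𝒜.L (Fin.last n) * ((lam' + γ) * (n + 1) * ‖w - u‖ ^ 2) := by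
      rw [hgl, hgl, neg_sub_neg, ← smul_sub, norm_smul, mul_pow, Real.norm_eq_abs, sq_abs, hLl,
        norm_sub_rev]
      ring
    rw [h3]
    have h4 := mul_le_mul_of_nonneg_right (hq (Fin.last n))
      (by positivity : 0 ≤ (lam' + γ) * (n + 1) * ‖w - u‖ ^ 2)
    linarith
  have h3 := add_le_add (Finset.sum_le_sum fun i (_ : i ∈ Finset.univ) => h1 i) h2
  refine (mul_le_mul_of_nonneg_left h3 (by positivity)).trans (le_of_eq ?_)
  rw [← Finset.mul_sum, gram]
  push_cast
  field_simp

/-- Expanding at `w`, the progress equals `D + (G - γa)/2 - lam' a/2`. Restricted curvature bounds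
the negative multiples of `a` by `G`, `D` and the tolerance; optimality bounds `G - γa` by `2D`. -/
theorem gapCondition_sdca (hn : 1 ≤ n) (hlam' : 0 < lam') (hγ : 0 ≤ γ)
    {s : ℕ} {α τ : ℝ} {wstar what : Vec p} (hgood : GoodSample z y γ ρ lam α τ wstar)
    (hα : lam' + 2 * γ + 128 * (τ * s) ≤ α) (hs : IsSparse s wstar) (hstar : wstar ∈ feasible p ρ)
    (hwhat : what ∈ feasible p ρ)
    (hmin : IsMinOn (objective z y γ lam) (feasible p ρ) what)
    (hη : 0 < η) (hη1 : η ≤ 1 / (16 * (lam' + (∑ i, L i) / n))) (hγL : 3 * γ ≤ (∑ i, L i) / n) :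
    (sdca z y γ ρ lam lam' L η).GapCondition (objective z y γ lam) what
      (1440 * (τ * s) * ‖what - wstar‖ ^ 2) (1 / 12) := by
  intro w hw
  have hw : w ∈ feasible p ρ := hw
  have hτ := hgood.τ_nonneg
  have hα0 : 0 ≤ α := le_trans (by positivity) hα
  have h1 := sum_gradient_sdca_le (y := y) (ρ := ρ) (lam := lam) hL hn hlam' hγ hη w what
  have h2 := hgood.le_gram_sub hα0 hs hstar hwhat hmin hw
  have h3 := half_quadratic_le_of_isMinOn hgood.lam_pos.le hwhat hmin hw
  have h4 := objective_sub z y γ lam what w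
  rw [average_gradient_sdca hn]
  have hg : (sdca z y γ ρ lam lam' L η).lam * ((sdca z y γ ρ lam lam' L η).g w
      - (sdca z y γ ρ lam lam' L η).g what)
      = lam' * (1 / 2 * (‖w‖ ^ 2 - ‖what‖ ^ 2)) + lam * (l1Norm w - l1Norm what) := by
    simp only [sdca]; field_simp; ring
  rw [hg]
  have e1 : ⟪w - what, smoothGrad z y γ w - lam' • w⟫
      = -⟪smoothGrad z y γ w, what - w⟫ - lam' * ⟪w - what, w⟫ := by
    rw [inner_sub_right, real_inner_smul_right, real_inner_comm, ← neg_sub w what, inner_neg_right]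
    ring
  have e2 : 1 / 2 * (‖w‖ ^ 2 - ‖what‖ ^ 2) = ⟪w - what, w⟫ - 1 / 2 * ‖w - what‖ ^ 2 := by
    simp only [← real_inner_self_eq_norm_sq, inner_sub_left, inner_sub_right]
    rw [real_inner_comm what w]; ring
  have e3 : gram z (what - w) = gram z (w - what) := by
    have := gram_smul z (-1) (w - what)
    simpa using this
  rw [e3, norm_sub_rev what w] at h4
  rw [e1, e2]
  set D := objective z y γ lam w - objective z y γ lam what with hD
  set G := gram z (w - what) with hG
  set a := ‖w - what‖ ^ 2
  set δ := 1440 * (τ * s) * ‖what - wstar‖ ^ 2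
  have hG0 : 0 ≤ G := gram_nonneg _ _
  have ha0 : 0 ≤ a := sq_nonneg _
  set Lb := (∑ i, L i) / n
  have hLb : 0 ≤ Lb := by linarith
  -- The step-size bound does not see `γ`; using `γ ≤ Lb / 3`, the left side is at most `(8/3) η
  -- (lam' + Lb)`.
  have hθ : 2 * η * (Lb + (lam' + γ)) ≤ 1 / 6 := by
    rw [le_div_iff₀ (by positivity)] at hη1
    have := mul_le_mul_of_nonneg_left hγL hη.le
    have h5 := mul_pos hη hlam'
    linarith
  have h5 : 2 * η * (Lb + (lam' + γ)) * (G + (lam' + γ) * a) ≤ 1 / 6 * (G + (lam' + γ) * a) :=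
    mul_le_mul_of_nonneg_right hθ (by positivity)
  have h6 : (lam' + 3 * γ) * a ≤ (α + γ - 128 * (τ * s)) * a :=
    mul_le_mul_of_nonneg_right (by linarith) ha0
  have h7 : 0 ≤ γ * a := by positivity
  have h8 : 0 ≤ lam' * a := by positivity
  have hη' : (sdca z y γ ρ lam lam' L η).η = η := rfl
  rw [hη']
  -- Weight 3/4 on `h2` and `h6` and weight 5/6 on `h3` match the coefficients of `D`, `G` and `δ`;
  -- `h7` and `h8` absorb the surplus.
  linarith

end Lasso

/-! ### Products of sub-Gaussian random variables -/

section Bernstein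

variable {Ω : Type*} [MeasurableSpace Ω] {P : Measure Ω} [IsProbabilityMeasure P]

theorem lintegral_exp_mul_gaussianReal (x : ℝ) :
    ∫⁻ g, ENNReal.ofReal (Real.exp (x * g)) ∂(gaussianReal 0 1)
      = ENNReal.ofReal (Real.exp (x ^ 2 / 2)) := by
  rw [← ofReal_integral_eq_lintegral_ofReal (integrable_exp_mul_gaussianReal x)
    (Filter.Eventually.of_forall fun _ => (Real.exp_pos _).le)]
  have := congrFun (mgf_fun_id_gaussianReal (μ := 0) (v := 1)) x
  rw [mgf] at this
  rw [this]
  simp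

/-- Multiplying the standard density by `exp (g² / 4)` gives a multiple of the `N(0, 2)` density;
the multiple `√2` is rounded up to 2. -/
theorem lintegral_exp_sq_gaussianReal_le :
    ∫⁻ g, ENNReal.ofReal (Real.exp (g ^ 2 / 4)) ∂(gaussianReal 0 1) ≤ ENNReal.ofReal 2 := by
  rw [gaussianReal_of_var_ne_zero 0 one_ne_zero,
    lintegral_withDensity_eq_lintegral_mul _ (measurable_gaussianPDF 0 1) (by fun_prop)]
  have h : ∀ g : ℝ, (gaussianPDF 0 1 * fun g => ENNReal.ofReal (Real.exp (g ^ 2 / 4))) g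
      ≤ ENNReal.ofReal 2 * gaussianPDF 0 2 g := by
    intro g
    simp only [Pi.mul_apply, gaussianPDF]
    rw [← ENNReal.ofReal_mul (gaussianPDFReal_nonneg _ _ _), ← ENNReal.ofReal_mul zero_le_two]
    refine ENNReal.ofReal_le_ofReal ?_
    rw [gaussianPDFReal, gaussianPDFReal, mul_assoc, ← Real.exp_add, ← mul_assoc]
    have e : -(g - 0) ^ 2 / (2 * ((1 : ℝ≥0) : ℝ)) + g ^ 2 / 4
        = -(g - 0) ^ 2 / (2 * ((2 : ℝ≥0) : ℝ)) := by
      push_cast; ring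
    rw [e]
    refine mul_le_mul_of_nonneg_right ?_ (Real.exp_pos _).le
    have h1 : √(2 * Real.pi * ((2 : ℝ≥0) : ℝ)) ≤ 2 * √(2 * Real.pi * ((1 : ℝ≥0) : ℝ)) := by
      rw [Real.sqrt_le_left (by positivity), mul_pow, Real.sq_sqrt (by positivity)]
      push_cast
      nlinarith [Real.pi_pos]
    have h2 : 0 < √(2 * Real.pi * ((1 : ℝ≥0) : ℝ)) := Real.sqrt_pos.2 (by positivity)
    have h3 : 0 < √(2 * Real.pi * ((2 : ℝ≥0) : ℝ)) := Real.sqrt_pos.2 (by positivity)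
    rw [← div_eq_mul_inv, inv_eq_one_div, div_le_div_iff₀ h2 h3]
    linarith
  calc _ ≤ ∫⁻ g, ENNReal.ofReal 2 * gaussianPDF 0 2 g := lintegral_mono h
    _ = ENNReal.ofReal 2 := by
      rw [lintegral_const_mul _ (measurable_gaussianPDF 0 2),
        lintegral_gaussianPDF_eq_one 0 two_ne_zero, mul_one]

/-- The square of a sub-Gaussian variable is sub-exponential. -/
theorem integral_exp_sq_le_of_hasSubgaussianMGF {X : Ω → ℝ} {α : ℝ≥0} (hX : HasSubgaussianMGF X α P)
    (hα : 0 < α) : Integrable (fun ω => Real.exp (X ω ^ 2 / (4 * α))) P ∧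
      ∫ ω, Real.exp (X ω ^ 2 / (4 * α)) ∂P ≤ 2 := by
  have hα' : (0 : ℝ) < α := by exact_mod_cast hα
  have hm := hX.aemeasurable
  have key : ∫⁻ ω, ENNReal.ofReal (Real.exp (X ω ^ 2 / (4 * α))) ∂P ≤ ENNReal.ofReal 2 := by
    -- Linearize the square with an auxiliary Gaussian `g`, exchange the integrals, and apply the
    -- sub-Gaussian bound for fixed `g`.
    calc ∫⁻ ω, ENNReal.ofReal (Real.exp (X ω ^ 2 / (4 * α))) ∂P
        = ∫⁻ ω, ∫⁻ g, ENNReal.ofReal (Real.exp (X ω / √(2 * α) * g)) ∂(gaussianReal 0 1) ∂P := by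
          refine lintegral_congr fun ω => ?_
          rw [lintegral_exp_mul_gaussianReal, div_pow, Real.sq_sqrt (by positivity), div_div]
          congr 3; ring
      _ = ∫⁻ g, ∫⁻ ω, ENNReal.ofReal (Real.exp (X ω / √(2 * α) * g)) ∂P ∂(gaussianReal 0 1) := by
          refine lintegral_lintegral_swap ?_
          have h1 : AEMeasurable (fun q : Ω × ℝ => X q.1) (P.prod (gaussianReal 0 1)) :=
            hm.comp_fst
          have h2 : AEMeasurable (fun q : Ω × ℝ => q.2) (P.prod (gaussianReal 0 1)) :=
            measurable_snd.aemeasurable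
          exact (((h1.div_const _).mul h2).exp).ennreal_ofReal
      _ ≤ ∫⁻ g, ENNReal.ofReal (Real.exp (g ^ 2 / 4)) ∂(gaussianReal 0 1) := by
          refine lintegral_mono fun g => ?_
          have e : ∀ ω, X ω / √(2 * α) * g = (g / √(2 * α)) * X ω := fun ω => by ring
          simp only [e]
          rw [← ofReal_integral_eq_lintegral_ofReal (hX.integrable_exp_mul _)
            (Filter.Eventually.of_forall fun _ => (Real.exp_pos _).le)]
          refine ENNReal.ofReal_le_ofReal ((hX.mgf_le _).trans (le_of_eq ?_))
          rw [div_pow, Real.sq_sqrt (by positivity)]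
          congr 1
          field_simp
          norm_num
      _ ≤ _ := lintegral_exp_sq_gaussianReal_le
  have hmeas : AEStronglyMeasurable (fun ω => Real.exp (X ω ^ 2 / (4 * α))) P :=
    ((hm.pow_const 2).div_const _).exp.aestronglyMeasurable
  have hint : Integrable (fun ω => Real.exp (X ω ^ 2 / (4 * α))) P := by
    refine ⟨hmeas, ?_⟩
    rw [hasFiniteIntegral_iff_ofReal (Filter.Eventually.of_forall fun _ => (Real.exp_pos _).le)]
    exact key.trans_lt ENNReal.ofReal_lt_top
  refine ⟨hint, ?_⟩
  rw [← ofReal_integral_eq_lintegral_ofReal hint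
    (Filter.Eventually.of_forall fun _ => (Real.exp_pos _).le)] at key
  exact (ENNReal.ofReal_le_ofReal_iff zero_le_two).1 key

theorem exp_le_one_add_add_sq_mul_exp_abs (x : ℝ) :
    Real.exp x ≤ 1 + x + x ^ 2 * Real.exp |x| := by
  have h := Complex.norm_exp_sub_sum_le_norm_mul_exp x 2
  simp only [Finset.sum_range_succ, Finset.sum_range_zero, Nat.factorial] at h
  have e : Complex.exp x - (0 + (x : ℂ) ^ 0 / ((1 : ℕ) : ℂ) + (x : ℂ) ^ 1 / (((0 + 1) * 1 : ℕ) : ℂ))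
      = ((Real.exp x - 1 - x : ℝ) : ℂ) := by
    push_cast; ring
  rw [e, Complex.norm_real, Complex.norm_real, Real.norm_eq_abs, Real.norm_eq_abs, sq_abs] at h
  linarith [(abs_le.1 h).2]

theorem sq_le_mul_exp_half_abs (x : ℝ) : x ^ 2 ≤ 8 * Real.exp (|x| / 2) := by
  have h := Real.quadratic_le_exp_of_nonneg (x := |x| / 2) (by positivity)
  have := abs_nonneg x
  have h2 : (|x| / 2) ^ 2 = x ^ 2 / 4 := by rw [div_pow, sq_abs]; norm_num
  rw [h2] at h
  linarith

/-- Sub-exponential variables have sub-Gaussian moment generating functions near zero. -/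
theorem mgf_sub_integral_le {Y : Ω → ℝ} (hY : AEMeasurable Y P)
    (hint : Integrable (fun ω => Real.exp |Y ω|) P) (hle : ∫ ω, Real.exp |Y ω| ∂P ≤ 2) {θ : ℝ}
    (hθ : |θ| ≤ 1 / 2) :
    Integrable (fun ω => Real.exp (θ * (Y ω - ∫ ω, Y ω ∂P))) P ∧
      mgf (fun ω => Y ω - ∫ ω, Y ω ∂P) P θ ≤ Real.exp (16 * θ ^ 2) := by
  set m := ∫ ω, Y ω ∂P with hm
  have hYint : Integrable Y P := by
    refine hint.mono' hY.aestronglyMeasurable (Filter.Eventually.of_forall fun ω => ?_)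
    rw [Real.norm_eq_abs]
    linarith [Real.add_one_le_exp |Y ω|]
  have hle1 : ∀ ω, |θ * Y ω| ≤ |Y ω| / 2 := fun ω => by
    rw [abs_mul]; nlinarith [abs_nonneg (Y ω)]
  have hexp : Integrable (fun ω => Real.exp (θ * Y ω)) P := by
    refine hint.mono' (hY.const_mul θ).exp.aestronglyMeasurable
      (Filter.Eventually.of_forall fun ω => ?_)
    rw [Real.norm_eq_abs, Real.abs_exp]
    refine Real.exp_le_exp.2 ?_
    linarith [le_abs_self (θ * Y ω), hle1 ω, abs_nonneg (Y ω)]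
  have hfac : ∀ ω, Real.exp (θ * (Y ω - m)) = Real.exp (-(θ * m)) * Real.exp (θ * Y ω) := by
    intro ω; rw [← Real.exp_add]; congr 1; ring
  -- Half of `exp |Y|` absorbs the exponential of the Taylor remainder, since `|θ| ≤ 1/2`, and the
  -- other half absorbs `Y²`.
  have hpt : ∀ ω, Real.exp (θ * Y ω) ≤ 1 + θ * Y ω + 8 * θ ^ 2 * Real.exp |Y ω| := by
    intro ω
    have h1 := exp_le_one_add_add_sq_mul_exp_abs (θ * Y ω)
    have h2 : (θ * Y ω) ^ 2 * Real.exp |θ * Y ω|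
        ≤ θ ^ 2 * (8 * Real.exp (|Y ω| / 2)) * Real.exp (|Y ω| / 2) := by
      rw [mul_pow]
      gcongr
      · exact sq_le_mul_exp_half_abs _
      · exact hle1 ω
    have h3 : Real.exp (|Y ω| / 2) * Real.exp (|Y ω| / 2) = Real.exp |Y ω| := by
      rw [← Real.exp_add]; congr 1; ring
    calc _ ≤ _ := h1
      _ ≤ 1 + θ * Y ω + θ ^ 2 * (8 * Real.exp (|Y ω| / 2)) * Real.exp (|Y ω| / 2) := by linarith
      _ = _ := by rw [← h3]; ring
  have hI : ∫ ω, Real.exp (θ * Y ω) ∂P ≤ Real.exp (θ * m + 16 * θ ^ 2) := by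
    have h1 : ∫ ω, Real.exp (θ * Y ω) ∂P
        ≤ ∫ ω, (1 + θ * Y ω + 8 * θ ^ 2 * Real.exp |Y ω|) ∂P :=
      integral_mono hexp (((integrable_const 1).add (hYint.const_mul θ)).add (hint.const_mul _)) hpt
    have h0 : Integrable (fun ω => 1 + θ * Y ω) P := (integrable_const 1).add (hYint.const_mul θ)
    rw [integral_add h0 (hint.const_mul _), integral_add (integrable_const 1) (hYint.const_mul θ), integral_const_mul,
      integral_const_mul, ← hm] at h1
    simp only [integral_const, probReal_univ, smul_eq_mul, mul_one] at h1
    have h2 := mul_le_mul_of_nonneg_left hle (by positivity : 0 ≤ 8 * θ ^ 2)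
    linarith [Real.add_one_le_exp (θ * m + 16 * θ ^ 2)]
  simp only [mgf, hfac]
  refine ⟨hexp.const_mul _, ?_⟩
  rw [integral_const_mul]
  calc _ ≤ Real.exp (-(θ * m)) * Real.exp (θ * m + 16 * θ ^ 2) :=
        mul_le_mul_of_nonneg_left hI (Real.exp_pos _).le
    _ = _ := by rw [← Real.exp_add]; congr 1; ring

/-- The product of two sub-Gaussian variables is sub-exponential. -/
theorem integral_exp_abs_mul_le {a b : Ω → ℝ} {α β : ℝ≥0} (ha : HasSubgaussianMGF a α P)
    (hb : HasSubgaussianMGF b β P) (hα : 0 < α) (hβ : 0 < β) :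
    Integrable (fun ω => Real.exp |a ω * b ω / (4 * √(α * β))|) P ∧
      ∫ ω, Real.exp |a ω * b ω / (4 * √(α * β))| ∂P ≤ 2 := by
  obtain ⟨ia, la⟩ := integral_exp_sq_le_of_hasSubgaussianMGF ha hα
  obtain ⟨ib, lb⟩ := integral_exp_sq_le_of_hasSubgaussianMGF hb hβ
  have hα' : (0 : ℝ) < α := by exact_mod_cast hα
  have hβ' : (0 : ℝ) < β := by exact_mod_cast hβ
  have hpt : ∀ ω, Real.exp |a ω * b ω / (4 * √(α * β))|
      ≤ 1 / 2 * (Real.exp (a ω ^ 2 / (4 * α)) + Real.exp (b ω ^ 2 / (4 * β))) := by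
    intro ω
    have h1 : |a ω * b ω / (4 * √(α * β))|
        ≤ 1 / 2 * (a ω ^ 2 / (4 * α)) + 1 / 2 * (b ω ^ 2 / (4 * β)) := by
      rw [Real.sqrt_mul hα'.le, abs_div, abs_mul, abs_of_pos (by positivity : 0 < 4 * (√α * √β))]
      have e1 : a ω ^ 2 / (4 * α) = (|a ω| / √α) ^ 2 / 4 := by
        rw [div_pow, Real.sq_sqrt hα'.le, sq_abs]; field_simp
      have e2 : b ω ^ 2 / (4 * β) = (|b ω| / √β) ^ 2 / 4 := by
        rw [div_pow, Real.sq_sqrt hβ'.le, sq_abs]; field_simp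
      have e3 : |a ω| * |b ω| / (4 * (√α * √β)) = (|a ω| / √α) * (|b ω| / √β) / 4 := by
        field_simp
      rw [e1, e2, e3]
      nlinarith [sq_nonneg (|a ω| / √α - |b ω| / √β)]
    refine (Real.exp_le_exp.2 h1).trans ?_
    have := convexOn_exp.2 (Set.mem_univ (a ω ^ 2 / (4 * α))) (Set.mem_univ (b ω ^ 2 / (4 * β)))
      (by norm_num : (0 : ℝ) ≤ 1 / 2) (by norm_num : (0 : ℝ) ≤ 1 / 2) (by norm_num)
    simp only [smul_eq_mul] at this
    linarith
  have hdom := (ia.add ib).const_mul (1 / 2)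
  have hint : Integrable (fun ω => Real.exp |a ω * b ω / (4 * √(α * β))|) P := by
    refine hdom.mono' ?_ (Filter.Eventually.of_forall fun ω => ?_)
    · exact (continuous_abs.measurable.comp_aemeasurable
        ((ha.aemeasurable.mul hb.aemeasurable).div_const _)).exp.aestronglyMeasurable
    · rw [Real.norm_eq_abs, Real.abs_exp]; exact hpt ω
  refine ⟨hint, (integral_mono hint hdom hpt).trans ?_⟩
  rw [integral_const_mul]
  simp only [Pi.add_apply]
  rw [integral_add ia ib]
  linarith

/-- Chernoff with the optimal parameter `t / 32`, which is admissible because `t ≤ 16`. -/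
theorem measure_sum_ge_le_of_mgf_le {n : ℕ} {X : Fin n → Ω → ℝ} (hX : ∀ i, Measurable (X i))
    (hind : iIndepFun X P)
    (hint : ∀ i (θ : ℝ), |θ| ≤ 1 / 2 → Integrable (fun ω => Real.exp (θ * X i ω)) P)
    (hmgf : ∀ i (θ : ℝ), |θ| ≤ 1 / 2 → mgf (X i) P θ ≤ Real.exp (16 * θ ^ 2))
    {t : ℝ} (ht : 0 ≤ t) (ht' : t ≤ 16) :
    P.real {ω | n * t ≤ ∑ i, X i ω} ≤ Real.exp (-(n * t ^ 2 / 64)) := by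
  have hθ : |t / 32| ≤ 1 / 2 := by rw [abs_of_nonneg (by positivity)]; linarith
  have h1 := measure_ge_le_exp_mul_mgf (μ := P) (X := ∑ i, X i) (t := t / 32) (n * t)
    (by positivity) (hind.integrable_exp_mul_sum hX fun i _ => hint i _ hθ)
  rw [hind.mgf_sum hX] at h1
  have h2 : ∏ i, mgf (X i) P (t / 32) ≤ ∏ _i : Fin n, Real.exp (16 * (t / 32) ^ 2) :=
    Finset.prod_le_prod (fun i _ => mgf_nonneg) fun i _ => hmgf i _ hθ
  rw [Finset.prod_const, Finset.card_univ, Fintype.card_fin, ← Real.exp_nat_mul] at h2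
  simp only [Finset.sum_apply] at h1
  refine h1.trans ((mul_le_mul_of_nonneg_left h2 (Real.exp_pos _).le).trans (le_of_eq ?_))
  rw [← Real.exp_add]
  congr 1
  ring

/-- **Bernstein's inequality** for sums of products of sub-Gaussian variables. -/
theorem measure_abs_sum_mul_sub_gt_le {n : ℕ} {a b : Fin n → Ω → ℝ} {α β : ℝ≥0} {m : ℝ}
    (hma : ∀ i, Measurable (a i)) (hmb : ∀ i, Measurable (b i))
    (ha : ∀ i, HasSubgaussianMGF (a i) α P) (hb : ∀ i, HasSubgaussianMGF (b i) β P)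
    (hind : iIndepFun (fun i ω => a i ω * b i ω) P) (hm : ∀ i, ∫ ω, a i ω * b i ω ∂P = m)
    {t : ℝ} (ht : 0 ≤ t) (ht' : t ≤ 64) :
    P.real {ω | n * (t * √(α * β)) < |∑ i, a i ω * b i ω - n * m|}
      ≤ 2 * Real.exp (-(n * t ^ 2 / 1024)) := by
  by_cases h0 : 0 < α ∧ 0 < β
  · obtain ⟨hα, hβ⟩ := h0
    have hα' : (0 : ℝ) < α := by exact_mod_cast hα
    have hβ' : (0 : ℝ) < β := by exact_mod_cast hβ
    -- In units of `r` the threshold is `t / 4`, whence `(t / 4)² / 64 = t² / 1024` and the range `t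
    -- ≤ 64`.
    set r := 4 * √((α : ℝ) * β) with hr
    have hr0 : 0 < r := by positivity
    set X : Fin n → Ω → ℝ := fun i ω => a i ω * b i ω / r - m / r with hXdef
    have hXm : ∀ i, Measurable (X i) := fun i => (((hma i).mul (hmb i)).div_const _).sub_const _
    have hXind : iIndepFun X P :=
      hind.comp (fun _ u => u / r - m / r) fun _ => by fun_prop
    have hsub : ∀ i (θ : ℝ), |θ| ≤ 1 / 2 → Integrable (fun ω => Real.exp (θ * X i ω)) P ∧
        mgf (X i) P θ ≤ Real.exp (16 * θ ^ 2) := by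
      intro i θ hθ
      obtain ⟨h1, h2⟩ := integral_exp_abs_mul_le (ha i) (hb i) hα hβ
      have h3 := mgf_sub_integral_le (((hma i).mul (hmb i)).div_const r).aemeasurable h1 h2 hθ
      simp only [Pi.mul_apply] at h3
      rw [integral_div, hm i] at h3
      exact h3
    have hpos := measure_sum_ge_le_of_mgf_le hXm hXind (fun i θ hθ => (hsub i θ hθ).1)
      (fun i θ hθ => (hsub i θ hθ).2) (t := t / 4) (by positivity) (by linarith)
    have hneg := measure_sum_ge_le_of_mgf_le (X := fun i ω => -X i ω) (fun i => (hXm i).neg)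
      (hXind.comp (fun _ u => -u) fun _ => measurable_neg)
      (fun i θ hθ => by simpa using (hsub i (-θ) (by simpa using hθ)).1)
      (fun i θ hθ => by
        have := (hsub i (-θ) (by simpa using hθ)).2
        rw [neg_sq] at this
        refine le_trans (le_of_eq ?_) this
        simp [mgf]) (t := t / 4) (by positivity) (by linarith)
    have hsum : ∀ ω, ∑ i, X i ω = (∑ i, a i ω * b i ω - n * m) / r := by
      intro ω
      simp only [hXdef, Finset.sum_sub_distrib, ← Finset.sum_div, Finset.sum_const,
        Finset.card_univ, Fintype.card_fin, nsmul_eq_mul]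
      ring
    have hsubset : {ω | n * (t * √(α * β)) < |∑ i, a i ω * b i ω - n * m|}
        ⊆ {ω | n * (t / 4) ≤ ∑ i, X i ω} ∪ {ω | n * (t / 4) ≤ ∑ i, -X i ω} := by
      intro ω hω
      simp only [Set.mem_ofPred_eq, Set.mem_union, Finset.sum_neg_distrib, hsum] at hω ⊢
      have e : n * (t * √((α : ℝ) * β)) = n * (t / 4) * r := by rw [hr]; ring
      rw [e] at hω
      rcases lt_abs.1 hω with h | h
      · left; rw [le_div_iff₀ hr0]; exact h.le
      · right; rw [← neg_div, le_div_iff₀ hr0]; exact h.le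
    refine (measureReal_mono hsubset).trans ((measureReal_union_le _ _).trans ?_)
    have e : (n : ℝ) * (t / 4) ^ 2 / 64 = n * t ^ 2 / 1024 := by ring
    rw [e] at hpos hneg
    linarith
  -- A zero variance proxy makes every product vanish almost surely; the strict inequality in the
  -- event then makes it null.
  · have hzero : ∀ i, (fun ω => a i ω * b i ω) =ᵐ[P] 0 := by
      intro i
      rw [not_and_or, not_lt, not_lt, nonpos_iff_eq_zero, nonpos_iff_eq_zero] at h0
      rcases h0 with rfl | rfl
      · filter_upwards [(ha i).ae_eq_zero_of_hasSubgaussianMGF_zero] with ω hω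
        simp [hω]
      · filter_upwards [(hb i).ae_eq_zero_of_hasSubgaussianMGF_zero] with ω hω
        simp [hω]
    have hnull : P.real {ω | n * (t * √(α * β)) < |∑ i, a i ω * b i ω - n * m|} = 0 := by
      rw [measureReal_eq_zero_iff]
      have : ∀ᵐ ω ∂P, ¬ (n * (t * √(α * β)) < |∑ i, a i ω * b i ω - n * m|) := by
        filter_upwards [ae_all_iff.2 hzero] with ω hω
        have hnm : (n : ℝ) * m = 0 := by
          rcases Nat.eq_zero_or_pos n with rfl | hn
          · simp
          · rw [← hm ⟨0, hn⟩, integral_congr_ae (hzero _)]; simp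
        rw [hnm, Finset.sum_eq_zero fun i _ => hω i]
        simp only [sub_zero, abs_zero, not_lt]
        positivity
      simpa [ae_iff] using this
    rw [hnull]
    positivity

/-- A self-normalized exponential bound for the product of independent variables. -/
theorem lintegral_exp_mul_sub_sq_le_one {a b : Ω → ℝ} {α : ℝ≥0} (hma : Measurable a)
    (hmb : Measurable b) (ha : HasSubgaussianMGF a α P) (hind : IndepFun a b P) (θ : ℝ) :
    ∫⁻ ω, ENNReal.ofReal (Real.exp (θ * (a ω * b ω) - α * θ ^ 2 / 2 * b ω ^ 2)) ∂P ≤ 1 := by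
  have hmap := (indepFun_iff_map_prod_eq_prod_map_map hma.aemeasurable hmb.aemeasurable).1 hind
  have hmeas : Measurable fun q : ℝ × ℝ =>
      ENNReal.ofReal (Real.exp (θ * (q.1 * q.2) - α * θ ^ 2 / 2 * q.2 ^ 2)) := by fun_prop
  have := Measure.isProbabilityMeasure_map (μ := P) hma.aemeasurable
  have := Measure.isProbabilityMeasure_map (μ := P) hmb.aemeasurable
  have h1 := lintegral_map (μ := P) hmeas (hma.prodMk hmb)
  simp only at h1
  rw [← h1, hmap, lintegral_prod_symm' _ hmeas]
  calc _ ≤ ∫⁻ _, 1 ∂(P.map b) := by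
        refine lintegral_mono fun v => ?_
        rw [lintegral_map (by fun_prop) hma]
        -- With `b` frozen at `v`, the quadratic penalty is exactly the sub-Gaussian exponent at `θ
        -- v`.
        have e : ∀ ω, Real.exp (θ * (a ω * v) - α * θ ^ 2 / 2 * v ^ 2)
            = Real.exp (-(α * θ ^ 2 / 2 * v ^ 2)) * Real.exp (θ * v * a ω) := by
          intro ω; rw [← Real.exp_add]; congr 1; ring
        simp only [e]
        rw [← ofReal_integral_eq_lintegral_ofReal ((ha.integrable_exp_mul _).const_mul _)
          (Filter.Eventually.of_forall fun _ => by positivity), integral_const_mul,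
          ENNReal.ofReal_le_one]
        calc _ ≤ Real.exp (-(α * θ ^ 2 / 2 * v ^ 2)) * Real.exp (α * (θ * v) ^ 2 / 2) :=
              mul_le_mul_of_nonneg_left (ha.mgf_le _) (Real.exp_pos _).le
          _ = 1 := by rw [← Real.exp_add, Real.exp_eq_one_iff]; ring
    _ = 1 := by simp

/-- Markov for the product of the self-normalized exponentials, at the optimal `θ = τ / (αB)`.
Unlike in Bernstein's inequality the deviation `τ` is unrestricted, which is what the regime `log p
> n` requires. -/
theorem measure_sum_mul_gt_and_sum_sq_le {n : ℕ} {a b : Fin n → Ω → ℝ} {α : ℝ≥0}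
    (hma : ∀ i, Measurable (a i)) (hmb : ∀ i, Measurable (b i))
    (ha : ∀ i, HasSubgaussianMGF (a i) α P) (hab : ∀ i, IndepFun (a i) (b i) P)
    (hind : iIndepFun (fun i ω => (a i ω, b i ω)) P) (hα : 0 < α) {τ B : ℝ}
    (hτ : 0 ≤ τ) (hB : 0 < B) :
    P.real {ω | n * τ < ∑ i, a i ω * b i ω ∧ ∑ i, b i ω ^ 2 ≤ n * B}
      ≤ Real.exp (-(n * τ ^ 2 / (2 * (α * B)))) := by
  have hα' : (0 : ℝ) < α := by exact_mod_cast hα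
  set θ := τ / (α * B) with hθ
  have hθ0 : 0 ≤ θ := by positivity
  set f : Fin n → Ω → ENNReal := fun i ω =>
    ENNReal.ofReal (Real.exp (θ * (a i ω * b i ω) - α * θ ^ 2 / 2 * b i ω ^ 2)) with hf
  have hfm : ∀ i, Measurable (f i) := fun i => by
    have := hma i; have := hmb i; fun_prop
  have hfind : iIndepFun f P := hind.comp
    (fun _ (q : ℝ × ℝ) => ENNReal.ofReal (Real.exp (θ * (q.1 * q.2) - α * θ ^ 2 / 2 * q.2 ^ 2)))
    fun _ => by fun_prop
  have hprod : ∫⁻ ω, ∏ i, f i ω ∂P ≤ 1 := by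
    rw [lintegral_prod_eq_prod_lintegral_of_indepFun _ _ hfind hfm]
    exact Finset.prod_le_one' fun i _ =>
      lintegral_exp_mul_sub_sq_le_one (hma i) (hmb i) (ha i) (hab i) θ
  set c := n * τ ^ 2 / (2 * (α * B)) with hc
  have hsubset : {ω | n * τ < ∑ i, a i ω * b i ω ∧ ∑ i, b i ω ^ 2 ≤ n * B}
      ⊆ {ω | ENNReal.ofReal (Real.exp c) ≤ ∏ i, f i ω} := by
    rintro ω ⟨h1, h2⟩
    simp only [Set.mem_ofPred_eq, hf]
    rw [← ENNReal.ofReal_prod_of_nonneg fun _ _ => (Real.exp_pos _).le, ← Real.exp_sum]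
    refine ENNReal.ofReal_le_ofReal (Real.exp_le_exp.2 ?_)
    rw [Finset.sum_sub_distrib, ← Finset.mul_sum, ← Finset.mul_sum]
    have h3 := mul_le_mul_of_nonneg_left h1.le hθ0
    have h4 := mul_le_mul_of_nonneg_left h2 (by positivity : 0 ≤ α * θ ^ 2 / 2)
    have e : c = θ * (n * τ) - α * θ ^ 2 / 2 * (n * B) := by
      rw [hc, hθ]; field_simp; ring
    linarith
  have hmarkov := mul_meas_ge_le_lintegral (μ := P)
    (Finset.measurable_fun_prod Finset.univ fun i _ => hfm i) (ENNReal.ofReal (Real.exp c))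
  have h5 : ENNReal.ofReal (Real.exp c) *
      P {ω | n * τ < ∑ i, a i ω * b i ω ∧ ∑ i, b i ω ^ 2 ≤ n * B} ≤ 1 :=
    (mul_le_mul_right (measure_mono hsubset) _).trans (hmarkov.trans hprod)
  have h6 := ENNReal.toReal_mono ENNReal.one_ne_top h5
  rw [ENNReal.toReal_mul, ENNReal.toReal_ofReal (Real.exp_pos _).le, ENNReal.toReal_one] at h6
  rw [Real.exp_neg, ← one_div, le_div_iff₀ (Real.exp_pos _), mul_comm]
  exact h6

theorem measure_abs_sum_mul_gt_and_sum_sq_le {n : ℕ} {a b : Fin n → Ω → ℝ} {α : ℝ≥0}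
    (hma : ∀ i, Measurable (a i)) (hmb : ∀ i, Measurable (b i))
    (ha : ∀ i, HasSubgaussianMGF (a i) α P) (hab : ∀ i, IndepFun (a i) (b i) P)
    (hind : iIndepFun (fun i ω => (a i ω, b i ω)) P) (hα : 0 < α) {τ B : ℝ}
    (hτ : 0 ≤ τ) (hB : 0 < B) :
    P.real {ω | n * τ < |∑ i, a i ω * b i ω| ∧ ∑ i, b i ω ^ 2 ≤ n * B}
      ≤ 2 * Real.exp (-(n * τ ^ 2 / (2 * (α * B)))) := by
  have h1 := measure_sum_mul_gt_and_sum_sq_le hma hmb ha hab hind hα hτ hB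
  have h2 := measure_sum_mul_gt_and_sum_sq_le (a := fun i ω => -a i ω) (fun i => (hma i).neg) hmb
    (fun i => (ha i).neg) (fun i => (hab i).comp measurable_neg measurable_id)
    (hind.comp (fun _ (q : ℝ × ℝ) => (-q.1, q.2)) fun _ => by fun_prop) hα hτ hB
  have hsubset : {ω | n * τ < |∑ i, a i ω * b i ω| ∧ ∑ i, b i ω ^ 2 ≤ n * B}
      ⊆ {ω | n * τ < ∑ i, a i ω * b i ω ∧ ∑ i, b i ω ^ 2 ≤ n * B}
        ∪ {ω | n * τ < ∑ i, -a i ω * b i ω ∧ ∑ i, b i ω ^ 2 ≤ n * B} := by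
    rintro ω ⟨h3, h4⟩
    rcases lt_abs.1 h3 with h | h
    · exact Or.inl ⟨h, h4⟩
    · refine Or.inr ⟨?_, h4⟩
      simpa [Finset.sum_neg_distrib] using h
  refine (measureReal_mono hsubset).trans ((measureReal_union_le _ _).trans ?_)
  linarith

end Bernstein

/-! ### The quadratic form of the population covariance -/

section Spectral

variable {p : ℕ} {S : Matrix (Fin p) (Fin p) ℝ}

/-- The quadratic form is diagonal in an orthonormal eigenbasis; the bounds by `sigmaMin` and
`sigmaMax` follow termwise. -/
theorem inner_toEuclideanLin_eq_sum (hS : S.PosSemidef) (u : Vec p) :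
    ⟪u, S.toEuclideanLin u⟫
      = ∑ i, hS.isHermitian.eigenvalues i * ⟪hS.isHermitian.eigenvectorBasis i, u⟫ ^ 2 := by
  set b := hS.isHermitian.eigenvectorBasis
  have hb : ∀ i, S.toEuclideanLin (b i) = hS.isHermitian.eigenvalues i • b i := by
    intro i
    have := hS.isHermitian.mulVec_eigenvectorBasis i
    ext j
    simpa using congrFun this j
  rw [← b.sum_inner_mul_inner]
  refine Finset.sum_congr rfl fun i _ => ?_
  rw [← Matrix.isSymmetric_toEuclideanLin_iff.2 hS.isHermitian (b i) u, hb, real_inner_smul_left,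
    real_inner_comm]
  ring

theorem sigmaMin_mul_le (hS : S.PosSemidef) (u : Vec p) :
    sigmaMin hS * ‖u‖ ^ 2 ≤ ⟪u, S.toEuclideanLin u⟫ := by
  rw [inner_toEuclideanLin_eq_sum hS, ← hS.isHermitian.eigenvectorBasis.sum_sq_norm_inner_right u,
    Finset.mul_sum]
  refine Finset.sum_le_sum fun i _ => ?_
  rw [Real.norm_eq_abs, sq_abs]
  exact mul_le_mul_of_nonneg_right (ciInf_le (Set.finite_range _).bddBelow i) (sq_nonneg _)

theorem le_sigmaMax_mul (hS : S.PosSemidef) (u : Vec p) :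
    ⟪u, S.toEuclideanLin u⟫ ≤ sigmaMax hS * ‖u‖ ^ 2 := by
  rw [inner_toEuclideanLin_eq_sum hS, ← hS.isHermitian.eigenvectorBasis.sum_sq_norm_inner_right u,
    Finset.mul_sum]
  refine Finset.sum_le_sum fun i _ => ?_
  rw [Real.norm_eq_abs, sq_abs]
  exact mul_le_mul_of_nonneg_right (le_ciSup (Set.finite_range _).bddAbove i) (sq_nonneg _)

theorem sigmaMin_nonneg (hS : S.PosSemidef) : 0 ≤ sigmaMin hS :=
  Real.iInf_nonneg fun i => hS.eigenvalues_nonneg i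

theorem sigmaMin_le_sigmaMax (hS : S.PosSemidef) (hp : 1 ≤ p) : sigmaMin hS ≤ sigmaMax hS :=
  (ciInf_le (Set.finite_range _).bddBelow ⟨0, hp⟩).trans
    (le_ciSup (f := hS.isHermitian.eigenvalues) (Set.finite_range _).bddAbove ⟨0, hp⟩)

end Spectral

/-! ### Moments in the additive noise model -/

section Model

/-- The residual `⟨w*, z⟩ - y` of a sample. -/
theorem inner_obsZ_sub_obsY {Ω : Type*} {n p : ℕ} {x ς : Fin n → Ω → Vec p} {ξ : Fin n → Ω → ℝ}
    (wstar : Vec p) (ω : Ω) (i : Fin n) :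
    ⟪wstar, obsZ x ς ω i⟫ - obsY x ξ wstar ω i = ⟪wstar, ς i ω⟫ - ξ i ω := by
  rw [obsZ, obsY, inner_add_right, real_inner_comm]; ring

variable {Ω : Type*} [MeasurableSpace Ω] {P : Measure Ω}

theorem HasSubgaussianMGF_mono {X : Ω → ℝ} {c c' : ℝ≥0} (h : HasSubgaussianMGF X c P)
    (hc : c ≤ c') : HasSubgaussianMGF X c' P := by
  refine ⟨h.integrable_exp_mul, fun t => (h.mgf_le t).trans (Real.exp_le_exp.2 ?_)⟩
  have : (c : ℝ) ≤ c' := by exact_mod_cast hc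
  gcongr

variable {n p : ℕ} {K : ℝ≥0} {S : Matrix (Fin p) (Fin p) ℝ} {γ σ : ℝ≥0}
  {x ς : Fin n → Ω → Vec p} {ξ : Fin n → Ω → ℝ}

namespace AdditiveNoiseModel

variable (hM : AdditiveNoiseModel P K S γ σ x ς ξ)
include hM

theorem map_inner_x (hS : S.PosSemidef) (i : Fin n) (u : Vec p) :
    P.map (fun ω => ⟪u, x i ω⟫) = gaussianReal 0 (⟪u, S.toEuclideanLin u⟫).toNNReal := by
  have h1 : P.map (fun ω => ⟪u, x i ω⟫) = (P.map (x i)).map (innerSL ℝ u) :=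
    (Measure.map_map (by fun_prop) (hM.measurable_x i)).symm
  rw [h1, hM.gaussian_x, IsGaussian.map_eq_gaussianReal,
    ContinuousLinearMap.integral_comp_id_comm IsGaussian.integrable_id,
    integral_id_multivariateGaussian, map_zero]
  congr 2
  have h2 := covarianceBilin_self (μ := multivariateGaussian 0 S) IsGaussian.memLp_two_id u
  rw [covarianceBilin_multivariateGaussian hS] at h2
  have h3 : (⇑(innerSL ℝ u) : Vec p → ℝ) = fun v => ⟪u, v⟫ := by ext; simp
  rw [h3, ← h2, EuclideanSpace.inner_eq_star_dotProduct]
  simp [dotProduct_comm]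

theorem measurable_inner_x (i : Fin n) (u : Vec p) : Measurable fun ω => ⟪u, x i ω⟫ := by
  have := hM.measurable_x i; fun_prop

theorem measurable_inner_ς (i : Fin n) (u : Vec p) : Measurable fun ω => ⟪u, ς i ω⟫ := by
  have := hM.measurable_ς i; fun_prop

theorem measurable_inner_z (i : Fin n) (u : Vec p) : Measurable fun ω => ⟪u, obsZ x ς ω i⟫ := by
  have := hM.measurable_x i
  have := hM.measurable_ς i
  simp only [obsZ]
  fun_prop

theorem memLp_ς (i : Fin n) (u : Vec p) : MemLp (fun ω => ⟪u, ς i ω⟫) 2 P :=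
  (hM.subgaussian_ς i u).memLp 2

theorem hasSubgaussianMGF_inner_x (hS : S.PosSemidef) (i : Fin n) (u : Vec p) :
    HasSubgaussianMGF (fun ω => ⟪u, x i ω⟫) (⟪u, S.toEuclideanLin u⟫).toNNReal P := by
  have hlaw := hM.map_inner_x hS i u
  refine ⟨fun t => ?_, fun t => ?_⟩
  · have h1 := integrable_exp_mul_gaussianReal (μ := 0) (v := (⟪u, S.toEuclideanLin u⟫).toNNReal) t
    rw [← hlaw, integrable_map_measure (by fun_prop) (hM.measurable_inner_x i u).aemeasurable] at h1
    exact h1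
  · rw [mgf_gaussianReal hlaw]
    simp

theorem integral_inner_x (hS : S.PosSemidef) (i : Fin n) (u : Vec p) :
    ∫ ω, ⟪u, x i ω⟫ ∂P = 0 := by
  have h1 := integral_map (μ := P) (hM.measurable_inner_x i u).aemeasurable
    (f := fun r : ℝ => r) (by fun_prop)
  rw [← h1, hM.map_inner_x hS]
  exact integral_id_gaussianReal

theorem memLp_ς_apply (i : Fin n) (j : Fin p) : MemLp (fun ω => ς i ω j) 2 P := by
  simpa [PiLp.inner_apply, Pi.single_apply] using hM.memLp_ς i (EuclideanSpace.single j 1)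

theorem hasSubgaussianMGF_residual (wstar : Vec p) (i : Fin n) :
    HasSubgaussianMGF (fun ω => ⟪wstar, ς i ω⟫ - ξ i ω) (K * (γ * ‖wstar‖₊ ^ 2 + σ ^ 2)) P := by
  have h1 := (hM.subgaussian_ς i wstar).sub_of_indepFun (hM.subgaussian_ξ i)
    ((hM.indep_ς_ξ i).comp (φ := fun v => ⟪wstar, v⟫) (ψ := fun r => r)
      (by fun_prop) (by fun_prop))
  refine HasSubgaussianMGF_mono h1 (le_of_eq ?_)
  ring

theorem integral_inner_x_sq (hS : S.PosSemidef) (i : Fin n) (u : Vec p) :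
    ∫ ω, ⟪u, x i ω⟫ ^ 2 ∂P = ⟪u, S.toEuclideanLin u⟫ := by
  rw [← variance_of_integral_eq_zero (hM.measurable_inner_x i u).aemeasurable
    (hM.integral_inner_x hS i u)]
  have h1 := variance_map (μ := P) (X := fun r : ℝ => r) (by fun_prop)
    (hM.measurable_inner_x i u).aemeasurable
  rw [hM.map_inner_x hS, variance_fun_id_gaussianReal] at h1
  rw [Function.comp_def] at h1
  rw [← h1, Real.coe_toNNReal]
  exact le_trans (mul_nonneg (sigmaMin_nonneg hS) (sq_nonneg _)) (sigmaMin_mul_le hS u)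

theorem memLp_x (hS : S.PosSemidef) (i : Fin n) (u : Vec p) : MemLp (fun ω => ⟪u, x i ω⟫) 2 P :=
  (hM.hasSubgaussianMGF_inner_x hS i u).memLp 2

/-- A bound on the variance proxy of a one-dimensional marginal of the observed covariates. -/
theorem hasSubgaussianMGF_inner_z (hS : S.PosSemidef) (hK : 1 ≤ K) {V : ℝ≥0}
    (hV : sigmaMax hS + γ ≤ V) (i : Fin n) (u : Vec p) :
    HasSubgaussianMGF (fun ω => ⟪u, obsZ x ς ω i⟫) (K * V * ‖u‖₊ ^ 2) P := by
  have h1 := (hM.hasSubgaussianMGF_inner_x hS i u).add_of_indepFun (hM.subgaussian_ς i u)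
    ((hM.indep_x i).comp (φ := fun v => ⟪u, v⟫) (ψ := fun q : Vec p × ℝ => ⟪u, q.1⟫)
      (by fun_prop) (by fun_prop))
  simp only [obsZ, inner_add_right]
  refine HasSubgaussianMGF_mono h1 ?_
  rw [← NNReal.coe_le_coe]
  push_cast
  have h2 := le_sigmaMax_mul hS u
  have h3 := le_trans (mul_nonneg (sigmaMin_nonneg hS) (sq_nonneg _)) (sigmaMin_mul_le hS u)
  rw [Real.coe_toNNReal _ h3]
  have hK' : (1 : ℝ) ≤ K := by exact_mod_cast hK
  -- The Gaussian part needs no factor `K`; since `1 ≤ K`, both parts share one proxy.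
  have h4 : sigmaMax hS * ‖u‖ ^ 2 ≤ K * sigmaMax hS * ‖u‖ ^ 2 := by
    rw [mul_assoc]
    exact le_mul_of_one_le_left (h3.trans h2) hK'
  have h5 := mul_le_mul_of_nonneg_left hV K.coe_nonneg
  have h6 := mul_le_mul_of_nonneg_right h5 (sq_nonneg ‖u‖)
  linarith

variable [IsProbabilityMeasure P]

theorem integral_inner_ς (i : Fin n) (u : Vec p) : ∫ ω, ⟪u, ς i ω⟫ ∂P = 0 := by
  simp only [PiLp.inner_apply, RCLike.inner_apply, conj_trivial]
  rw [integral_finsetSum _ fun j _ =>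
    ((hM.memLp_ς_apply i j).integrable one_le_two).mul_const _]
  exact Finset.sum_eq_zero fun j _ => by rw [integral_mul_const, hM.mean_ς, zero_mul]

theorem integral_inner_ς_mul (i : Fin n) (u v : Vec p) :
    ∫ ω, ⟪u, ς i ω⟫ * ⟪v, ς i ω⟫ ∂P = γ * ⟪u, v⟫ := by
  have h1 := covariance_eq_sub (hM.memLp_ς i u) (hM.memLp_ς i v)
  rw [hM.integral_inner_ς, zero_mul, sub_zero] at h1
  have h2 : ∫ ω, ⟪u, ς i ω⟫ * ⟪v, ς i ω⟫ ∂P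
      = covariance (fun ω => ⟪u, ς i ω⟫) (fun ω => ⟪v, ς i ω⟫) P := h1.symm
  rw [h2]
  simp only [PiLp.inner_apply, RCLike.inner_apply, conj_trivial]
  rw [covariance_fun_sum_fun_sum (fun j => (hM.memLp_ς_apply i j).mul_const _)
    (fun j => (hM.memLp_ς_apply i j).mul_const _), Finset.mul_sum]
  simp only [covariance_mul_const_left, covariance_mul_const_right, hM.cov_ς, ite_mul, zero_mul,
    Finset.sum_ite_eq, Finset.mem_univ, if_true]
  exact Finset.sum_congr rfl fun j _ => by ring

theorem integral_inner_z_sq (hS : S.PosSemidef) (i : Fin n) (u : Vec p) :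
    ∫ ω, ⟪u, obsZ x ς ω i⟫ * ⟪u, obsZ x ς ω i⟫ ∂P
      = ⟪u, S.toEuclideanLin u⟫ + γ * ‖u‖ ^ 2 := by
  have e : ∀ ω, ⟪u, obsZ x ς ω i⟫ * ⟪u, obsZ x ς ω i⟫
      = (⟪u, x i ω⟫ ^ 2 + 2 * (⟪u, x i ω⟫ * ⟪u, ς i ω⟫)) + ⟪u, ς i ω⟫ * ⟪u, ς i ω⟫ := by
    intro ω; simp only [obsZ, inner_add_right]; ring
  have hx := hM.memLp_x hS i u
  have hς := hM.memLp_ς i u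
  have i1 : Integrable (fun ω => ⟪u, x i ω⟫ ^ 2) P := hx.integrable_sq
  have i2 : Integrable (fun ω => 2 * (⟪u, x i ω⟫ * ⟪u, ς i ω⟫)) P :=
    (hx.integrable_mul hς).const_mul 2
  have i3 : Integrable (fun ω => ⟪u, ς i ω⟫ * ⟪u, ς i ω⟫) P := hς.integrable_mul hς
  have hind : IndepFun (fun ω => ⟪u, x i ω⟫) (fun ω => ⟪u, ς i ω⟫) P :=
    (hM.indep_x i).comp (φ := fun v => ⟪u, v⟫) (ψ := fun q : Vec p × ℝ => ⟪u, q.1⟫)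
      (by fun_prop) (by fun_prop)
  have i12 : Integrable (fun ω => ⟪u, x i ω⟫ ^ 2 + 2 * (⟪u, x i ω⟫ * ⟪u, ς i ω⟫)) P := i1.add i2
  simp only [e]
  rw [integral_add i12 i3, integral_add i1 i2, integral_const_mul,
    hind.integral_fun_mul_eq_mul_integral hx.1 hς.1, hM.integral_inner_x hS,
    hM.integral_inner_x_sq hS, hM.integral_inner_ς_mul, real_inner_self_eq_norm_sq]
  ring

theorem integral_inner_z_mul_residual (hS : S.PosSemidef) (wstar u : Vec p) (i : Fin n) :
    ∫ ω, ⟪u, obsZ x ς ω i⟫ * (⟪wstar, ς i ω⟫ - ξ i ω) ∂P = γ * ⟪u, wstar⟫ := by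
  have e : ∀ ω, ⟪u, obsZ x ς ω i⟫ * (⟪wstar, ς i ω⟫ - ξ i ω)
      = (⟪u, x i ω⟫ * (⟪wstar, ς i ω⟫ - ξ i ω) + ⟪u, ς i ω⟫ * ⟪wstar, ς i ω⟫)
        - ⟪u, ς i ω⟫ * ξ i ω := by
    intro ω; simp only [obsZ, inner_add_right]; ring
  have hx := hM.memLp_x hS i u
  have hς := hM.memLp_ς i u
  have hw := hM.memLp_ς i wstar
  have hξ : MemLp (ξ i) 2 P := (hM.subgaussian_ξ i).memLp 2
  have hb : MemLp (fun ω => ⟪wstar, ς i ω⟫ - ξ i ω) 2 P := hw.sub hξ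
  have i1 : Integrable (fun ω => ⟪u, x i ω⟫ * (⟪wstar, ς i ω⟫ - ξ i ω)) P := hx.integrable_mul hb
  have i2 : Integrable (fun ω => ⟪u, ς i ω⟫ * ⟪wstar, ς i ω⟫) P := hς.integrable_mul hw
  have i3 : Integrable (fun ω => ⟪u, ς i ω⟫ * ξ i ω) P := hς.integrable_mul hξ
  have ind1 : IndepFun (fun ω => ⟪u, x i ω⟫) (fun ω => ⟪wstar, ς i ω⟫ - ξ i ω) P :=
    (hM.indep_x i).comp (φ := fun v => ⟪u, v⟫) (ψ := fun q : Vec p × ℝ => ⟪wstar, q.1⟫ - q.2)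
      (by fun_prop) (by fun_prop)
  have ind3 : IndepFun (fun ω => ⟪u, ς i ω⟫) (ξ i) P :=
    (hM.indep_ς_ξ i).comp (φ := fun v => ⟪u, v⟫) (ψ := fun r => r) (by fun_prop) (by fun_prop)
  have i12 : Integrable (fun ω => ⟪u, x i ω⟫ * (⟪wstar, ς i ω⟫ - ξ i ω)
      + ⟪u, ς i ω⟫ * ⟪wstar, ς i ω⟫) P := i1.add i2
  simp only [e]
  rw [integral_sub i12 i3, integral_add i1 i2,
    ind1.integral_fun_mul_eq_mul_integral hx.1 hb.1,
    ind3.integral_fun_mul_eq_mul_integral hς.1 hξ.1, hM.integral_inner_x hS,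
    hM.integral_inner_ς_mul, hM.mean_ξ]
  ring

/-- Concentration of the empirical second moments in one direction. -/
theorem measure_gram_deviation_le (hS : S.PosSemidef) (hK : 1 ≤ K) {V : ℝ≥0}
    (hV : sigmaMax hS + γ ≤ V) (u : Vec p) {t : ℝ} (ht : 0 ≤ t) (ht' : t ≤ 64) :
    P.real {ω | n * (t * (K * V * ‖u‖ ^ 2))
        < |∑ i, ⟪u, obsZ x ς ω i⟫ ^ 2 - n * (⟪u, S.toEuclideanLin u⟫ + γ * ‖u‖ ^ 2)|}
      ≤ 2 * Real.exp (-(n * t ^ 2 / 1024)) := by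
  have h := measure_abs_sum_mul_sub_gt_le (P := P) (fun i => hM.measurable_inner_z i u)
    (fun i => hM.measurable_inner_z i u) (fun i => hM.hasSubgaussianMGF_inner_z hS hK hV i u)
    (fun i => hM.hasSubgaussianMGF_inner_z hS hK hV i u)
    (hM.indep_samples.comp
      (fun _ (q : Vec p × Vec p × ℝ) => ⟪u, q.1 + q.2.1⟫ * ⟪u, q.1 + q.2.1⟫)
      fun _ => by fun_prop)
    (fun i => hM.integral_inner_z_sq hS i u) ht ht'
  rw [Real.sqrt_mul_self (NNReal.coe_nonneg _)] at h
  simp only [← sq] at h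
  push_cast at h
  exact h

/-- Concentration of the empirical correlation of the covariates with the residuals. -/
theorem measure_correlation_deviation_le (hS : S.PosSemidef) (hK : 1 ≤ K) {V : ℝ≥0}
    (hV : sigmaMax hS + γ ≤ V) (wstar u : Vec p) {t : ℝ} (ht : 0 ≤ t) (ht' : t ≤ 64) :
    P.real {ω | n * (t * √(K * V * ‖u‖ ^ 2 * (K * (γ * ‖wstar‖ ^ 2 + σ ^ 2))))
        < |∑ i, ⟪u, obsZ x ς ω i⟫ * (⟪wstar, ς i ω⟫ - ξ i ω) - n * (γ * ⟪u, wstar⟫)|}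
      ≤ 2 * Real.exp (-(n * t ^ 2 / 1024)) := by
  have h := measure_abs_sum_mul_sub_gt_le (P := P) (fun i => hM.measurable_inner_z i u)
    (fun i => (hM.measurable_inner_ς i wstar).sub (hM.measurable_ξ i))
    (fun i => hM.hasSubgaussianMGF_inner_z hS hK hV i u)
    (fun i => hM.hasSubgaussianMGF_residual wstar i)
    (hM.indep_samples.comp
      (fun _ (q : Vec p × Vec p × ℝ) => ⟪u, q.1 + q.2.1⟫ * (⟪wstar, q.2.1⟫ - q.2.2))
      fun _ => by fun_prop)
    (fun i => hM.integral_inner_z_mul_residual hS wstar u i) ht ht'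
  push_cast at h
  exact h

theorem measure_sum_sq_ξ_gt_le :
    P.real {ω | n * (32 * (K * σ ^ 2)) < |∑ i, ξ i ω ^ 2 - n * (σ : ℝ) ^ 2|}
      ≤ 2 * Real.exp (-n) := by
  have h := measure_abs_sum_mul_sub_gt_le (P := P) (m := (σ : ℝ) ^ 2) hM.measurable_ξ
    hM.measurable_ξ hM.subgaussian_ξ hM.subgaussian_ξ
    (hM.indep_samples.comp (fun _ (q : Vec p × Vec p × ℝ) => q.2.2 * q.2.2) fun _ => by fun_prop)
    (fun i => by
      rw [← hM.var_ξ i, variance_of_integral_eq_zero (hM.measurable_ξ i).aemeasurable (hM.mean_ξ i)]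
      simp only [sq])
    (t := 32) (by norm_num) (by norm_num)
  rw [Real.sqrt_mul_self (NNReal.coe_nonneg _)] at h
  simp only [← sq] at h
  push_cast at h
  have e : -((n : ℝ) * 32 ^ 2 / 1024) = -n := by ring
  rwa [e] at h

/-- For `wstar = 0` the residual is `-ξ`, independent of the observed covariates, so the
self-normalized bound applies. -/
theorem measure_correlation_ξ_gt_le (hS : S.PosSemidef) (hK : 1 ≤ K) {V : ℝ≥0}
    (hV : sigmaMax hS + γ ≤ V) (hV0 : 0 < V) {u : Vec p} (hu : u ≠ 0) {τ B : ℝ} (hτ : 0 ≤ τ)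
    (hB : 0 < B) :
    P.real {ω | n * τ < |∑ i, ⟪u, obsZ x ς ω i⟫ * ξ i ω| ∧ ∑ i, ξ i ω ^ 2 ≤ n * B}
      ≤ 2 * Real.exp (-(n * τ ^ 2 / (2 * (K * V * ‖u‖ ^ 2 * B)))) := by
  have hu' : 0 < ‖u‖₊ := by rwa [pos_iff_ne_zero, nnnorm_ne_zero_iff]
  have hK0 : 0 < K := lt_of_lt_of_le one_pos hK
  have hind : ∀ i, IndepFun (fun ω => ⟪u, obsZ x ς ω i⟫) (ξ i) P := by
    intro i
    -- The model makes `x` independent of `(ς, ξ)` and `ς` of `ξ`; the joint law is therefore a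
    -- triple product, which is regrouped by associativity.
    have h1 : IndepFun (fun ω => (x i ω, ς i ω)) (ξ i) P := by
      rw [indepFun_iff_map_prod_eq_prod_map_map
        ((hM.measurable_x i).prodMk (hM.measurable_ς i)).aemeasurable (hM.measurable_ξ i).aemeasurable]
      have h2 := (indepFun_iff_map_prod_eq_prod_map_map (hM.measurable_x i).aemeasurable
        ((hM.measurable_ς i).prodMk (hM.measurable_ξ i)).aemeasurable).1 (hM.indep_x i)
      have h3 := (indepFun_iff_map_prod_eq_prod_map_map (hM.measurable_ς i).aemeasurable
        (hM.measurable_ξ i).aemeasurable).1 (hM.indep_ς_ξ i)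
      have h4 := (indepFun_iff_map_prod_eq_prod_map_map (hM.measurable_x i).aemeasurable
        (hM.measurable_ς i).aemeasurable).1
        ((hM.indep_x i).comp (φ := fun v => v) (ψ := fun q : Vec p × ℝ => q.1)
          measurable_id measurable_fst)
      have m1 := Measure.isProbabilityMeasure_map (μ := P) (hM.measurable_x i).aemeasurable
      have m2 := Measure.isProbabilityMeasure_map (μ := P) (hM.measurable_ς i).aemeasurable
      have m3 := Measure.isProbabilityMeasure_map (μ := P) (hM.measurable_ξ i).aemeasurable
      have h4' : P.map (fun ω => (x i ω, ς i ω)) = (P.map (x i)).prod (P.map (ς i)) := h4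
      rw [h4', ← (measurePreserving_prodAssoc (P.map (x i)) (P.map (ς i)) (P.map (ξ i))).symm.map_eq,
        ← h3, ← h2, Measure.map_map (MeasurableEquiv.measurable _)
          ((hM.measurable_x i).prodMk ((hM.measurable_ς i).prodMk (hM.measurable_ξ i)))]
      rfl
    exact h1.comp (φ := fun q : Vec p × Vec p => ⟪u, q.1 + q.2⟫) (ψ := fun r => r)
      (by fun_prop) measurable_id
  have h := measure_abs_sum_mul_gt_and_sum_sq_le (P := P) (fun i => hM.measurable_inner_z i u)
    hM.measurable_ξ (fun i => hM.hasSubgaussianMGF_inner_z hS hK hV i u) hind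
    (hM.indep_samples.comp (fun _ (q : Vec p × Vec p × ℝ) => (⟪u, q.1 + q.2.1⟫, q.2.2))
      fun _ => by fun_prop)
    (by positivity) hτ hB
  push_cast at h
  exact h

end AdditiveNoiseModel

end Model

/-! ### From words in the signed basis vectors to all vectors -/

/-- Maurey's empirical method: nonnegativity of a quadratic form at all sums of `k` vectors of a
finite family transfers to the convex hull of the family, up to a diagonal term. -/
theorem nonneg_of_forall_words_nonneg {ι V : Type*} [Fintype ι] [AddCommGroup V] [Module ℝ V]
    (B : V →ₗ[ℝ] V →ₗ[ℝ] ℝ) (hB : ∀ u v, B u v = B v u) (e : ι → V) {c : ι → ℝ}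
    (hc : ∀ i, 0 ≤ c i) (hsum : ∑ i, c i = 1) {v : V} (hv : ∑ i, c i • e i = v) :
    ∀ (k : ℕ) (u : V), (∀ w : Fin k → ι, 0 ≤ B (u + ∑ l, e (w l)) (u + ∑ l, e (w l))) →
      0 ≤ B u u + 2 * k * B u v + k * (k - 1) * B v v + k * ∑ i, c i * B (e i) (e i) := by
  intro k
  induction k with
  | zero =>
    intro u h
    simpa using h finZeroElim
  | succ k ih =>
    intro u h
    set T := ∑ i, c i * B (e i) (e i) with hT
    -- Put the first letter into the free starting vector `u`, then average over it with weights
    -- `c`: this is the expectation over random words with i.i.d. letters.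
    have h1 : ∀ i, 0 ≤ c i * (B (u + e i) (u + e i) + 2 * k * B (u + e i) v
        + k * (k - 1) * B v v + k * T) := by
      intro i
      refine mul_nonneg (hc i) (ih (u + e i) fun w => ?_)
      have := h (Fin.cons i w)
      simpa [Fin.sum_univ_succ, add_assoc] using this
    have h2 := Finset.sum_nonneg fun i (_ : i ∈ Finset.univ) => h1 i
    have hlin : ∀ w, ∑ i, c i * B (e i) w = B v w := by
      intro w
      simp [← hv, map_sum, LinearMap.sum_apply]
    have h3 : ∑ i, c i * (B (u + e i) (u + e i) + 2 * k * B (u + e i) v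
        + k * (k - 1) * B v v + k * T)
        = (∑ i, c i) * (B u u + 2 * k * B u v + k * (k - 1) * B v v + k * T)
          + 2 * ∑ i, c i * B (e i) u + T + 2 * k * ∑ i, c i * B (e i) v := by
      have h4 : ∀ i, c i * (B (u + e i) (u + e i) + 2 * k * B (u + e i) v
          + k * (k - 1) * B v v + k * T)
          = c i * (B u u + 2 * k * B u v + k * (k - 1) * B v v + k * T)
            + 2 * (c i * B (e i) u) + c i * B (e i) (e i) + 2 * k * (c i * B (e i) v) := by
        intro i
        simp only [map_add, LinearMap.add_apply, hB u (e i)]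
        ring
      rw [Finset.sum_congr rfl fun i _ => h4 i, Finset.sum_add_distrib, Finset.sum_add_distrib,
        Finset.sum_add_distrib, ← Finset.sum_mul, ← Finset.mul_sum, ← Finset.mul_sum, ← hT]
    rw [h3, hsum, hlin, hlin, hB v u] at h2
    push_cast
    linarith

section Words

variable {p : ℕ}

/-- The vectors `± e_j`. -/
noncomputable def signedBasis (i : Fin p × Bool) : Vec p :=
  (if i.2 then (1 : ℝ) else -1) • EuclideanSpace.single i.1 (1 : ℝ)

/-- The sum of a word in the vectors `± e_j`. -/
noncomputable def wordSum {k : ℕ} (w : Fin k → Fin p × Bool) : Vec p := ∑ l, signedBasis (w l)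

theorem norm_signedBasis (i : Fin p × Bool) : ‖signedBasis i‖ = 1 := by
  rw [signedBasis, norm_smul]
  split_ifs <;> simp

/-- `v / ‖v‖₁` is a convex combination of signed basis vectors. In Maurey's average the form at this
vector has weight `k(k - 1)` against `k` for the diagonal, hence the loss `c / (k - 1)`. -/
theorem le_add_l1Norm_sq_of_words (B : Vec p →ₗ[ℝ] Vec p →ₗ[ℝ] ℝ) (hB : ∀ u v, B u v = B v u)
    {c : ℝ} {k : ℕ} (hk : 2 ≤ k)
    (hw : ∀ w : Fin k → Fin p × Bool, 0 ≤ B (wordSum w) (wordSum w))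
    (hd : ∀ i, B (signedBasis i) (signedBasis i) ≤ c) (v : Vec p) :
    0 ≤ B v v + c / (k - 1) * l1Norm v ^ 2 := by
  by_cases hv : v = 0
  · subst hv; simp [l1Norm]
  have hR : 0 < l1Norm v := lt_of_lt_of_le (norm_pos_iff.2 hv) (norm_le_l1Norm v)
  set R := l1Norm v with hRdef
  have hk' : (2 : ℝ) ≤ k := by exact_mod_cast hk
  set a : Fin p × Bool → ℝ := fun i => (if i.2 then max (v i.1) 0 else max (-v i.1) 0) / R with ha
  have ha0 : ∀ i, 0 ≤ a i := fun i => by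
    simp only [ha]; split_ifs <;> positivity
  have ha1 : ∑ i, a i = 1 := by
    simp only [ha, ← Finset.sum_div, Fintype.sum_prod_type, Fintype.sum_bool]
    rw [div_eq_one_iff_eq hR.ne', hRdef, l1Norm]
    refine Finset.sum_congr rfl fun j _ => ?_
    rcases le_total 0 (v j) with h | h
    · simp [h, abs_of_nonneg h]
    · simp [h, abs_of_nonpos h]
  have hav : ∑ i, a i • signedBasis i = R⁻¹ • v := by
    ext j
    simp only [ha, signedBasis, Fintype.sum_prod_type, Fintype.sum_bool]
    simp only [if_true, Bool.false_eq_true, if_false, smul_smul, ← add_smul, mul_one, mul_neg]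
    have : ∀ i, max (v i) 0 / R + -(max (-v i) 0 / R) = R⁻¹ * v i := by
      intro i
      rcases le_total 0 (v i) with h | h
      · simp [h]; ring
      · simp [h]; ring
    simp only [this]
    simp [Pi.single_apply]
  have key := nonneg_of_forall_words_nonneg B hB signedBasis ha0 ha1 hav k 0
    (fun w => by simpa [wordSum] using hw w)
  have hT : ∑ i, a i * B (signedBasis i) (signedBasis i) ≤ c := by
    calc _ ≤ ∑ i, a i * c := Finset.sum_le_sum fun i _ => mul_le_mul_of_nonneg_left (hd i) (ha0 i)
      _ = c := by rw [← Finset.sum_mul, ha1, one_mul]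
  simp only [map_zero, LinearMap.zero_apply, map_smul, LinearMap.smul_apply, smul_eq_mul, zero_add,
    mul_zero] at key
  have h1 : 0 ≤ (k : ℝ) * ((k - 1) * (R⁻¹ * (R⁻¹ * B v v)) + c) := by
    have := mul_le_mul_of_nonneg_left hT (by linarith : (0 : ℝ) ≤ k)
    linarith
  have h2 : 0 ≤ (k - 1) * (R⁻¹ * (R⁻¹ * B v v)) + c :=
    nonneg_of_mul_nonneg_right h1 (by linarith)
  have hk1 : (0 : ℝ) < k - 1 := by linarith
  have h3 : B v v + c / (k - 1) * R ^ 2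
      = R ^ 2 / (k - 1) * ((k - 1) * (R⁻¹ * (R⁻¹ * B v v)) + c) := by
    field_simp
  rw [h3]
  positivity

end Words

/-! ### Restricted eigenvalues -/

section RestrictedEigenvalue

variable {n p : ℕ} {S : Matrix (Fin p) (Fin p) ℝ} {γ : ℝ} {z : Fin n → Vec p}

/-- The empirical second moment in direction `u` is within `ε ‖u‖²` of `uᵀ S u + γ ‖u‖²`. -/
def QuadClose (S : Matrix (Fin p) (Fin p) ℝ) (γ ε : ℝ) (z : Fin n → Vec p) (u : Vec p) : Prop :=
  |∑ i, ⟪u, z i⟫ ^ 2 - n * (⟪u, S.toEuclideanLin u⟫ + γ * ‖u‖ ^ 2)| ≤ n * (ε * ‖u‖ ^ 2)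

theorem QuadClose.abs_gram_sub_le {ε : ℝ} {u : Vec p} (hn : 1 ≤ n) (h : QuadClose S γ ε z u) :
    |gram z u - (⟪u, S.toEuclideanLin u⟫ + γ * ‖u‖ ^ 2)| ≤ ε * ‖u‖ ^ 2 := by
  have hn' : (0 : ℝ) < n := by exact_mod_cast hn
  have e : ∑ i, ⟪u, z i⟫ ^ 2 = n * gram z u := by rw [gram]; field_simp
  rw [QuadClose, e, ← mul_sub, abs_mul, abs_of_pos hn'] at h
  exact le_of_mul_le_mul_left h hn'

/-- The bilinear form of the centred empirical second moments, shifted by `ε`. -/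
noncomputable def centredForm (S : Matrix (Fin p) (Fin p) ℝ) (γ ε : ℝ) (z : Fin n → Vec p) :
    Vec p →ₗ[ℝ] Vec p →ₗ[ℝ] ℝ :=
  LinearMap.mk₂ ℝ
    (fun u v => (1 / n) * ∑ i, ⟪u, z i⟫ * ⟪v, z i⟫ - ⟪u, S.toEuclideanLin v⟫ - (γ - ε) * ⟪u, v⟫)
    (fun u u' v => by simp only [inner_add_left, add_mul, Finset.sum_add_distrib]; ring)
    (fun c u v => by
      simp only [real_inner_smul_left, mul_assoc, ← Finset.mul_sum, smul_eq_mul]; ring)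
    (fun u v v' => by
      simp only [inner_add_left, inner_add_right, map_add, mul_add, Finset.sum_add_distrib]; ring)
    (fun c u v => by
      simp only [real_inner_smul_left, real_inner_smul_right, map_smul, mul_left_comm _ c,
        ← Finset.mul_sum, smul_eq_mul]
      ring)

theorem centredForm_comm (hS : S.PosSemidef) (γ ε : ℝ) (z : Fin n → Vec p) (u v : Vec p) :
    centredForm S γ ε z u v = centredForm S γ ε z v u := by
  simp only [centredForm, LinearMap.mk₂_apply]
  rw [← Matrix.isSymmetric_toEuclideanLin_iff.2 hS.isHermitian u v,
    real_inner_comm v (S.toEuclideanLin u), real_inner_comm v u]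
  simp only [mul_comm ⟪u, z _⟫]

theorem centredForm_self (γ ε : ℝ) (z : Fin n → Vec p) (u : Vec p) :
    centredForm S γ ε z u u
      = gram z u - (⟪u, S.toEuclideanLin u⟫ + γ * ‖u‖ ^ 2) + ε * ‖u‖ ^ 2 := by
  simp only [centredForm, LinearMap.mk₂_apply, gram, sq, real_inner_self_eq_norm_mul_norm]
  ring

theorem restricted_eigenvalue_of_words (hS : S.PosSemidef) (hn : 1 ≤ n) {k : ℕ} (hk : 2 ≤ k)
    (h : ∀ w : Fin k → Fin p × Bool, QuadClose S γ (sigmaMin hS / 2) z (wordSum w)) (v : Vec p) :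
    sigmaMin hS / 2 * ‖v‖ ^ 2 - sigmaMin hS / (k - 1) * l1Norm v ^ 2
      ≤ gram z v - γ * ‖v‖ ^ 2 := by
  have hk0 : (0 : ℝ) < k := by positivity
  have h1 := le_add_l1Norm_sq_of_words (centredForm S γ (sigmaMin hS / 2) z)
    (centredForm_comm hS _ _ z) (c := sigmaMin hS) hk
    (fun w => by
      rw [centredForm_self]
      linarith [(abs_le.1 ((h w).abs_gram_sub_le hn)).1])
    -- A word repeating one letter sums to `k` times that basis vector, so by homogeneity the
    -- closeness assumption also bounds the diagonal.
    (fun i => by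
      have h2 := (abs_le.1 ((h fun _ => i).abs_gram_sub_le hn)).2
      have h3 : centredForm S γ (sigmaMin hS / 2) z (wordSum fun _ : Fin k => i)
          (wordSum fun _ : Fin k => i) ≤ sigmaMin hS * ‖wordSum fun _ : Fin k => i‖ ^ 2 := by
        rw [centredForm_self]; linarith
      have h4 : wordSum (fun _ : Fin k => i) = (k : ℝ) • signedBasis i := by
        simp [wordSum, Nat.cast_smul_eq_nsmul]
      rw [h4, norm_smul, norm_signedBasis] at h3
      simp only [map_smul, LinearMap.smul_apply, smul_eq_mul, mul_one, Real.norm_natCast] at h3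
      have h5 : (k : ℝ) ^ 2 * centredForm S γ (sigmaMin hS / 2) z (signedBasis i) (signedBasis i)
          ≤ (k : ℝ) ^ 2 * sigmaMin hS := by linarith
      exact le_of_mul_le_mul_left h5 (by positivity)) v
  rw [centredForm_self] at h1
  have h2 := sigmaMin_mul_le hS v
  linarith

/-- The average smoothness dominates the empirical second moment in direction `u`, which is at least
`σ_min / 2 + γ ≥ 3γ`. -/
theorem three_mul_le_average (hS : S.PosSemidef) (hn : 1 ≤ n) {L : Fin n → ℝ}
    (hL : ∀ i, ‖z i‖ ^ 2 ≤ L i) {u : Vec p} (hu : ‖u‖ = 1) (hγ : 4 * γ ≤ sigmaMin hS)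
    (h : QuadClose S γ (sigmaMin hS / 2) z u) : 3 * γ ≤ (∑ i, L i) / n := by
  have h1 := (abs_le.1 (h.abs_gram_sub_le hn)).1
  have h2 := sigmaMin_mul_le hS u
  have h3 : gram z u ≤ (∑ i, L i) / n := by
    rw [gram, one_div, inv_mul_eq_div]
    gcongr with i
    refine le_trans ?_ (hL i)
    rw [← sq_abs]
    have := abs_real_inner_le_norm u (z i)
    rw [hu, one_mul] at this
    gcongr
  rw [hu] at h1 h2
  linarith

end RestrictedEigenvalue

/-! ### Probability of a good sample -/

/-- Converts the geometric mean of the variance proxies of covariate and residual, the scale in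
Bernstein's inequality, into `φ`. -/
theorem sqrt_mul_le_noiseLevel {K σmax γ σ m : ℝ} (hK : 0 ≤ K) (hσmax : 0 ≤ σmax) (hγ : 0 ≤ γ)
    (hσ : 0 ≤ σ) (hm : 0 ≤ m) :
    √(K * (σmax + γ) * (K * (γ * m ^ 2 + σ ^ 2))) ≤ K * noiseLevel σmax γ σ m := by
  rw [noiseLevel, Real.sqrt_le_left (by positivity), mul_pow, mul_pow]
  have h1 : σmax + γ ≤ (√σmax + √γ) ^ 2 := by
    have h3 := Real.sq_sqrt hσmax
    have h4 := Real.sq_sqrt hγ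
    nlinarith [mul_nonneg (Real.sqrt_nonneg σmax) (Real.sqrt_nonneg γ)]
  have h2 : γ * m ^ 2 + σ ^ 2 ≤ (σ + √γ * m) ^ 2 := by
    have h4 := Real.sq_sqrt hγ
    have h5 : (√γ * m) ^ 2 = γ * m ^ 2 := by rw [mul_pow, h4]
    nlinarith [mul_nonneg hσ (mul_nonneg (Real.sqrt_nonneg γ) hm)]
  calc _ = K ^ 2 * ((σmax + γ) * (γ * m ^ 2 + σ ^ 2)) := by ring
    _ ≤ _ := by gcongr

theorem mul_exp_neg_log_le {p : ℕ} (hp : 1 ≤ p) {a : ℝ} (ha : 2 ≤ a) :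
    p * Real.exp (-(a * Real.log p)) ≤ Real.exp (-Real.log p) := by
  have hp' : (0 : ℝ) < p := by exact_mod_cast hp
  have hlog : 0 ≤ Real.log p := Real.log_nonneg (by exact_mod_cast hp)
  calc p * Real.exp (-(a * Real.log p)) = Real.exp (Real.log p + -(a * Real.log p)) := by
        rw [Real.exp_add, Real.exp_log hp']
    _ ≤ _ := Real.exp_le_exp.2 (by nlinarith)

section Probability

/-- The coordinates of the gradient at `wstar` in terms of the residuals. -/
theorem smoothGrad_obs {Ω : Type*} {n p : ℕ} {γ : ℝ} {x ς : Fin n → Ω → Vec p}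
    {ξ : Fin n → Ω → ℝ} (wstar : Vec p) (ω : Ω) (j : Fin p) :
    smoothGrad (obsZ x ς ω) (obsY x ξ wstar ω) γ wstar j
      = (1 / n) * ∑ i, ⟪EuclideanSpace.single j (1 : ℝ), obsZ x ς ω i⟫ * (⟪wstar, ς i ω⟫ - ξ i ω)
        - γ * ⟪EuclideanSpace.single j (1 : ℝ), wstar⟫ := by
  simp only [smoothGrad, inner_obsZ_sub_obsY]
  simp [PiLp.inner_apply, mul_comm]

variable {Ω : Type*} [MeasurableSpace Ω] {P : Measure Ω} [IsProbabilityMeasure P]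
variable {n p : ℕ} {K : ℝ≥0} {S : Matrix (Fin p) (Fin p) ℝ} {γ σ : ℝ≥0}
  {x ς : Fin n → Ω → Vec p} {ξ : Fin n → Ω → ℝ}

namespace AdditiveNoiseModel

variable (hM : AdditiveNoiseModel P K S γ σ x ς ξ)
include hM

omit [IsProbabilityMeasure P] in
theorem measurableSet_quadClose (ε : ℝ) (u : Vec p) :
    MeasurableSet {ω | QuadClose S γ ε (obsZ x ς ω) u} := by
  have := fun i => hM.measurable_inner_z i u
  unfold QuadClose
  exact measurableSet_le (by fun_prop) measurable_const

theorem measure_not_quadClose_le (hS : S.PosSemidef) (hK : 1 ≤ K) (hp : 1 ≤ p)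
    (hmin : 0 < sigmaMin hS) (u : Vec p) :
    P.real {ω | ¬ QuadClose S γ (sigmaMin hS / 2) (obsZ x ς ω) u}
      ≤ 2 * Real.exp (-(n * (sigmaMin hS / (sigmaMax hS + γ)) ^ 2 / (4096 * K ^ 2))) := by
  have hmm := sigmaMin_le_sigmaMax hS hp
  have hV0 : 0 < sigmaMax hS + γ := by linarith [γ.coe_nonneg]
  have hK' : (1 : ℝ) ≤ K := by exact_mod_cast hK
  obtain ⟨V, hV⟩ : ∃ V : ℝ≥0, (V : ℝ) = sigmaMax hS + γ := ⟨⟨_, hV0.le⟩, rfl⟩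
  set r := sigmaMin hS / (sigmaMax hS + γ) with hr
  have hr0 : 0 < r := by positivity
  have hr1 : r ≤ 1 := by
    rw [hr, div_le_one hV0]; linarith [γ.coe_nonneg]
  -- This `t` makes the deviation equal to `σ_min ‖u‖² / 2`.
  have h := hM.measure_gram_deviation_le hS hK hV.ge u
    (t := r / (2 * K)) (by positivity) (by rw [div_le_iff₀ (by positivity)]; linarith)
  have e1 : r / (2 * K) * (K * (sigmaMax hS + γ) * ‖u‖ ^ 2) = sigmaMin hS / 2 * ‖u‖ ^ 2 := by
    rw [hr]; field_simp
  have e2 : (n : ℝ) * (r / (2 * K)) ^ 2 / 1024 = n * r ^ 2 / (4096 * K ^ 2) := by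
    field_simp; ring
  simp only [hV, e1, e2] at h
  simpa only [QuadClose, not_le] using h

/-- There are `(2p)^k` words; the assumption on `k` lets their number consume only half of the
exponent for a single direction. -/
theorem measure_exists_word_not_quadClose_le (hS : S.PosSemidef) (hK : 1 ≤ K) (hp : 1 ≤ p)
    (hmin : 0 < sigmaMin hS) {k : ℕ}
    (hk : k * Real.log (2 * p)
      ≤ n * (sigmaMin hS / (sigmaMax hS + γ)) ^ 2 / (8192 * K ^ 2)) :
    P.real {ω | ∃ w : Fin k → Fin p × Bool,
        ¬ QuadClose S γ (sigmaMin hS / 2) (obsZ x ς ω) (wordSum w)}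
      ≤ 2 * Real.exp (-(n * (sigmaMin hS / (sigmaMax hS + γ)) ^ 2 / (8192 * K ^ 2))) := by
  set r := sigmaMin hS / (sigmaMax hS + γ) with hr
  have hp' : (0 : ℝ) < p := by exact_mod_cast hp
  have hset : {ω | ∃ w : Fin k → Fin p × Bool,
      ¬ QuadClose S γ (sigmaMin hS / 2) (obsZ x ς ω) (wordSum w)}
      = ⋃ w : Fin k → Fin p × Bool,
        {ω | ¬ QuadClose S γ (sigmaMin hS / 2) (obsZ x ς ω) (wordSum w)} := by
    ext; simp
  rw [hset]
  refine (measureReal_iUnion_fintype_le _).trans ((Finset.sum_le_sum fun w _ =>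
    hM.measure_not_quadClose_le hS hK hp hmin (wordSum w)).trans ?_)
  rw [Finset.sum_const, Finset.card_univ, nsmul_eq_mul]
  have hcard : (Fintype.card (Fin k → Fin p × Bool) : ℝ) = Real.exp (k * Real.log (2 * p)) := by
    rw [Real.exp_nat_mul, Real.exp_log (by positivity)]
    simp [mul_comm]
  rw [hcard, mul_left_comm, ← Real.exp_add, ← hr]
  gcongr
  have e : (n : ℝ) * r ^ 2 / (4096 * K ^ 2) = 2 * (n * r ^ 2 / (8192 * K ^ 2)) := by
    ring
  rw [e]
  linarith

/-- Both cases use the deviation `64 √(log p / n)` in units of `R`. If `log p ≤ n` it lies in the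
Bernstein range; if `wstar = 0` the self-normalized bound works on the event that `∑ ξ²` is of order
`n K σ²`, which costs the extra `exp (-n)`. -/
theorem measure_exists_deviation_gt_le (hS : S.PosSemidef) (hK : 1 ≤ K) (hn : 1 ≤ n) (hp : 1 ≤ p)
    (hmin : 0 < sigmaMin hS) {wstar : Vec p} {lam : ℝ}
    (hlam : 256 * K * noiseLevel (sigmaMax hS) γ σ ‖wstar‖ * √(Real.log p / n) ≤ lam)
    (hcase : Real.log p ≤ n ∨ wstar = 0) :
    P.real {ω | ∃ j, ¬ |smoothGrad (obsZ x ς ω) (obsY x ξ wstar ω) γ wstar j| ≤ lam / 4}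
      ≤ 2 * Real.exp (-Real.log p) + 2 * Real.exp (-n) := by
  have hmm := sigmaMin_le_sigmaMax hS hp
  have hσmax : 0 < sigmaMax hS := by linarith
  have hV0 : 0 < sigmaMax hS + γ := by positivity
  have hK' : (1 : ℝ) ≤ K := by exact_mod_cast hK
  have hn' : (0 : ℝ) < n := by exact_mod_cast hn
  have hlog : 0 ≤ Real.log p := Real.log_nonneg (by exact_mod_cast hp)
  set V : ℝ≥0 := ⟨sigmaMax hS + γ, hV0.le⟩ with hV
  have hVc : (V : ℝ) = sigmaMax hS + γ := rfl
  set q := √(Real.log p / n) with hq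
  have hq2 : q ^ 2 = Real.log p / n := Real.sq_sqrt (by positivity)
  have hq0 : 0 ≤ q := Real.sqrt_nonneg _
  set R := √(K * V * (K * (γ * ‖wstar‖ ^ 2 + σ ^ 2))) with hR
  have hRle : 64 * q * R ≤ lam / 4 := by
    have h1 := sqrt_mul_le_noiseLevel (K := K) (σmax := sigmaMax hS) (γ := γ) (σ := σ)
      (m := ‖wstar‖) (by positivity) hσmax.le γ.coe_nonneg σ.coe_nonneg (norm_nonneg _)
    rw [← hVc, ← hR] at h1
    have h2 := mul_le_mul_of_nonneg_left h1 (by positivity : 0 ≤ 64 * q)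
    linarith
  have hdev : ∀ j ω, ¬ |smoothGrad (obsZ x ς ω) (obsY x ξ wstar ω) γ wstar j| ≤ lam / 4 →
      n * (64 * q * R) < |∑ i, ⟪EuclideanSpace.single j (1 : ℝ), obsZ x ς ω i⟫
        * (⟪wstar, ς i ω⟫ - ξ i ω) - n * (γ * ⟪EuclideanSpace.single j (1 : ℝ), wstar⟫)| := by
    intro j ω h
    rw [not_le, smoothGrad_obs] at h
    set s := ∑ i, ⟪EuclideanSpace.single j (1 : ℝ), obsZ x ς ω i⟫ * (⟪wstar, ς i ω⟫ - ξ i ω)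
    have e : s - n * (γ * ⟪EuclideanSpace.single j (1 : ℝ), wstar⟫)
        = n * ((1 / n) * s - γ * ⟪EuclideanSpace.single j (1 : ℝ), wstar⟫) := by
      field_simp
    rw [e, abs_mul, abs_of_pos hn']
    exact mul_lt_mul_of_pos_left (hRle.trans_lt h) hn'
  rcases hcase with hcase | rfl
  · have hq1 : q ≤ 1 := by
      exact Real.sqrt_le_one.2 ((div_le_one hn').2 hcase)
    have hsub : {ω | ∃ j, ¬ |smoothGrad (obsZ x ς ω) (obsY x ξ wstar ω) γ wstar j| ≤ lam / 4}
        ⊆ ⋃ j : Fin p, {ω | n * (64 * q * R) < |∑ i, ⟪EuclideanSpace.single j (1 : ℝ),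
          obsZ x ς ω i⟫ * (⟪wstar, ς i ω⟫ - ξ i ω)
            - n * (γ * ⟪EuclideanSpace.single j (1 : ℝ), wstar⟫)|} := by
      rintro ω ⟨j, hj⟩
      exact Set.mem_iUnion.2 ⟨j, hdev j ω hj⟩
    refine (measureReal_mono hsub).trans ((measureReal_iUnion_fintype_le _).trans ?_)
    have hj : ∀ j : Fin p, P.real {ω | n * (64 * q * R) < |∑ i, ⟪EuclideanSpace.single j (1 : ℝ),
          obsZ x ς ω i⟫ * (⟪wstar, ς i ω⟫ - ξ i ω)
            - n * (γ * ⟪EuclideanSpace.single j (1 : ℝ), wstar⟫)|}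
        ≤ 2 * Real.exp (-(4 * Real.log p)) := by
      intro j
      have h := hM.measure_correlation_deviation_le hS hK (V := V) le_rfl wstar
        (EuclideanSpace.single j (1 : ℝ)) (t := 64 * q) (by positivity) (by linarith)
      have e1 : ‖(EuclideanSpace.single j (1 : ℝ) : Vec p)‖ = 1 := by simp
      have e2 : (n : ℝ) * (64 * q) ^ 2 / 1024 = 4 * Real.log p := by
        rw [mul_pow, hq2]; field_simp; ring
      rw [e1, one_pow, mul_one, ← hR, e2] at h
      exact h
    refine (Finset.sum_le_sum fun j _ => hj j).trans ?_
    rw [Finset.sum_const, Finset.card_univ, Fintype.card_fin, nsmul_eq_mul]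
    have := mul_exp_neg_log_le hp (by norm_num : (2 : ℝ) ≤ 4)
    have := Real.exp_pos (-(n : ℝ))
    linarith
  · have hsub : {ω | ∃ j, ¬ |smoothGrad (obsZ x ς ω) (obsY x ξ 0 ω) γ 0 j| ≤ lam / 4}
        ⊆ (⋃ j : Fin p, {ω | n * (64 * q * R) < |∑ i, ⟪EuclideanSpace.single j (1 : ℝ),
          obsZ x ς ω i⟫ * ξ i ω| ∧ ∑ i, ξ i ω ^ 2 ≤ n * (33 * (K * σ ^ 2))})
          ∪ {ω | n * (32 * (K * σ ^ 2)) < |∑ i, ξ i ω ^ 2 - n * (σ : ℝ) ^ 2|} := by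
      rintro ω ⟨j, hj⟩
      by_cases hξ : ω ∈ {ω | n * (32 * (K * σ ^ 2)) < |∑ i, ξ i ω ^ 2 - n * (σ : ℝ) ^ 2|}
      · exact Or.inr hξ
      · refine Or.inl (Set.mem_iUnion.2 ⟨j, ?_, ?_⟩)
        · have := hdev j ω hj
          simpa [Finset.sum_neg_distrib] using this
        · simp only [Set.mem_ofPred_eq, not_lt] at hξ
          have h1 := (abs_le.1 hξ).2
          have h2 : n * (σ : ℝ) ^ 2 ≤ n * (K * σ ^ 2) := by
            gcongr
            exact le_mul_of_one_le_left (sq_nonneg _) hK'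
          linarith
    refine (measureReal_mono hsub).trans ((measureReal_union_le _ _).trans ?_)
    refine add_le_add ((measureReal_iUnion_fintype_le _).trans ?_) hM.measure_sum_sq_ξ_gt_le
    have hj : ∀ j : Fin p, P.real {ω | n * (64 * q * R) < |∑ i, ⟪EuclideanSpace.single j (1 : ℝ),
          obsZ x ς ω i⟫ * ξ i ω| ∧ ∑ i, ξ i ω ^ 2 ≤ n * (33 * (K * σ ^ 2))}
        ≤ 2 * Real.exp (-(2048 / 33 * Real.log p)) := by
      intro j
      -- Without noise `B` would be zero; the event is then empty, since the `ξ i` vanish on it.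
      by_cases hσ : σ = 0
      · have : {ω | n * (64 * q * R) < |∑ i, ⟪EuclideanSpace.single j (1 : ℝ),
            obsZ x ς ω i⟫ * ξ i ω| ∧ ∑ i, ξ i ω ^ 2 ≤ n * (33 * (K * (σ : ℝ) ^ 2))} = ∅ := by
          rw [Set.eq_empty_iff_forall_notMem]
          rintro ω ⟨h1, h2⟩
          simp only [hσ, NNReal.coe_zero, ne_eq, OfNat.ofNat_ne_zero, not_false_eq_true, zero_pow,
            mul_zero] at h2
          have h3 := (Finset.sum_eq_zero_iff_of_nonneg fun i _ => sq_nonneg (ξ i ω)).1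
            (le_antisymm h2 (Finset.sum_nonneg fun i _ => sq_nonneg (ξ i ω)))
          have h4 : ∑ i, ⟪EuclideanSpace.single j (1 : ℝ), obsZ x ς ω i⟫ * ξ i ω = 0 :=
            Finset.sum_eq_zero fun i hi => by
              rw [pow_eq_zero_iff two_ne_zero |>.1 (h3 i hi), mul_zero]
          rw [h4, abs_zero] at h1
          have : 0 ≤ n * (64 * q * R) := by positivity
          linarith
        rw [this, measureReal_empty]
        positivity
      · have hσ0 : (0 : ℝ) < σ := by exact_mod_cast pos_iff_ne_zero.2 hσ
        have hV0' : (0 : ℝ) < V := hV0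
        have h := hM.measure_correlation_ξ_gt_le hS hK (V := V) le_rfl (by exact_mod_cast hV0')
          (u := EuclideanSpace.single j (1 : ℝ)) (by simp) (τ := 64 * q * R)
          (B := 33 * (K * (σ : ℝ) ^ 2)) (by positivity) (by positivity)
        have e1 : ‖(EuclideanSpace.single j (1 : ℝ) : Vec p)‖ = 1 := by simp
        have e2 : R ^ 2 = K * V * (K * σ ^ 2) := by
          rw [hR, Real.sq_sqrt (by positivity)]
          simp
        have e3 : (n : ℝ) * (64 * q * R) ^ 2 / (2 * (K * V * (33 * (K * σ ^ 2))))
            = 2048 / 33 * Real.log p := by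
          rw [mul_pow, mul_pow, hq2, e2]; field_simp; ring
        rw [e1, one_pow, mul_one, e3] at h
        exact h
    refine (Finset.sum_le_sum fun j _ => hj j).trans ?_
    rw [Finset.sum_const, Finset.card_univ, Fintype.card_fin, nsmul_eq_mul]
    have := mul_exp_neg_log_le hp (by norm_num : (2 : ℝ) ≤ 2048 / 33)
    linarith

end AdditiveNoiseModel

end Probability

/-! ### The curvature constant and the choice of the word length -/

theorem curvature_eq {σmin σmax γ : ℝ} (hmin : 0 < σmin) (hle : σmin ≤ σmax) (hγ : 0 ≤ γ) :
    curvature σmin σmax γ = σmin / (σmin / (σmax + γ)) ^ 2 := by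
  have hV : 0 < σmax + γ := by linarith
  have h1 : 1 ≤ (σmax + γ) / σmin := by rw [le_div_iff₀ hmin]; linarith
  rw [curvature, max_eq_left (one_le_pow₀ h1)]
  field_simp

theorem curvature_nonneg {σmin σmax γ : ℝ} (hmin : 0 ≤ σmin) : 0 ≤ curvature σmin σmax γ :=
  mul_nonneg hmin (le_max_of_le_right zero_le_one)

theorem le_curvature {σmin σmax γ : ℝ} (hmin : 0 ≤ σmin) : σmin ≤ curvature σmin σmax γ :=
  le_mul_of_one_le_right hmin (le_max_right _ _)

/-- The length of the words which have to be controlled for the restricted eigenvalue condition. -/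
noncomputable def wordLength (K r : ℝ) (n p : ℕ) : ℕ :=
  ⌊n * r ^ 2 / (8192 * K ^ 2) / Real.log (2 * p)⌋₊

theorem wordLength_mul_log_le {K r : ℝ} {n p : ℕ} (hp : 1 ≤ p) :
    wordLength K r n p * Real.log (2 * p) ≤ n * r ^ 2 / (8192 * K ^ 2) := by
  have hp' : (1 : ℝ) ≤ p := by exact_mod_cast hp
  have hlog : 0 < Real.log (2 * p) := Real.log_pos (by linarith)
  rw [← le_div_iff₀ hlog]
  exact Nat.floor_le (by positivity)

theorem restricted_eigenvalue_of_wordLength {n p : ℕ} {S : Matrix (Fin p) (Fin p) ℝ} {γ K : ℝ}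
    {z : Fin n → Vec p} (hS : S.PosSemidef) (hn : 1 ≤ n) (hp : 2 ≤ p) (hK : 1 ≤ K)
    (hmin : 0 < sigmaMin hS) (hγ0 : 0 ≤ γ) (hγ : 4 * γ ≤ sigmaMin hS)
    (h : ∀ w : Fin (wordLength K (sigmaMin hS / (sigmaMax hS + γ)) n p) → Fin p × Bool,
      QuadClose S γ (sigmaMin hS / 2) z (wordSum w)) (v : Vec p) :
    sigmaMin hS / 2 * ‖v‖ ^ 2 - 65536 * K ^ 2 * curvature (sigmaMin hS) (sigmaMax hS) γ
      * (Real.log p / n) * l1Norm v ^ 2 ≤ gram z v - γ * ‖v‖ ^ 2 := by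
  have hle := sigmaMin_le_sigmaMax hS (one_le_two.trans hp)
  rw [curvature_eq hmin hle hγ0]
  set r := sigmaMin hS / (sigmaMax hS + γ) with hr
  have hr0 : 0 < r := div_pos hmin (by linarith)
  have hn' : (0 : ℝ) < n := by exact_mod_cast hn
  have hp' : (2 : ℝ) ≤ p := by exact_mod_cast hp
  have hlogp : 0 < Real.log p := Real.log_pos (by linarith)
  -- This is where `2 ≤ p` is needed.
  have hlog2 : Real.log (2 * p) ≤ 2 * Real.log p := by
    rw [Real.log_mul (by norm_num) (by positivity)]
    have := Real.log_le_log (by norm_num) hp'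
    linarith
  have hlog2' : 0 < Real.log (2 * p) := Real.log_pos (by linarith)
  set ℓ := Real.log (2 * p)
  set X := n * r ^ 2 / (8192 * K ^ 2) / ℓ with hX
  have hX0 : 0 < X := by positivity
  have hτ : 4 * sigmaMin hS / X
      ≤ 65536 * K ^ 2 * (sigmaMin hS / r ^ 2) * (Real.log p / n) := by
    calc 4 * sigmaMin hS / X = 32768 * K ^ 2 * (sigmaMin hS / r ^ 2) / n * ℓ := by
          rw [hX]; field_simp; ring
      _ ≤ 32768 * K ^ 2 * (sigmaMin hS / r ^ 2) / n * (2 * Real.log p) := by gcongr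
      _ = _ := by ring
  have hl1 : ‖v‖ ^ 2 ≤ l1Norm v ^ 2 := by
    have := norm_le_l1Norm v
    gcongr
  have hXlt : X < wordLength K r n p + 1 := Nat.lt_floor_add_one X
  by_cases hk : 2 ≤ wordLength K r n p
  · have h1 := restricted_eigenvalue_of_words hS hn hk h v
    have hk' : (2 : ℝ) ≤ wordLength K r n p := by exact_mod_cast hk
    have h2 : sigmaMin hS / (wordLength K r n p - 1) ≤ 4 * sigmaMin hS / X := by
      rw [div_le_div_iff₀ (by linarith) hX0]
      -- From `X < k + 1` and `k ≥ 2`.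
      have h3 : X ≤ 4 * (wordLength K r n p - 1) := by linarith
      have := mul_le_mul_of_nonneg_left h3 hmin.le
      linarith
    have h4 := mul_le_mul_of_nonneg_right (h2.trans hτ) (sq_nonneg (l1Norm v))
    linarith
  -- If the sample is too small for words of length two, the `ℓ₁` term alone exceeds `σ_min ‖v‖²`,
  -- and `gram ≥ 0` with `4γ ≤ σ_min` suffices.
  · have hk' : (wordLength K r n p : ℝ) ≤ 1 := by
      exact_mod_cast Nat.lt_succ_iff.1 (not_le.1 hk)
    have h2 : sigmaMin hS ≤ 4 * sigmaMin hS / X := by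
      rw [le_div_iff₀ hX0]
      have := mul_le_mul_of_nonneg_left (by linarith : X ≤ 4) hmin.le
      linarith
    have h4 := mul_le_mul_of_nonneg_right (h2.trans hτ) (sq_nonneg (l1Norm v))
    have h5 := mul_le_mul_of_nonneg_left hl1 hmin.le
    have h6 := gram_nonneg z v
    have h7 := mul_le_mul_of_nonneg_right hγ (sq_nonneg ‖v‖)
    have h8 := mul_nonneg hmin.le (sq_nonneg ‖v‖)
    linarith

/-! ### The good event -/

section Event

variable {Ω : Type*} [MeasurableSpace Ω] {P : Measure Ω} [IsProbabilityMeasure P]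
variable {n p : ℕ} {K : ℝ≥0} {S : Matrix (Fin p) (Fin p) ℝ} {γ σ : ℝ≥0}
  {x ς : Fin n → Ω → Vec p} {ξ : Fin n → Ω → ℝ}

/-- With high probability the sample is good. -/
theorem AdditiveNoiseModel.exists_good_event (hM : AdditiveNoiseModel P K S γ σ x ς ξ)
    (hS : S.PosSemidef) (hK : 1 ≤ K) (hn : 1 ≤ n) (hp : 2 ≤ p) (hmin : 0 < sigmaMin hS)
    (hγ : 4 * (γ : ℝ) ≤ sigmaMin hS) {wstar : Vec p} {ρ lam : ℝ} (hρ : 0 < ρ)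
    (hlam0 : 144 * (65536 * K ^ 2) * ρ * curvature (sigmaMin hS) (sigmaMax hS) γ
      * (Real.log p / n) ≤ lam)
    (hlam : 256 * K * noiseLevel (sigmaMax hS) γ σ ‖wstar‖ * √(Real.log p / n) ≤ lam)
    (hcase : Real.log p ≤ n ∨ wstar = 0) :
    ∃ E : Set Ω, MeasurableSet E ∧
      1 - 6 * Real.exp (-(1 / (8192 * (K : ℝ) ^ 2)) * n *
          min (sigmaMin hS ^ 2 / (sigmaMax hS + γ) ^ 2) 1)
        - 2 * Real.exp (-1 * Real.log p) ≤ P.real E ∧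
      ∀ ω ∈ E,
        GoodSample (obsZ x ς ω) (obsY x ξ wstar ω) γ ρ lam (sigmaMin hS / 2)
          (65536 * K ^ 2 * curvature (sigmaMin hS) (sigmaMax hS) γ * (Real.log p / n)) wstar ∧
        ∀ L : Fin n → ℝ, (∀ i, ‖obsZ x ς ω i‖ ^ 2 ≤ L i) → 3 * (γ : ℝ) ≤ (∑ i, L i) / n := by
  have hp1 : 1 ≤ p := one_le_two.trans hp
  have hle := sigmaMin_le_sigmaMax hS hp1
  have hK' : (1 : ℝ) ≤ K := by exact_mod_cast hK
  have hn' : (0 : ℝ) < n := by exact_mod_cast hn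
  have hlogp : 0 < Real.log p := Real.log_pos (by exact_mod_cast hp)
  set r := sigmaMin hS / (sigmaMax hS + γ) with hr
  set k := wordLength K r n p with hk
  -- One unit direction is controlled separately, for the bound on the average smoothness: the word
  -- length may be zero, and then the words say nothing.
  set u : Vec p := EuclideanSpace.single ⟨0, hp1⟩ (1 : ℝ) with hu
  have hu1 : ‖u‖ = 1 := by simp [hu]
  set Q : Set Ω := {ω | QuadClose S γ (sigmaMin hS / 2) (obsZ x ς ω) u} with hQ
  set W : Set Ω := {ω | ∀ w : Fin k → Fin p × Bool,
    QuadClose S γ (sigmaMin hS / 2) (obsZ x ς ω) (wordSum w)} with hW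
  set D : Set Ω := {ω | ∀ j, |smoothGrad (obsZ x ς ω) (obsY x ξ wstar ω) γ wstar j| ≤ lam / 4}
    with hD
  have mQ : MeasurableSet Q := hM.measurableSet_quadClose _ _
  have mW : MeasurableSet W := by
    have : W = ⋂ w : Fin k → Fin p × Bool,
        {ω | QuadClose S γ (sigmaMin hS / 2) (obsZ x ς ω) (wordSum w)} := by ext; simp [hW]
    rw [this]
    exact MeasurableSet.iInter fun w => hM.measurableSet_quadClose _ _
  have mD : MeasurableSet D := by
    have : D = ⋂ j : Fin p,
        {ω | |smoothGrad (obsZ x ς ω) (obsY x ξ wstar ω) γ wstar j| ≤ lam / 4} := by ext; simp [hD]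
    rw [this]
    refine MeasurableSet.iInter fun j => measurableSet_le ?_ measurable_const
    simp only [smoothGrad_obs]
    have h1 := fun i => hM.measurable_inner_z i (EuclideanSpace.single j 1)
    have h2 := fun i => hM.measurable_inner_ς i wstar
    have h3 := hM.measurable_ξ
    fun_prop
  have mE : MeasurableSet (Q ∩ W ∩ D) := (mQ.inter mW).inter mD
  refine ⟨Q ∩ W ∩ D, mE, ?_, ?_⟩
  · have hcompl : P.real (Q ∩ W ∩ D)ᶜ ≤ P.real Qᶜ + P.real Wᶜ + P.real Dᶜ := by
      rw [Set.compl_inter, Set.compl_inter]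
      exact (measureReal_union_le _ _).trans (add_le_add_left (measureReal_union_le _ _) _)
    rw [probReal_compl_eq_one_sub mE] at hcompl
    have bQ : P.real Qᶜ ≤ 2 * Real.exp (-(n * r ^ 2 / (4096 * K ^ 2))) :=
      hM.measure_not_quadClose_le hS hK hp1 hmin u
    have bW : P.real Wᶜ ≤ 2 * Real.exp (-(n * r ^ 2 / (8192 * K ^ 2))) := by
      have h1 := hM.measure_exists_word_not_quadClose_le (k := k) hS hK hp1 hmin
        (wordLength_mul_log_le hp1)
      have h2 : Wᶜ = {ω | ∃ w : Fin k → Fin p × Bool,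
          ¬ QuadClose S γ (sigmaMin hS / 2) (obsZ x ς ω) (wordSum w)} := by ext; simp [hW]
      rwa [h2]
    have bD : P.real Dᶜ ≤ 2 * Real.exp (-Real.log p) + 2 * Real.exp (-n) := by
      have h1 := hM.measure_exists_deviation_gt_le hS hK hn hp1 hmin hlam hcase
      have h2 : Dᶜ = {ω | ∃ j,
          ¬ |smoothGrad (obsZ x ς ω) (obsY x ξ wstar ω) γ wstar j| ≤ lam / 4} := by
        ext; simp [hD]
      rwa [h2]
    set m := min (sigmaMin hS ^ 2 / (sigmaMax hS + γ) ^ 2) 1 with hm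
    have hm0 : 0 ≤ m := le_min (by positivity) zero_le_one
    have hm1 : m ≤ 1 := min_le_right _ _
    have hmr : m ≤ r ^ 2 := by rw [hr, div_pow]; exact min_le_left _ _
    have hK2 : (1 : ℝ) ≤ K ^ 2 := one_le_pow₀ hK'
    have e1 : Real.exp (-(n * r ^ 2 / (4096 * K ^ 2)))
        ≤ Real.exp (-(1 / (8192 * (K : ℝ) ^ 2)) * n * m) := by
      refine Real.exp_le_exp.2 ?_
      have : n * m / (8192 * K ^ 2) ≤ n * r ^ 2 / (4096 * K ^ 2) := by
        gcongr
        norm_num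
      calc _ ≤ -(n * m / (8192 * (K : ℝ) ^ 2)) := by linarith
        _ = _ := by ring
    have e2 : Real.exp (-(n * r ^ 2 / (8192 * K ^ 2)))
        ≤ Real.exp (-(1 / (8192 * (K : ℝ) ^ 2)) * n * m) := by
      refine Real.exp_le_exp.2 ?_
      have : n * m / (8192 * K ^ 2) ≤ n * r ^ 2 / (8192 * K ^ 2) := by gcongr
      calc _ ≤ -(n * m / (8192 * (K : ℝ) ^ 2)) := by linarith
        _ = _ := by ring
    have e3 : Real.exp (-(n : ℝ)) ≤ Real.exp (-(1 / (8192 * (K : ℝ) ^ 2)) * n * m) := by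
      refine Real.exp_le_exp.2 ?_
      have h1 : n * m / (8192 * (K : ℝ) ^ 2) ≤ n := by
        rw [div_le_iff₀ (by positivity)]
        exact mul_le_mul_of_nonneg_left (by linarith) hn'.le
      calc _ ≤ -(n * m / (8192 * (K : ℝ) ^ 2)) := by linarith
        _ = _ := by ring
    -- The coefficient 6 collects two each from `Q`, `W` and the `exp (-n)` part of `D`.
    rw [neg_one_mul]
    linarith
  · rintro ω ⟨⟨hωQ, hωW⟩, hωD⟩
    have hM0 : 0 < curvature (sigmaMin hS) (sigmaMax hS) γ :=
      hmin.trans_le (le_curvature hmin.le)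
    refine ⟨⟨lt_of_lt_of_le (by positivity) hlam0, by positivity, by linarith,
      restricted_eigenvalue_of_wordLength hS hn hp hK' hmin γ.coe_nonneg hγ hωW, hωD⟩, ?_⟩
    intro L hL
    exact three_mul_le_average hS hn hL hu1 hγ hωQ

end Event

theorem IsSparse.eq_zero {p : ℕ} {w : Vec p} (h : IsSparse 0 w) : w = 0 := by
  have h1 := (Set.ncard_eq_zero (Set.toFinite _)).1 (Nat.le_zero.1 h)
  ext j
  by_contra hj
  exact Set.notMem_empty j (h1 ▸ hj)

end CorrectedLasso

/-! ### The main theorem -/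

theorem corollary4 (K : ℝ≥0) (hK : 1 ≤ K) :
    ∃ c₀ c₁ c₂ c₃ c₄ c₅ c₆ c₇ : ℝ, 0 < c₀ ∧ 0 < c₁ ∧ 0 < c₂ ∧ 0 < c₃ ∧ 0 < c₄ ∧ 0 < c₅ ∧ 0 < c₆ ∧
      0 < c₇ ∧
    ∀ (Ω : Type*) [MeasurableSpace Ω] (P : Measure Ω) [IsProbabilityMeasure P]
      (n p s : ℕ) (_ : 1 ≤ n) (_ : 1 ≤ p)
      (S : Matrix (Fin p) (Fin p) ℝ) (hS : S.PosSemidef) (γ σ : ℝ≥0)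
      (x ς : Fin n → Ω → CorrectedLasso.Vec p) (ξ : Fin n → Ω → ℝ)
      (_ : CorrectedLasso.AdditiveNoiseModel P K S γ σ x ς ξ)
      (wstar : CorrectedLasso.Vec p) (_ : CorrectedLasso.IsSparse s wstar)
      (ρ lam lam' : ℝ) (_ : 0 < ρ) (_ : wstar ∈ CorrectedLasso.feasible p ρ)
      (_ : max
          (c₀ * ρ * CorrectedLasso.curvature (CorrectedLasso.sigmaMin hS)
            (CorrectedLasso.sigmaMax hS) γ * (Real.log p / n))
          (c₁ * CorrectedLasso.noiseLevel (CorrectedLasso.sigmaMax hS) γ σ ‖wstar‖ *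
            √(Real.log p / n)) ≤ lam)
      (_ : 0 < lam')
      (_ : lam' ≤ CorrectedLasso.kappaTilde c₂ (CorrectedLasso.sigmaMin hS)
        (CorrectedLasso.sigmaMax hS) γ s n p - γ),
    ∃ E : Set Ω, MeasurableSet E ∧
      1 - c₃ * Real.exp (-c₄ * n * min (CorrectedLasso.sigmaMin hS ^ 2 /
            (CorrectedLasso.sigmaMax hS + γ) ^ 2) 1)
        - c₅ * Real.exp (-c₆ * Real.log p) ≤ P.real E ∧
      ∀ ω ∈ E,
        let z := CorrectedLasso.obsZ x ς ω
        let y := CorrectedLasso.obsY x ξ wstar ω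
        let F := CorrectedLasso.objective z y γ lam
        ∀ what ∈ CorrectedLasso.feasible p ρ, IsMinOn F (CorrectedLasso.feasible p ρ) what →
        ∀ L : Fin n → ℝ,
          (∀ i, CorrectedLasso.IsSmooth (CorrectedLasso.loss (z i) (y i)) (L i)) →
        ∀ η : ℝ, 0 < η →
          η ≤ min (1 / (16 * (lam' + (∑ i, L i) / n))) (1 / (4 * lam' * (n + 1))) →
        let A := CorrectedLasso.sdca z y γ ρ lam lam' L η
        ∀ vhat : CorrectedLasso.Vec p,
          A.g what + CorrectedLasso.conj A.Ω A.g vhat = ⟪what, vhat⟫ →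
        let δ := CorrectedLasso.tolerance c₇ (CorrectedLasso.sigmaMin hS)
          (CorrectedLasso.sigmaMax hS) γ s n what wstar
        ∀ (a₀ : Fin (n + 1) → CorrectedLasso.Vec p) (t : ℕ),
          -- path by path: `C_t` up to the first time the gap is at most `δ`
          A.expect t (Set.indicator
              {I | ∀ (k : ℕ) (hk : k < t), δ < F (A.runTake a₀ k hk.le I).w - F what}
              (fun I => A.potC what vhat (A.run a₀ t I)))
            ≤ (1 - η * lam') ^ t * A.potC what vhat (A.init a₀) ∧
          -- in mean: as long as the expected gap exceeds `δ`
          ((∀ k < t, δ < A.expect k (fun I => F (A.run a₀ k I).w) - F what) →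
            A.expect t (fun I => A.potC what vhat (A.run a₀ t I))
              ≤ (1 - η * lam') ^ t * A.potC what vhat (A.init a₀)) := by
  have hK' : (1 : ℝ) ≤ K := by exact_mod_cast hK
  -- With `τ = 65536 K² M log p / n`, the factors 144, 128 and 1440 are those of
  -- `GoodSample.tol_le`, of the curvature loss and of the tolerance; `256 K` is four times the
  -- deviation constant `64 K`.
  refine ⟨144 * (65536 * K ^ 2), 256 * K, 128 * (65536 * K ^ 2), 6, 1 / (8192 * K ^ 2), 2, 1,
    1440 * (65536 * K ^ 2), by positivity, by positivity, by positivity, by norm_num, by positivity,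
    by norm_num, by norm_num, by positivity, ?_⟩
  intro Ω _ P _ n p s hn hp S hS γ σ x ς ξ hM wstar hs ρ lam lam' hρ hstar hlam hlam'0 hlam'
  rcases Nat.lt_or_ge p 2 with hp2 | hp2
  · obtain rfl : p = 1 := by omega
    -- For `p = 1` the claimed probability is negative, because `log p = 0` and `c₅ = 2`.
    refine ⟨∅, MeasurableSet.empty, ?_, fun ω hω => hω.elim⟩
    simp only [Nat.cast_one, Real.log_one, mul_zero, Real.exp_zero, measureReal_empty]
    have := Real.exp_pos (-(1 / (8192 * (K : ℝ) ^ 2)) * n *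
      min (CorrectedLasso.sigmaMin hS ^ 2 / (CorrectedLasso.sigmaMax hS + γ) ^ 2) 1)
    linarith
  have hn' : (0 : ℝ) < n := by exact_mod_cast hn
  have hlogp : 0 < Real.log p := Real.log_pos (by exact_mod_cast hp2)
  have hM0 := CorrectedLasso.curvature_nonneg (σmax := CorrectedLasso.sigmaMax hS) (γ := γ)
    (CorrectedLasso.sigmaMin_nonneg hS)
  have hγ0 := γ.coe_nonneg
  rw [CorrectedLasso.kappaTilde] at hlam'
  set M := CorrectedLasso.curvature (CorrectedLasso.sigmaMin hS) (CorrectedLasso.sigmaMax hS) γ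
    with hMdef
  have hterm : 0 ≤ 128 * (65536 * (K : ℝ) ^ 2) * M * (s * Real.log p / n) := by positivity
  -- Positivity of `lam'` yields `σ_min > 4γ`, so nondegeneracy of `S` need not be assumed.
  have hmin : 0 < CorrectedLasso.sigmaMin hS := by linarith
  have hγ : 4 * (γ : ℝ) ≤ CorrectedLasso.sigmaMin hS := by linarith
  -- If `s ≥ 1`, positivity of `lam'` bounds `c₂ M s log p / n` by `σ_min / 2`, and `c₂ M ≥ σ_min`
  -- then gives `log p ≤ n`.
  have hcase : Real.log p ≤ n ∨ wstar = 0 := by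
    rcases Nat.eq_zero_or_pos s with rfl | hs0
    · exact Or.inr hs.eq_zero
    · left
      have hs1 : (1 : ℝ) ≤ s := by exact_mod_cast hs0
      have hK2 : (1 : ℝ) ≤ K ^ 2 := one_le_pow₀ hK'
      have h1 : CorrectedLasso.sigmaMin hS * (Real.log p / n)
          ≤ 128 * (65536 * (K : ℝ) ^ 2) * M * (s * Real.log p / n) := by
        have h2 : CorrectedLasso.sigmaMin hS ≤ 128 * (65536 * (K : ℝ) ^ 2) * M :=
          (CorrectedLasso.le_curvature hmin.le).trans
            (le_mul_of_one_le_left hM0 (by linarith))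
        have h3 : Real.log p / n ≤ s * Real.log p / n := by
          gcongr
          exact le_mul_of_one_le_left hlogp.le hs1
        gcongr
      have h2 : CorrectedLasso.sigmaMin hS * (Real.log p / n)
          ≤ CorrectedLasso.sigmaMin hS * 1 := by linarith
      exact (div_le_one hn').1 (le_of_mul_le_mul_left h2 hmin)
  obtain ⟨E, mE, hE, hgood⟩ := hM.exists_good_event hS hK hn hp2 hmin hγ (wstar := wstar) hρ
    ((le_max_left _ _).trans hlam) ((le_max_right _ _).trans hlam) hcase
  refine ⟨E, mE, hE, fun ω hω => ?_⟩
  obtain ⟨hG, hLb⟩ := hgood ω hω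
  intro z y F what hwhat hFmin L hL η hη hη' A vhat hv δ a₀ t
  have hL' : ∀ i, ‖z i‖ ^ 2 ≤ L i := fun i => CorrectedLasso.norm_sq_le_of_isSmooth hp (hL i)
  have hreg : A.Regular := CorrectedLasso.regular_sdca hL' hn hlam'0 hγ0 hG.lam_pos.le hρ hη
    (hη'.trans (min_le_right _ _))
  have hgap := CorrectedLasso.gapCondition_sdca hL' hn hlam'0 hγ0 hG
    (by
      have e : 128 * (65536 * (K : ℝ) ^ 2 * M * (Real.log p / n) * s)
        = 128 * (65536 * (K : ℝ) ^ 2) * M * (s * Real.log p / n) := by ring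
      linarith) hs hstar hwhat hFmin hη (hη'.trans (min_le_left _ _)) (hLb L hL')
  have hδ : 1440 * (65536 * (K : ℝ) ^ 2 * M * (Real.log p / n) * s) * ‖what - wstar‖ ^ 2 = δ := by
    simp only [δ, CorrectedLasso.tolerance, ← hMdef]
    ring
  rw [hδ] at hgap
  exact ⟨CorrectedLasso.SDCA.expect_indicator_potC_le hreg hwhat hv (by norm_num) hgap a₀ t,
    fun ht => CorrectedLasso.SDCA.expect_potC_le hreg hwhat hv (by norm_num) hgap a₀ t ht⟩
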